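/- For a convex body $K\subset\mathbb R^2$ (compact, convex, with non-empty interior), let $A$ denote area, let $[x_1,\dots,x_n]$ denote the convex hull of $x_1,\dots,x_n$, let $\gamma(K)=A(K)^{-1}\int_K x\,dx$ be the centroid of $K$, and for $p\ge 1$ put $$E^p_3(K)=A(K)^{-3-p}\int_K\int_K\int_K A([x_1,x_2,x_3])^p\,dx_1dx_2dx_3,\qquad E^p_*(K)=A(K)^{-2-p}\int_K\int_K A([\gamma(K),x_1,x_2])^p\,dx_1dx_2 .$$ For convex bodies $K,M\subset\mathbb R^2$ the Banach–Mazur distance is $$\delta_{BM}(K,M)=\min\{\lambda\ge 1:\ K-x\subset\Phi(M-y)\subset\lambda(K-x)\ \text{for some }\Phi\in GL_2(\mathbb R),\ x,y\in\mathbb R^2\}.$$ Let $T^2\subset\mathbb R^2$ be a (non-degenerate) triangle; none of the quantities $E^p_3(T^2)$, $E^p_*(T^2)$, $\delta_{BM}(K,T^2)$ depends on its choice. **Theorem.** (i) There is an absolute constant $c>0$ such that if $K$ is a planar convex body with $\delta_{BM}(K,T^2)=1+\delta$ for some $\delta>0$, and $p\ge 1$ is real, then $$E^p_*(K)\le(1-c^p\delta^2)\,E^p_*(T^2)\qquad\text{and}\qquad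 E^p_3(K)\le(1-c^p\delta^2)\,E^p_3(T^2).$$ (ii) The estimate is asymptotically sharp as $\delta\to 0$: there are absolute constants $C,\delta_0>0$ such that for every $\delta\in(0,\delta_0)$ there is a planar convex body $K$ with $\delta_{BM}(K,T^2)=1+\delta$ such that, for all real $p\ge 1$, $$E^p_*(K)\ge(1-C^p\delta^2)\,E^p_*(T^2)\qquad\text{and}\qquad E^p_3(K)\ge(1-C^p\delta^2)\,E^p_3(T^2).$$ -/

import Mathlib

open MeasureTheory

noncomputable section

namespace RandomSimplex

/-- The centroid `γ(K) = V(K)⁻¹ ∫_K x dx` of a set of finite positive volume. -/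
def centroid {d : ℕ} (K : Set (EuclideanSpace ℝ (Fin d))) : EuclideanSpace ℝ (Fin d) :=
  ⨍ x in K, x

/-- `V([x₁, …, xₙ])` for a finite family of points: the `d`-dimensional volume of its convex hull. -/
def hullVolume {d : ℕ} {ι : Type} (x : ι → EuclideanSpace ℝ (Fin d)) : ℝ :=
  volume.real (convexHull ℝ (Set.range x))

/-- `E^p_n(K) = V(K)^(-n-p) ∫_K … ∫_K V([x₁, …, xₙ])^p dx₁ … dxₙ`, the integral being taken over
`Kⁿ` with respect to the product of Lebesgue measures. -/
def momentRandom {d : ℕ} (n : ℕ) (p : ℝ) (K : Set (EuclideanSpace ℝ (Fin d))) : ℝ :=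
  volume.real K ^ (-(n : ℝ) - p) *
    ∫ x : Fin n → EuclideanSpace ℝ (Fin d) in Set.univ.pi (fun _ => K), hullVolume x ^ p

/-- `E^p_z(K) = V(K)^(-d-p) ∫_K … ∫_K V([z, x₁, …, x_d])^p dx₁ … dx_d`, the simplex having one
vertex fixed at `z`. -/
def momentFixed {d : ℕ} (p : ℝ) (z : EuclideanSpace ℝ (Fin d))
    (K : Set (EuclideanSpace ℝ (Fin d))) : ℝ :=
  volume.real K ^ (-(d : ℝ) - p) *
    ∫ x : Fin d → EuclideanSpace ℝ (Fin d) in Set.univ.pi (fun _ => K),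
      hullVolume (Fin.cons z x : Fin (d + 1) → EuclideanSpace ℝ (Fin d)) ^ p

/-- `E^p_*(K)`: the fixed vertex is the centroid of `K`. -/
def momentCentroid {d : ℕ} (p : ℝ) (K : Set (EuclideanSpace ℝ (Fin d))) : ℝ :=
  momentFixed p (centroid K) K

/-- The numbers `lam ≥ 1` with `K - x ⊆ Φ (M - y) ⊆ lam (K - x)` for some invertible linear `Φ` and
some points `x`, `y`. -/
def banachMazurSet {d : ℕ} (K M : Set (EuclideanSpace ℝ (Fin d))) : Set ℝ :=
  {lam : ℝ | 1 ≤ lam ∧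
    ∃ (Φ : EuclideanSpace ℝ (Fin d) ≃ₗ[ℝ] EuclideanSpace ℝ (Fin d))
      (x y : EuclideanSpace ℝ (Fin d)),
      (fun z => z - x) '' K ⊆ (fun z => Φ (z - y)) '' M ∧
      (fun z => Φ (z - y)) '' M ⊆ (fun z => lam • (z - x)) '' K}

/-- The Banach-Mazur distance (for convex bodies the infimum is attained). -/
def banachMazurDist {d : ℕ} (K M : Set (EuclideanSpace ℝ (Fin d))) : ℝ :=
  sInf (banachMazurSet K M)

/-- A (nondegenerate) triangle in the plane. -/
def IsTriangle (T : Set (EuclideanSpace ℝ (Fin 2))) : Prop :=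
  ∃ v : Fin 3 → EuclideanSpace ℝ (Fin 2),
    AffineIndependent ℝ v ∧ T = convexHull ℝ (Set.range v)

end RandomSimplex

end

/-!
The plane is treated as `ℝ × ℝ`; `cr a b c` is twice the signed area of the triangle `abc`, the two
moments are `Es p` and `E3 p`, and all functionals involved are affinely invariant.

**The upper bound.** Besides the moments consider `Th K`, twice the determinant of the matrix of second
moments of `K` about its centroid, divided by `area K ^ 4`; up to a factor it is `Es 2`. If the part of `K` above a
line is sheared parallel to that line (`sh s t`), the area is preserved and every `cr x y z` is an
affine function of the parameter `t`. Hence all three functionals are convex along such a family as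
long as its members are convex (`ShearConvex`). For the moments this convexity is quantitative: the
convexity defect of `Es p` and `E3 p` is at least `c ^ p` times that of `Th`
(`shearConvex_moments`). The reason is that a large part of the body does not move, and integrating
`|·| ^ p` against a static chord produces the function `psi`, which is uniformly convex.

A vertex of a convex polygon can be moved by such a shear, parallel to the line through its
neighbours, in both directions until one of the neighbours becomes redundant (`polygon_move`). By
induction on the number of vertices a shear-convex affinely invariant functional is therefore maximal
at triangles (`polygon_le_T0`); applied to `Es p - c ^ p * Th` and to `E3 p - c ^ p * Th` this bounds
the deficit of the moments from below by `c ^ p` times the deficit of `Th`, uniformly in `p`.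

It remains to prove stability for the single functional `Th`. Let `eta K` be half of the relative
area deficit of `K` in a smallest triangle containing it. The midpoints of the sides of such a triangle
belong to `K` (`MinIn.toMid`), and if `eta K` is small then the missing points are, seen from these
midpoints, terminal segments of rays; integrating the sum of squares of the barycentric coordinates
along the rays gives `Th K ≤ Th T0 - eta K / 108` (`Th_near`). If `eta K` is not small, the maximum
principle applies again: a motion of a vertex is stopped when `eta` reaches a fixed value
(`Th_polygon_far`). Approximation by polygons extends the estimate to all bodies
(`body_stability`). Finally `eta K < τ ^ 2` forces `K` to contain a homothetic copy of the triangle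
with ratio `1 - 3 τ`, so the squared distance to a triangle is at most a multiple of `eta`
(`sq_le_eta`). This gives `plane_stability`.

**The sharpness.** Cutting a corner of size `ε` off the standard triangle gives a body (`trunc ε`)
whose distance to a triangle is continuous in `ε` and at least `√(1 + ε)`, by comparison of the areas
of inscribed and circumscribed triangles, so that every small `δ` is attained with `ε ≤ 3 δ`. The area
removed is `ε ^ 2 / 2`, and both moments change by at most a multiple of `p * ε ^ 2`. This gives
`plane_sharp`.
-/

noncomputable section
namespace PlaneBody
open Set Filter Topology

/-! ### Areas, frames and moments in coordinates -/

/-- Twice the signed area of the triangle `abc`. -/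
def cr (a b c : ℝ × ℝ) : ℝ := (b.1 - a.1) * (c.2 - a.2) - (b.2 - a.2) * (c.1 - a.1)

/-- The area of a planar set. -/
def area (K : Set (ℝ × ℝ)) : ℝ := volume.real K

/-- The affine map taking the origin to `o`, with linear part taking the standard basis vectors to
`u` and `v`. -/
def aff (o u v : ℝ × ℝ) : (ℝ × ℝ) →ᵃ[ℝ] (ℝ × ℝ) :=
  ((LinearMap.fst ℝ ℝ ℝ).smulRight u + (LinearMap.snd ℝ ℝ ℝ).smulRight v).toAffineMap
    + AffineMap.const ℝ (ℝ × ℝ) o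

/-- The determinant of the linear part of `aff o u v`. -/
def det2 (u v : ℝ × ℝ) : ℝ := u.1 * v.2 - u.2 * v.1

@[simp] lemma aff_fst (o u v z : ℝ × ℝ) : (aff o u v z).1 = z.1 * u.1 + z.2 * v.1 + o.1 := by
  simp [aff]

@[simp] lemma aff_snd (o u v z : ℝ × ℝ) : (aff o u v z).2 = z.1 * u.2 + z.2 * v.2 + o.2 := by
  simp [aff]

lemma aff_cont (o u v : ℝ × ℝ) : Continuous (aff o u v) :=
  (aff o u v).continuous_of_finiteDimensional

/-- The inverse of a nondegenerate frame map is again a frame map. -/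
lemma aff_inv (o u v : ℝ × ℝ) (h : det2 u v ≠ 0) : ∃ o' u' v' : ℝ × ℝ, det2 u' v' ≠ 0 ∧
    det2 u' v' * det2 u v = 1 ∧
    (∀ z, aff o' u' v' (aff o u v z) = z) ∧ (∀ z, aff o u v (aff o' u' v' z) = z) := by
  have h' : u.1 * v.2 - u.2 * v.1 ≠ 0 := h
  set d := u.1 * v.2 - u.2 * v.1 with hd
  have e1 : det2 (v.2 / d, -u.2 / d) (-v.1 / d, u.1 / d) * det2 u v = 1 := by
    simp only [det2]; field_simp; rw [hd]; ring
  refine ⟨((-o.1 * v.2 + o.2 * v.1) / d, (o.1 * u.2 - o.2 * u.1) / d), (v.2 / d, -u.2 / d),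
    (-v.1 / d, u.1 / d), ?_, e1, ?_, ?_⟩
  · intro h0; rw [h0] at e1; simp at e1
  · intro z; ext
    · simp; field_simp; rw [hd]; ring
    · simp; field_simp; rw [hd]; ring
  · intro z; ext
    · simp; field_simp; rw [hd]; ring
    · simp; field_simp; rw [hd]; ring

lemma aff_inj (o u v : ℝ × ℝ) (h : det2 u v ≠ 0) : Function.Injective (aff o u v) := by
  obtain ⟨o', u', v', -, -, h1, -⟩ := aff_inv o u v h
  exact Function.LeftInverse.injective h1

lemma cr_aff (o u v a b c : ℝ × ℝ) :
    cr (aff o u v a) (aff o u v b) (aff o u v c) = det2 u v * cr a b c := by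
  simp [cr, det2]; ring

lemma integral_aff (o u v : ℝ × ℝ) (h : det2 u v ≠ 0) {K : Set (ℝ × ℝ)} (hK : MeasurableSet K)
    (f : ℝ × ℝ → ℝ) :
    ∫ z in aff o u v '' K, f z = |det2 u v| * ∫ z in K, f (aff o u v z) := by
  set Λ : (ℝ × ℝ) →ₗ[ℝ] (ℝ × ℝ) :=
    (LinearMap.fst ℝ ℝ ℝ).smulRight u + (LinearMap.snd ℝ ℝ ℝ).smulRight v with hΛ
  have hd : LinearMap.det Λ = det2 u v := by
    rw [← LinearMap.det_toMatrix (Module.Basis.finTwoProd ℝ), Matrix.det_fin_two]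
    simp [LinearMap.toMatrix_apply, hΛ, det2]; ring
  have hder : ∀ z ∈ K, HasFDerivWithinAt (aff o u v) (LinearMap.toContinuousLinearMap Λ) K z := by
    intro z _
    have : HasFDerivAt (fun z => LinearMap.toContinuousLinearMap Λ z + o)
        (LinearMap.toContinuousLinearMap Λ) z :=
      (LinearMap.toContinuousLinearMap Λ).hasFDerivAt.add_const o
    exact this.hasFDerivWithinAt
  rw [integral_image_eq_integral_abs_det_fderiv_smul volume hK hder (aff_inj o u v h).injOn]
  simp only [ContinuousLinearMap.det, LinearMap.coe_toContinuousLinearMap, hd, smul_eq_mul]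
  rw [integral_const_mul]

lemma area_eq_integral (K : Set (ℝ × ℝ)) : area K = ∫ _ in K, (1 : ℝ) := by
  simp [area]

lemma area_aff (o u v : ℝ × ℝ) (K : Set (ℝ × ℝ)) :
    area (aff o u v '' K) = |det2 u v| * area K := by
  have hd : LinearMap.det ((LinearMap.fst ℝ ℝ ℝ).smulRight u + (LinearMap.snd ℝ ℝ ℝ).smulRight v)
      = det2 u v := by
    rw [← LinearMap.det_toMatrix (Module.Basis.finTwoProd ℝ), Matrix.det_fin_two]
    simp [LinearMap.toMatrix_apply, det2]; ring
  have e : aff o u v '' K = (fun z => z + o) ''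
      (((LinearMap.fst ℝ ℝ ℝ).smulRight u + (LinearMap.snd ℝ ℝ ℝ).smulRight v) '' K) := by
    rw [← image_comp]; rfl
  rw [e, area, measureReal_def, image_add_right, measure_preimage_add_right,
    Measure.addHaar_image_linearMap, hd, ENNReal.toReal_mul, ENNReal.toReal_ofReal (abs_nonneg _)]
  rfl

/-- The centroid of a planar set. -/
def cen (K : Set (ℝ × ℝ)) : ℝ × ℝ := ((area K)⁻¹ * ∫ z in K, z.1, (area K)⁻¹ * ∫ z in K, z.2)

lemma clm_apply_prod (f : ℝ × ℝ →L[ℝ] ℝ) (z : ℝ × ℝ) : f z = f (1, 0) * z.1 + f (0, 1) * z.2 := by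
  have : z = z.1 • ((1 : ℝ), (0 : ℝ)) + z.2 • ((0 : ℝ), (1 : ℝ)) := by ext <;> simp
  conv_lhs => rw [this]
  rw [map_add, map_smul, map_smul, smul_eq_mul, smul_eq_mul]; ring

/-- The integral of `φ (cr o x y)` over `x, y ∈ K`, that is of `φ` at twice the signed area of the
random triangles with one vertex fixed at `o`. -/
def W (φ : ℝ → ℝ) (K : Set (ℝ × ℝ)) (o : ℝ × ℝ) : ℝ := ∫ x in K, ∫ y in K, φ (cr o x y)

lemma W_aff (φ : ℝ → ℝ) (o u v : ℝ × ℝ) (h : det2 u v ≠ 0) {K : Set (ℝ × ℝ)}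
    (hK : MeasurableSet K) (c : ℝ × ℝ) :
    W φ (aff o u v '' K) (aff o u v c) =
      |det2 u v| ^ 2 * W (fun s => φ (det2 u v * s)) K c := by
  unfold W
  rw [integral_aff o u v h hK]
  simp_rw [integral_aff o u v h hK, integral_const_mul, cr_aff]
  ring

/-- A convex body: compact, convex and with interior points. -/
structure Body (K : Set (ℝ × ℝ)) : Prop where
  cpt : IsCompact K
  cvx : Convex ℝ K
  int : (interior K).Nonempty

namespace Body
variable {K : Set (ℝ × ℝ)}

lemma meas (hK : Body K) : MeasurableSet K := hK.cpt.measurableSet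

lemma area_pos (hK : Body K) : 0 < area K := by
  have h0 : 0 < volume K :=
    lt_of_lt_of_le (isOpen_interior.measure_pos volume hK.int) (measure_mono interior_subset)
  exact ENNReal.toReal_pos h0.ne' hK.cpt.measure_lt_top.ne

lemma intOn (hK : Body K) {f : ℝ × ℝ → ℝ} (hf : Continuous f) : IntegrableOn f K :=
  hf.continuousOn.integrableOn_compact hK.cpt

lemma aff (hK : Body K) {o u v : ℝ × ℝ} (h : det2 u v ≠ 0) : Body (aff o u v '' K) := by
  refine ⟨hK.cpt.image (aff_cont o u v), hK.cvx.affine_image _, ?_⟩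
  obtain ⟨o', u', v', -, -, h1, h2⟩ := aff_inv o u v h
  let e : (ℝ × ℝ) ≃ₜ (ℝ × ℝ) :=
    ⟨⟨PlaneBody.aff o u v, PlaneBody.aff o' u' v', h1, h2⟩, aff_cont _ _ _, aff_cont _ _ _⟩
  have := (e.image_interior K)
  have h3 : interior (PlaneBody.aff o u v '' K) = PlaneBody.aff o u v '' interior K := this.symm
  rw [h3]
  exact hK.int.image _

/-- Every body is the image of a body under a given frame map. -/
lemma pull (hK : Body K) {o u v : ℝ × ℝ} (h : det2 u v ≠ 0) :
    ∃ K₀, Body K₀ ∧ K = PlaneBody.aff o u v '' K₀ ∧ K₀ = PlaneBody.aff o u v ⁻¹' K := by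
  obtain ⟨o', u', v', hd, -, h1, h2⟩ := aff_inv o u v h
  have e : PlaneBody.aff o u v '' (PlaneBody.aff o' u' v' '' K) = K := by
    rw [← image_comp]; simp [h2]
  refine ⟨PlaneBody.aff o' u' v' '' K, hK.aff hd, e.symm, ?_⟩
  ext z; constructor
  · rintro ⟨w, hw, rfl⟩; simpa [h2] using hw
  · intro hz; exact ⟨_, hz, h1 z⟩

end Body

lemma cen_aff {K : Set (ℝ × ℝ)} (hK : Body K) {o u v : ℝ × ℝ} (h : det2 u v ≠ 0) :
    cen (aff o u v '' K) = aff o u v (cen K) := by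
  have hd : |det2 u v| ≠ 0 := abs_ne_zero.mpr h
  have hA := hK.area_pos.ne'
  have hi1 : IntegrableOn (fun z : ℝ × ℝ => z.1) K := hK.intOn continuous_fst
  have hi2 : IntegrableOn (fun z : ℝ × ℝ => z.2) K := hK.intOn continuous_snd
  have key : ∀ a b c : ℝ, ∫ z in K, (z.1 * a + z.2 * b + c) =
      (∫ z in K, z.1) * a + (∫ z in K, z.2) * b + area K * c := by
    intro a b c
    rw [integral_add, integral_add, integral_mul_const, integral_mul_const]
    · simp [area]
    · exact hi1.mul_const a
    · exact hi2.mul_const b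
    · exact (hi1.mul_const a).add (hi2.mul_const b)
    · exact hK.intOn continuous_const
  ext
  · simp only [cen, area_aff, integral_aff o u v h hK.meas, aff_fst, key]
    field_simp
  · simp only [cen, area_aff, integral_aff o u v h hK.meas, aff_snd, key]
    field_simp

/-- The normalised `p`-th moment of the area of a triangle with two random vertices, the third
one being the centroid. -/
def Es (p : ℝ) (K : Set (ℝ × ℝ)) : ℝ :=
  area K ^ (-2 - p) * W (fun s => (|s| / 2) ^ p) K (cen K)

/-- The normalised `p`-th moment of the area of a random triangle. -/
def E3 (p : ℝ) (K : Set (ℝ × ℝ)) : ℝ :=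
  area K ^ (-3 - p) * ∫ o in K, W (fun s => (|s| / 2) ^ p) K o

/-- The second moment of `cr` about the centroid, normalised to be affinely invariant. It is twice
the determinant of the matrix of second moments about the centroid, divided by `area K ^ 4`. -/
def Th (K : Set (ℝ × ℝ)) : ℝ := (area K ^ 4)⁻¹ * W (fun s => s ^ 2) K (cen K)

lemma W_const_mul (c : ℝ) (φ : ℝ → ℝ) (K : Set (ℝ × ℝ)) (o : ℝ × ℝ) :
    W (fun s => c * φ s) K o = c * W φ K o := by
  simp only [W, integral_const_mul]

/-- The powers of the determinant of an affine map cancel in the normalised moments. -/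
lemma rpow_cancel {d A p k : ℝ} (hd : 0 < d) (hA : 0 < A) (n : ℕ) (hk : k = n) :
    (d * A) ^ (-k - p) * d ^ n * d ^ p = A ^ (-k - p) := by
  rw [Real.mul_rpow hd.le hA.le, ← Real.rpow_natCast d n, ← hk]
  have : d ^ (-k - p) * d ^ k * d ^ p = 1 := by
    rw [← Real.rpow_add hd, ← Real.rpow_add hd]; ring_nf; simp
  calc _ = (d ^ (-k - p) * d ^ k * d ^ p) * A ^ (-k - p) := by ring
    _ = _ := by rw [this, one_mul]

lemma phi_scale (p d s : ℝ) : (|d * s| / 2) ^ p = |d| ^ p * (|s| / 2) ^ p := by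
  rw [abs_mul, mul_div_assoc, Real.mul_rpow (abs_nonneg _) (by positivity)]

lemma Es_aff (p : ℝ) {K : Set (ℝ × ℝ)} (hK : Body K) {o u v : ℝ × ℝ} (h : det2 u v ≠ 0) :
    Es p (aff o u v '' K) = Es p K := by
  unfold Es
  rw [cen_aff hK h, W_aff _ o u v h hK.meas, area_aff]
  simp_rw [phi_scale]
  rw [W_const_mul]
  rw [← rpow_cancel (abs_pos.mpr h) hK.area_pos 2 (k := 2) (p := p) (by norm_num)]
  ring

lemma E3_aff (p : ℝ) {K : Set (ℝ × ℝ)} (hK : Body K) {o u v : ℝ × ℝ} (h : det2 u v ≠ 0) :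
    E3 p (aff o u v '' K) = E3 p K := by
  unfold E3
  rw [integral_aff o u v h hK.meas, area_aff]
  simp_rw [W_aff _ o u v h hK.meas, phi_scale, W_const_mul, integral_const_mul]
  rw [← rpow_cancel (abs_pos.mpr h) hK.area_pos 3 (k := 3) (p := p) (by norm_num)]
  ring

lemma Th_aff {K : Set (ℝ × ℝ)} (hK : Body K) {o u v : ℝ × ℝ} (h : det2 u v ≠ 0) :
    Th (aff o u v '' K) = Th K := by
  unfold Th
  have hA := hK.area_pos.ne'
  have h' := abs_ne_zero.mpr h
  rw [cen_aff hK h, W_aff _ o u v h hK.meas, area_aff]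
  simp_rw [mul_pow, W_const_mul]
  rw [← sq_abs (det2 u v)]
  field_simp

/-- The standard triangle. -/
def T0 : Set (ℝ × ℝ) := {z | 0 ≤ z.1 ∧ 0 ≤ z.2 ∧ z.1 + z.2 ≤ 1}

lemma T0_eq_hull : T0 = convexHull ℝ {((0 : ℝ), (0 : ℝ)), (1, 0), (0, 1)} := by
  apply Subset.antisymm
  · rintro ⟨x, y⟩ ⟨h1, h2, h3⟩
    simp only at h1 h2 h3
    have hc := convex_convexHull ℝ ({((0 : ℝ), (0 : ℝ)), (1, 0), (0, 1)} : Set (ℝ × ℝ))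
    have m0 : ((0 : ℝ), (0 : ℝ)) ∈ convexHull ℝ ({((0 : ℝ), (0 : ℝ)), (1, 0), (0, 1)} : Set (ℝ × ℝ)) :=
      subset_convexHull _ _ (by simp)
    have m1 : ((1 : ℝ), (0 : ℝ)) ∈ convexHull ℝ ({((0 : ℝ), (0 : ℝ)), (1, 0), (0, 1)} : Set (ℝ × ℝ)) :=
      subset_convexHull _ _ (by simp)
    have m2 : ((0 : ℝ), (1 : ℝ)) ∈ convexHull ℝ ({((0 : ℝ), (0 : ℝ)), (1, 0), (0, 1)} : Set (ℝ × ℝ)) :=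
      subset_convexHull _ _ (by simp)
    have := hc.sum_mem (t := Finset.univ) (w := ![1 - x - y, x, y])
      (z := ![((0 : ℝ), (0 : ℝ)), (1, 0), (0, 1)]) (by
        intro i _; fin_cases i <;> simp <;> linarith) (by simp [Fin.sum_univ_three]; ring) (by
        intro i _; fin_cases i
        · exact m0
        · exact m1
        · exact m2)
    simpa [Fin.sum_univ_three] using this
  · apply convexHull_min
    · rintro z (rfl | rfl | rfl) <;> simp [T0]
    · rintro ⟨x, y⟩ ⟨h1, h2, h3⟩ ⟨x', y'⟩ ⟨h1', h2', h3'⟩ a b ha hb hab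
      simp only at *
      refine ⟨?_, ?_, ?_⟩ <;> simp
      · positivity
      · positivity
      · nlinarith

/-- The triangle with vertices `a`, `b`, `c`. -/
def tri (a b c : ℝ × ℝ) : Set (ℝ × ℝ) := convexHull ℝ {a, b, c}

lemma tri_eq_aff (a b c : ℝ × ℝ) : tri a b c = aff a (b - a) (c - a) '' T0 := by
  rw [T0_eq_hull, AffineMap.image_convexHull]
  have h0 : aff a (b - a) (c - a) (0, 0) = a := by
    ext
    · rw [aff_fst]; simp
    · rw [aff_snd]; simp
  have h1 : aff a (b - a) (c - a) (1, 0) = b := by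
    ext
    · rw [aff_fst]; simp
    · rw [aff_snd]; simp
  have h2 : aff a (b - a) (c - a) (0, 1) = c := by
    ext
    · rw [aff_fst]; simp
    · rw [aff_snd]; simp
  rw [image_insert_eq, image_pair, h0, h1, h2, tri]

lemma det2_eq_cr (a b c : ℝ × ℝ) : det2 (b - a) (c - a) = cr a b c := by
  simp [det2, cr]

lemma T0_compact : IsCompact T0 := by
  rw [T0_eq_hull]
  exact Set.Finite.isCompact_convexHull ℝ (Set.toFinite _)

lemma T0_body : Body T0 := by
  refine ⟨T0_compact, ?_, ?_⟩
  · rw [T0_eq_hull]; exact convex_convexHull _ _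
  · refine ⟨(1/4, 1/4), ?_⟩
    rw [mem_interior]
    refine ⟨{z | 0 < z.1 ∧ 0 < z.2 ∧ z.1 + z.2 < 1}, ?_, ?_, ?_⟩
    · rintro z ⟨h1, h2, h3⟩; exact ⟨h1.le, h2.le, h3.le⟩
    · exact (isOpen_lt continuous_const continuous_fst).inter
        ((isOpen_lt continuous_const continuous_snd).inter
          (isOpen_lt (continuous_fst.add continuous_snd) continuous_const))
    · norm_num

/-- Integration over the standard triangle as an iterated integral. -/
lemma integral_T0 {f : ℝ × ℝ → ℝ} (hf : Continuous f) :
    ∫ z in T0, f z = ∫ x in (0:ℝ)..1, ∫ y in (0:ℝ)..(1 - x), f (x, y) := by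
  have hint : Integrable (T0.indicator f) :=
    (integrable_indicator_iff T0_body.meas).2 (T0_body.intOn hf)
  rw [← integral_indicator T0_body.meas]
  rw [Measure.volume_eq_prod] at hint ⊢
  rw [integral_prod _ hint, intervalIntegral.integral_of_le zero_le_one,
    ← integral_Icc_eq_integral_Ioc, ← integral_indicator measurableSet_Icc]
  congr 1
  ext x
  by_cases hx : x ∈ Icc (0:ℝ) 1
  · rw [indicator_of_mem hx, intervalIntegral.integral_of_le (by linarith [hx.2]),
      ← integral_Icc_eq_integral_Ioc, ← integral_indicator measurableSet_Icc]
    congr 1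
    ext y
    by_cases hy : y ∈ Icc (0:ℝ) (1 - x)
    · rw [indicator_of_mem hy, indicator_of_mem]
      exact ⟨hx.1, hy.1, by simp; linarith [hy.2]⟩
    · rw [indicator_of_notMem hy, indicator_of_notMem]
      rintro ⟨-, h2, h3⟩; exact hy ⟨h2, by simp at h3; linarith⟩
  · rw [indicator_of_notMem hx]
    have : ∀ y, T0.indicator f (x, y) = 0 := by
      intro y
      apply indicator_of_notMem
      rintro ⟨h1, h2, h3⟩
      simp at h1 h2 h3
      exact hx ⟨h1, by linarith⟩
    simp [this]

lemma area_T0 : area T0 = 1 / 2 := by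
  rw [area_eq_integral, integral_T0 continuous_const]
  have : ∀ x : ℝ, HasDerivAt (fun x : ℝ => x - x ^ 2 / 2) (1 - x) x := by
    intro x
    exact ((hasDerivAt_id' x).sub ((hasDerivAt_pow 2 x).div_const 2)).congr_deriv (by norm_num)
  have e : ∀ x : ℝ, ∫ _ in (0:ℝ)..(1 - x), (1 : ℝ) = 1 - x := by intro x; simp
  simp_rw [e]
  rw [intervalIntegral.integral_eq_sub_of_hasDerivAt (fun x _ => this x)
    (Continuous.intervalIntegrable (by fun_prop) _ _)]
  norm_num

lemma area_tri (a b c : ℝ × ℝ) : area (tri a b c) = |cr a b c| / 2 := by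
  rw [tri_eq_aff]
  rw [area_aff, area_T0, det2_eq_cr]; ring

/-! ### Smoothed powers -/

/-- The smoothed power function `c ↦ ∫_{-r}^r |z - c|^p dz`. -/
def psi (r p c : ℝ) : ℝ := ∫ z in (-r)..r, |z - c| ^ p

lemma abs_rpow_cont {p : ℝ} (hp : 1 ≤ p) : Continuous fun s : ℝ => |s| ^ p :=
  continuous_abs.rpow_const (fun _ => Or.inr (by linarith))

lemma abs_rpow_convex {p : ℝ} (hp : 1 ≤ p) : ConvexOn ℝ univ fun s : ℝ => |s| ^ p := by
  have h1 := convexOn_rpow hp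
  refine ⟨convex_univ, fun x _ y _ a b ha hb hab => ?_⟩
  have h2 : |a • x + b • y| ≤ a * |x| + b * |y| := by
    refine (abs_add_le _ _).trans (le_of_eq ?_)
    simp [abs_mul, abs_of_nonneg ha, abs_of_nonneg hb]
  refine (Real.rpow_le_rpow (abs_nonneg _) h2 (by linarith)).trans ?_
  exact h1.2 (abs_nonneg x) (abs_nonneg y) ha hb hab

lemma psi_eq {r p c : ℝ} (hp : 1 ≤ p) (h1 : -r ≤ c) (h2 : c ≤ r) :
    psi r p c = ((r - c) ^ (p + 1) + (r + c) ^ (p + 1)) / (p + 1) := by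
  have hcont : Continuous fun z : ℝ => |z - c| ^ p :=
    (abs_rpow_cont hp).comp (continuous_id.sub continuous_const)
  rw [psi, ← intervalIntegral.integral_add_adjacent_intervals
    (hcont.intervalIntegrable (-r) c) (hcont.intervalIntegrable c r)]
  have e1 : ∫ z in (-r)..c, |z - c| ^ p = ∫ z in (-r)..c, (c - z) ^ p := by
    apply intervalIntegral.integral_congr
    intro z hz
    rw [uIcc_of_le h1] at hz
    simp only
    rw [abs_sub_comm, abs_of_nonneg (by linarith [hz.2])]
  have e2 : ∫ z in c..r, |z - c| ^ p = ∫ z in c..r, (z - c) ^ p := by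
    apply intervalIntegral.integral_congr
    intro z hz
    rw [uIcc_of_le h2] at hz
    simp only
    rw [abs_of_nonneg (by linarith [hz.1])]
  rw [e1, e2, intervalIntegral.integral_comp_sub_left (fun x => x ^ p),
    intervalIntegral.integral_comp_sub_right (fun x => x ^ p),
    integral_rpow (Or.inl (by linarith)), integral_rpow (Or.inl (by linarith))]
  simp only [sub_self, sub_neg_eq_add]
  rw [Real.zero_rpow (by linarith), add_comm c r]
  ring

/-- The smoothed power is uniformly convex on `[-r, r]`: its second derivative is at least
`r ^ (p - 1)` there, because one of `r - c` and `r + c` is at least `r`. -/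
lemma psi_strong {r p : ℝ} (hp : 1 ≤ p) (hr : 0 < r) :
    ConvexOn ℝ (Icc (-r) r) fun c => psi r p c - r ^ (p - 1) / 2 * c ^ 2 := by
  have hcongr : ∀ c ∈ Icc (-r) r, ((r - c) ^ (p + 1) + (r + c) ^ (p + 1)) / (p + 1)
      - r ^ (p - 1) / 2 * c ^ 2 = psi r p c - r ^ (p - 1) / 2 * c ^ 2 := by
    intro c hc; rw [psi_eq hp hc.1 hc.2]
  refine ConvexOn.congr ?_ hcongr
  have hp1 : p + 1 ≠ 0 := by linarith
  refine convexOn_of_hasDerivWithinAt2_nonneg (convex_Icc _ _)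
    (f' := fun c => (-(r - c) ^ p + (r + c) ^ p) - r ^ (p - 1) * c)
    (f'' := fun c => (p * (r - c) ^ (p - 1) + p * (r + c) ^ (p - 1)) - r ^ (p - 1)) ?_ ?_ ?_ ?_
  · apply Continuous.continuousOn
    have a1 : Continuous fun c : ℝ => (r - c) ^ (p + 1) :=
      (continuous_const.sub continuous_id).rpow_const (fun _ => Or.inr (by linarith))
    have a2 : Continuous fun c : ℝ => (r + c) ^ (p + 1) :=
      (continuous_const.add continuous_id).rpow_const (fun _ => Or.inr (by linarith))
    exact ((a1.add a2).div_const _).sub (continuous_const.mul (continuous_pow 2))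
  · intro c hc
    rw [interior_Icc] at hc ⊢
    have d1 : HasDerivAt (fun c : ℝ => (r - c) ^ (p + 1)) (-1 * (p + 1) * (r - c) ^ (p + 1 - 1)) c :=
      ((hasDerivAt_id' c).const_sub r).rpow_const (Or.inr (by linarith))
    have d2 : HasDerivAt (fun c : ℝ => (r + c) ^ (p + 1)) (1 * (p + 1) * (r + c) ^ (p + 1 - 1)) c :=
      ((hasDerivAt_id' c).const_add r).rpow_const (Or.inr (by linarith))
    have d3 := ((d1.add d2).div_const (p + 1)).sub
      ((hasDerivAt_pow 2 c).const_mul (r ^ (p - 1) / 2))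
    refine (d3.congr_deriv ?_).hasDerivWithinAt
    simp only [add_sub_cancel_right]
    field_simp
    push_cast
    ring
  · intro c hc
    rw [interior_Icc] at hc ⊢
    have d1 : HasDerivAt (fun c : ℝ => (r - c) ^ p) (-1 * p * (r - c) ^ (p - 1)) c :=
      ((hasDerivAt_id' c).const_sub r).rpow_const (Or.inr hp)
    have d2 : HasDerivAt (fun c : ℝ => (r + c) ^ p) (1 * p * (r + c) ^ (p - 1)) c :=
      ((hasDerivAt_id' c).const_add r).rpow_const (Or.inr hp)
    have d3 := (d1.neg.add d2).sub ((hasDerivAt_id' c).const_mul (r ^ (p - 1)))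
    refine (d3.congr_deriv ?_).hasDerivWithinAt
    ring
  · intro c hc
    rw [interior_Icc] at hc
    have n1 : 0 ≤ (r - c) ^ (p - 1) := Real.rpow_nonneg (by linarith [hc.2]) _
    have n2 : 0 ≤ (r + c) ^ (p - 1) := Real.rpow_nonneg (by linarith [hc.1]) _
    have n3 : r ^ (p - 1) ≤ (r - c) ^ (p - 1) + (r + c) ^ (p - 1) := by
      rcases le_total 0 c with h | h
      · have : r ^ (p - 1) ≤ (r + c) ^ (p - 1) :=
          Real.rpow_le_rpow hr.le (by linarith) (by linarith)
        linarith
      · have : r ^ (p - 1) ≤ (r - c) ^ (p - 1) :=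
          Real.rpow_le_rpow hr.le (by linarith) (by linarith)
        linarith
    nlinarith

lemma psi_convex {r p : ℝ} (hp : 1 ≤ p) (hr : 0 < r) (c d k : ℝ) (h0 : 0 ≤ k) (h1 : k ≤ 1) :
    psi r p (c + k * d) ≤ (1 - k) * psi r p c + k * psi r p (c + d) := by
  have hi : ∀ c, IntervalIntegrable (fun z : ℝ => |z - c| ^ p) volume (-r) r := fun c =>
    ((abs_rpow_cont hp).comp (continuous_id.sub continuous_const)).intervalIntegrable _ _
  unfold psi
  rw [← intervalIntegral.integral_const_mul, ← intervalIntegral.integral_const_mul,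
    ← intervalIntegral.integral_add ((hi _).const_mul _) ((hi _).const_mul _)]
  apply intervalIntegral.integral_mono_on (by linarith) (hi _)
    (((hi _).const_mul _).add ((hi _).const_mul _))
  intro z _
  have := (abs_rpow_convex hp).2 (mem_univ (z - c)) (mem_univ (z - (c + d)))
    (sub_nonneg.2 h1) h0 (by ring)
  simp only [smul_eq_mul] at this
  have e : z - (c + k * d) = (1 - k) * (z - c) + k * (z - (c + d)) := by ring
  rw [e]
  exact this

/-- Strong convexity of the smoothed power, for increments that may leave the window `[-r, r]`:
only the fraction `k` of each increment has to stay inside. -/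
lemma psi_gap {r p : ℝ} (hp : 1 ≤ p) (hr : 0 < r) {c d t₁ t₂ k : ℝ} (ht₁ : 0 < t₁) (ht₂ : 0 < t₂)
    (hk : 0 < k) (hk1 : k ≤ 1) (hc : |c| ≤ r / 2) (h1 : k * (t₁ * |d|) ≤ r / 2)
    (h2 : k * (t₂ * |d|) ≤ r / 2) :
    k * r ^ (p - 1) / 2 * (t₁ * t₂ * (t₁ + t₂)) * d ^ 2 ≤
      t₂ * psi r p (c - t₁ * d) + t₁ * psi r p (c + t₂ * d) - (t₁ + t₂) * psi r p c := by
  have b1 := psi_convex hp hr c (-(t₁ * d)) k hk.le hk1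
  have b2 := psi_convex hp hr c (t₂ * d) k hk.le hk1
  have hs := psi_strong hp hr
  have ad1 : |k * (t₁ * d)| ≤ r / 2 := by
    rw [abs_mul, abs_mul, abs_of_pos hk, abs_of_pos ht₁]; exact h1
  have ad2 : |k * (t₂ * d)| ≤ r / 2 := by
    rw [abs_mul, abs_mul, abs_of_pos hk, abs_of_pos ht₂]; exact h2
  rw [abs_le] at ad1 ad2 hc
  have hT : 0 < t₁ + t₂ := by linarith
  -- The uniform convexity applies to the points reached after the fraction `k` of each increment.
  have m1 : c + k * (-(t₁ * d)) ∈ Icc (-r) r := ⟨by linarith, by linarith⟩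
  have m2 : c + k * (t₂ * d) ∈ Icc (-r) r := ⟨by linarith, by linarith⟩
  have := hs.2 m1 m2 (show 0 ≤ t₂ / (t₁ + t₂) by positivity)
    (show 0 ≤ t₁ / (t₁ + t₂) by positivity) (by field_simp; ring)
  simp only [smul_eq_mul] at this
  have e : t₂ / (t₁ + t₂) * (c + k * (-(t₁ * d))) + t₁ / (t₁ + t₂) * (c + k * (t₂ * d)) = c := by
    field_simp; ring
  rw [e] at this
  have h3 := mul_le_mul_of_nonneg_left this hT.le
  have e2 : (t₁ + t₂) * (t₂ / (t₁ + t₂) * (psi r p (c + k * (-(t₁ * d))) - r ^ (p - 1) / 2 *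
      (c + k * (-(t₁ * d))) ^ 2) + t₁ / (t₁ + t₂) * (psi r p (c + k * (t₂ * d)) -
      r ^ (p - 1) / 2 * (c + k * (t₂ * d)) ^ 2)) = t₂ * (psi r p (c + k * (-(t₁ * d))) -
      r ^ (p - 1) / 2 * (c + k * (-(t₁ * d))) ^ 2) + t₁ * (psi r p (c + k * (t₂ * d)) -
      r ^ (p - 1) / 2 * (c + k * (t₂ * d)) ^ 2) := by
    field_simp
  rw [e2] at h3
  have c1 := mul_le_mul_of_nonneg_left b1 ht₂.le
  have c2 := mul_le_mul_of_nonneg_left b2 ht₁.le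
  have e3 : c + -(t₁ * d) = c - t₁ * d := by ring
  rw [e3] at c1
  refine le_of_mul_le_mul_left ?_ hk
  nlinarith

/-! ### Piecewise linear shears -/

/-- The piecewise linear shear that moves a point at height `h` above the level `s` by `t * h`
parallel to the first axis and fixes the points below that level. -/
def sh (s t : ℝ) (z : ℝ × ℝ) : ℝ × ℝ := (z.1 + t * max (z.2 - s) 0, z.2)

lemma sh_cont (s t : ℝ) : Continuous (sh s t) := by unfold sh; fun_prop

lemma sh_sh (s t t' : ℝ) (z : ℝ × ℝ) : sh s t (sh s t' z) = sh s (t + t') z := by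
  ext <;> simp [sh]; ring

lemma sh_zero (s : ℝ) (z : ℝ × ℝ) : sh s 0 z = z := by simp [sh]

/-- The shear as a homeomorphism. -/
def shHomeo (s t : ℝ) : (ℝ × ℝ) ≃ₜ (ℝ × ℝ) where
  toFun := sh s t
  invFun := sh s (-t)
  left_inv z := by simp [sh_sh, sh_zero]
  right_inv z := by simp [sh_sh, sh_zero]
  continuous_toFun := sh_cont s t
  continuous_invFun := sh_cont s (-t)

lemma sh_mp (s t : ℝ) : MeasurePreserving (sh s t) := by
  have h1 : MeasurePreserving (fun q : ℝ × ℝ => (id q.1, q.2 + t * max (q.1 - s) 0))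
      (volume.prod volume) (volume.prod volume) := by
    refine MeasurePreserving.skew_product (g := fun x y => y + t * max (x - s) 0)
      (MeasurePreserving.id volume) (by fun_prop) ?_
    filter_upwards with x
    exact (measurePreserving_add_right volume (t * max (x - s) 0)).map_eq
  have h2 : MeasurePreserving (Prod.swap : ℝ × ℝ → ℝ × ℝ) (volume.prod volume)
    (volume.prod volume) := Measure.measurePreserving_swap
  have := (h2.comp h1).comp h2
  exact this

lemma integral_sh (s t : ℝ) (K : Set (ℝ × ℝ)) (f : ℝ × ℝ → ℝ) :
    ∫ z in sh s t '' K, f z = ∫ z in K, f (sh s t z) :=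
  (sh_mp s t).setIntegral_image_emb (shHomeo s t).measurableEmbedding f K

lemma area_sh (s t : ℝ) (K : Set (ℝ × ℝ)) : area (sh s t '' K) = area K := by
  rw [area_eq_integral, area_eq_integral, integral_sh]

lemma Body.sh {K : Set (ℝ × ℝ)} (hK : Body K) {s t : ℝ} (hc : Convex ℝ (sh s t '' K)) :
    Body (sh s t '' K) := by
  refine ⟨hK.cpt.image (sh_cont s t), hc, ?_⟩
  have : interior (PlaneBody.sh s t '' K) = PlaneBody.sh s t '' interior K :=
    ((shHomeo s t).image_interior K).symm
  rw [this]
  exact hK.int.image _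

/-- The mean displacement of the points of `K` under `sh s 1`; it is the velocity of the centroid of
`sh s t '' K`. -/
def mdis (s : ℝ) (K : Set (ℝ × ℝ)) : ℝ := (area K)⁻¹ * ∫ z in K, max (z.2 - s) 0

lemma cen_sh {K : Set (ℝ × ℝ)} (hK : Body K) (s t : ℝ) :
    cen (sh s t '' K) = ((cen K).1 + t * mdis s K, (cen K).2) := by
  have h1 : ∫ z in sh s t '' K, z.1 = (∫ z in K, z.1) + t * ∫ z in K, max (z.2 - s) 0 := by
    rw [integral_sh, ← integral_const_mul]
    simp only [sh]
    exact integral_add (hK.intOn continuous_fst) (hK.intOn (by fun_prop))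
  have h2 : ∫ z in sh s t '' K, z.2 = ∫ z in K, z.2 := by rw [integral_sh]; simp [sh]
  ext
  · simp only [cen, mdis, area_sh, h1]; ring
  · simp only [cen, area_sh, h2]

lemma W_sh (φ : ℝ → ℝ) (s t : ℝ) (K : Set (ℝ × ℝ)) (o : ℝ × ℝ) :
    W φ (sh s t '' K) o = ∫ x in K, ∫ y in K, φ (cr o (sh s t x) (sh s t y)) := by
  simp only [W, integral_sh]

/-! ### Convexity defects along shears -/

/-- The velocity in `t` of `cr o (sh s t x) (sh s t y)` when `o` moves horizontally with velocity `a`. -/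
def vel (s a : ℝ) (o x y : ℝ × ℝ) : ℝ :=
  (max (x.2 - s) 0 - a) * (y.2 - o.2) - (x.2 - o.2) * (max (y.2 - s) 0 - a)

/-- Under a shear the area of a triangle is affine in the shear parameter, provided that the vertex
`o` below the kink moves with constant velocity `a`. -/
lemma cr_sh (s t a : ℝ) (o x y : ℝ × ℝ) :
    cr (o.1 + t * a, o.2) (sh s t x) (sh s t y) = cr o x y + t * vel s a o x y := by
  simp only [cr, sh, vel]; ring

lemma vel_cont (s a : ℝ) (o : ℝ × ℝ) :
    Continuous fun q : (ℝ × ℝ) × (ℝ × ℝ) => vel s a o q.1 q.2 := by unfold vel; fun_prop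

lemma cr_cont (o : ℝ × ℝ) : Continuous fun q : (ℝ × ℝ) × (ℝ × ℝ) => cr o q.1 q.2 := by
  unfold cr; fun_prop

section Double
variable {K : Set (ℝ × ℝ)}

lemma cont_inner (hK : IsCompact K) {X : Type*} [TopologicalSpace X] [FirstCountableTopology X]
    [LocallyCompactSpace X] {F : X → ℝ × ℝ → ℝ}
    (hF : Continuous (Function.uncurry F)) : Continuous fun x => ∫ y in K, F x y :=
  continuous_parametric_integral_of_continuous hF hK

lemma intOn_of_cont (hK : IsCompact K) {f : ℝ × ℝ → ℝ} (hf : Continuous f) :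
    IntegrableOn f K := hf.continuousOn.integrableOn_compact hK

lemma cont_left {F : ℝ × ℝ → ℝ × ℝ → ℝ} (hF : Continuous (Function.uncurry F)) (x : ℝ × ℝ) :
    Continuous (F x) := hF.comp (Continuous.prodMk_right x)

lemma double_mono (hK : IsCompact K) {F G : ℝ × ℝ → ℝ × ℝ → ℝ}
    (hF : Continuous (Function.uncurry F)) (hG : Continuous (Function.uncurry G))
    (h : ∀ x ∈ K, ∀ y ∈ K, F x y ≤ G x y) :
    ∫ x in K, ∫ y in K, F x y ≤ ∫ x in K, ∫ y in K, G x y := by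
  refine setIntegral_mono_on (intOn_of_cont hK (cont_inner hK hF))
    (intOn_of_cont hK (cont_inner hK hG)) hK.measurableSet fun x hx => ?_
  exact setIntegral_mono_on (intOn_of_cont hK (cont_left hF x))
    (intOn_of_cont hK (cont_left hG x)) hK.measurableSet fun y hy => h x hx y hy

/-- Linearity of the integral over a compact set for three continuous integrands. -/
lemma single_lin (hK : IsCompact K) (a b c : ℝ) {f g h : ℝ × ℝ → ℝ} (hf : Continuous f)
    (hg : Continuous g) (hh : Continuous h) :
    a * (∫ x in K, f x) + b * (∫ x in K, g x) - c * (∫ x in K, h x) =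
      ∫ x in K, (a * f x + b * g x - c * h x) := by
  have i1 : IntegrableOn (fun x => a * f x) K := (intOn_of_cont hK hf).const_mul a
  have i2 : IntegrableOn (fun x => b * g x) K := (intOn_of_cont hK hg).const_mul b
  have i3 : IntegrableOn (fun x => c * h x) K := (intOn_of_cont hK hh).const_mul c
  rw [← integral_const_mul, ← integral_const_mul, ← integral_const_mul, ← integral_add i1 i2]
  exact (integral_sub (i1.add i2) i3).symm

lemma double_lin (hK : IsCompact K) (a b c : ℝ) {F G H : ℝ × ℝ → ℝ × ℝ → ℝ}
    (hF : Continuous (Function.uncurry F)) (hG : Continuous (Function.uncurry G))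
    (hH : Continuous (Function.uncurry H)) :
    a * (∫ x in K, ∫ y in K, F x y) + b * (∫ x in K, ∫ y in K, G x y)
      - c * (∫ x in K, ∫ y in K, H x y) =
      ∫ x in K, ∫ y in K, (a * F x y + b * G x y - c * H x y) := by
  rw [single_lin hK a b c (cont_inner hK hF) (cont_inner hK hG) (cont_inner hK hH)]
  congr 1; ext x
  exact single_lin hK a b c (cont_left hF x) (cont_left hG x)
    (cont_left hH x)

end Double

/-- The convexity defect of `φ` at `A` between `A - t₁ B` and `A + t₂ B`, multiplied by
`t₁ + t₂`. -/
def defect (φ : ℝ → ℝ) (t₁ t₂ A B : ℝ) : ℝ :=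
  t₂ * φ (A - t₁ * B) + t₁ * φ (A + t₂ * B) - (t₁ + t₂) * φ A

lemma defect_nonneg {φ : ℝ → ℝ} (hφ : ConvexOn ℝ univ φ) {t₁ t₂ : ℝ} (h1 : 0 < t₁) (h2 : 0 < t₂)
    (A B : ℝ) : 0 ≤ defect φ t₁ t₂ A B := by
  have hT : 0 < t₁ + t₂ := by linarith
  have := hφ.2 (mem_univ (A - t₁ * B)) (mem_univ (A + t₂ * B))
    (show 0 ≤ t₂ / (t₁ + t₂) by positivity) (show 0 ≤ t₁ / (t₁ + t₂) by positivity)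
    (by field_simp; ring)
  simp only [smul_eq_mul] at this
  have e : t₂ / (t₁ + t₂) * (A - t₁ * B) + t₁ / (t₁ + t₂) * (A + t₂ * B) = A := by
    field_simp; ring
  rw [e] at this
  have h3 := mul_le_mul_of_nonneg_left this hT.le
  have e2 : (t₁ + t₂) * (t₂ / (t₁ + t₂) * φ (A - t₁ * B) + t₁ / (t₁ + t₂) * φ (A + t₂ * B)) =
    t₂ * φ (A - t₁ * B) + t₁ * φ (A + t₂ * B) := by field_simp
  unfold defect
  linarith

lemma defect_sq (t₁ t₂ A B : ℝ) :
    defect (fun s => s ^ 2) t₁ t₂ A B = t₁ * t₂ * (t₁ + t₂) * B ^ 2 := by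
  unfold defect; ring

/-- Integrated convexity defect of the functional `W φ` along the family `sh s t '' K`, the
distinguished vertex `o` moving with velocity `a`. -/
def Wgap (φ : ℝ → ℝ) (s t₁ t₂ a : ℝ) (K : Set (ℝ × ℝ)) (o : ℝ × ℝ) : ℝ :=
  ∫ x in K, ∫ y in K, defect φ t₁ t₂ (cr o x y) (vel s a o x y)

lemma defect_cont {φ : ℝ → ℝ} (hφ : Continuous φ) (s t₁ t₂ a : ℝ) (o : ℝ × ℝ) :
    Continuous (Function.uncurry fun x y => defect φ t₁ t₂ (cr o x y) (vel s a o x y)) := by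
  have h1 := cr_cont o
  have h2 := vel_cont s a o
  unfold defect
  simp only [Function.uncurry_def]
  fun_prop

/-- The convexity defect of `W φ` along a shear family is the integral of the pointwise defects. -/
lemma Wgap_eq {φ : ℝ → ℝ} (hφ : Continuous φ) (s t₁ t₂ a : ℝ) {K : Set (ℝ × ℝ)}
    (hK : IsCompact K) (o : ℝ × ℝ) :
    t₂ * W φ (sh s (-t₁) '' K) (o.1 + (-t₁) * a, o.2) + t₁ * W φ (sh s t₂ '' K) (o.1 + t₂ * a, o.2)
      - (t₁ + t₂) * W φ K o = Wgap φ s t₁ t₂ a K o := by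
  have hc : ∀ t, Continuous (Function.uncurry fun x y => φ (cr o x y + t * vel s a o x y)) := by
    intro t
    have h1 := cr_cont o
    have h2 := vel_cont s a o
    simp only [Function.uncurry_def]
    fun_prop
  simp only [W_sh, cr_sh]
  have h0 := hc 0
  simp only [zero_mul, add_zero] at h0
  rw [W, double_lin hK t₂ t₁ (t₁ + t₂) (hc (-t₁)) (hc t₂) h0]
  simp only [Wgap, defect]
  congr 1; ext x; congr 1; ext y
  ring_nf

lemma Wgap_nonneg {φ : ℝ → ℝ} (hφ : ConvexOn ℝ univ φ) {s t₁ t₂ a : ℝ} (h1 : 0 < t₁) (h2 : 0 < t₂)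
    (K : Set (ℝ × ℝ)) (o : ℝ × ℝ) : 0 ≤ Wgap φ s t₁ t₂ a K o :=
  integral_nonneg fun _ => integral_nonneg fun _ => defect_nonneg hφ h1 h2 _ _

/-- The defect integrated over a horizontal chord of length `2 r` centred below `o`. On the chord
`cr o x y` equals, up to sign, the height `x.2 - o.2` times the distance from `y.1 - o.1` to a point
moving with constant velocity, so that the integral is a value of `psi` and `psi_gap` applies. The
chord lies below `o` by the fraction `ζ` of the height of `x` over `o`. -/
lemma line_gap {p r C s t₁ t₂ H a : ℝ} {o x : ℝ × ℝ} {y₂ : ℝ} (hp : 1 ≤ p) (hr : 0 < r)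
    (hr1 : r ≤ 1) (hC : 1 ≤ C) (ht₁ : 0 < t₁) (ht₂ : 0 < t₂) (hH : 0 < H)
    (hC1 : t₁ * H ≤ C) (hC2 : t₂ * H ≤ C) (ha0 : 0 ≤ a) (haH : a ≤ H)
    (hY : 0 < x.2 - o.2) (hX : |x.1 - o.1| ≤ 2) (hxs : 0 ≤ x.2 - s) (hxH : x.2 - s ≤ H)
    (hys : y₂ ≤ s) {ζ : ℝ} (hζ0 : 0 ≤ ζ) (hζ1 : ζ ≤ r / 4) (hy₂ : y₂ = o.2 - ζ * (x.2 - o.2)) :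
    (x.2 - o.2) ^ p * (r / (4 * C) * r ^ (p - 1) / 2 * (t₁ * t₂ * (t₁ + t₂)) *
      (a - ζ * (x.2 - s - a)) ^ 2) ≤
    ∫ y₁ in (o.1 - r)..(o.1 + r),
      defect (fun s => |s| ^ p) t₁ t₂ (cr o x (y₁, y₂)) (vel s a o x (y₁, y₂)) := by
  set Y := x.2 - o.2 with hYdef
  set d := a - ζ * (x.2 - s - a) with hd
  set c := -(ζ * (x.1 - o.1)) with hc
  have key : ∀ y₁ t, cr o x (y₁, y₂) + t * vel s a o x (y₁, y₂) =
      -(Y * ((y₁ - o.1) - (c + t * d))) := by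
    intro y₁ t
    simp only [cr, vel, max_eq_left hxs, max_eq_right (sub_nonpos.2 hys), hc, hd]
    rw [hy₂]
    simp only [hYdef]
    ring
  have key2 : ∀ y₁ t, |cr o x (y₁, y₂) + t * vel s a o x (y₁, y₂)| ^ p =
      Y ^ p * |(y₁ - o.1) - (c + t * d)| ^ p := by
    intro y₁ t
    rw [key, abs_neg, abs_mul, abs_of_pos hY, Real.mul_rpow hY.le (abs_nonneg _)]
  have hi : ∀ e : ℝ, IntervalIntegrable (fun y₁ : ℝ => |(y₁ - o.1) - e| ^ p) volume
      (o.1 - r) (o.1 + r) := fun e =>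
    ((abs_rpow_cont hp).comp ((continuous_id.sub continuous_const).sub
      continuous_const)).intervalIntegrable _ _
  have hpsi : ∀ e : ℝ, ∫ y₁ in (o.1 - r)..(o.1 + r), |(y₁ - o.1) - e| ^ p = psi r p e := by
    intro e
    rw [intervalIntegral.integral_comp_sub_right (fun z => |z - e| ^ p)]
    simp [psi]
  have e1 : ∫ y₁ in (o.1 - r)..(o.1 + r),
      defect (fun s => |s| ^ p) t₁ t₂ (cr o x (y₁, y₂)) (vel s a o x (y₁, y₂)) =
      Y ^ p * (t₂ * psi r p (c - t₁ * d) + t₁ * psi r p (c + t₂ * d) - (t₁ + t₂) * psi r p c) := by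
    rw [← hpsi, ← hpsi, ← hpsi, ← intervalIntegral.integral_const_mul,
      ← intervalIntegral.integral_const_mul, ← intervalIntegral.integral_const_mul,
      ← intervalIntegral.integral_add ((hi _).const_mul _) ((hi _).const_mul _),
      ← intervalIntegral.integral_sub (((hi _).const_mul _).add ((hi _).const_mul _))
        ((hi _).const_mul _), ← intervalIntegral.integral_const_mul]
    congr 1; ext y₁
    have k1 := key2 y₁ (-t₁)
    have k2 := key2 y₁ t₂
    have k0 := key2 y₁ 0
    simp only [zero_mul, add_zero, neg_mul, ← sub_eq_add_neg] at k1 k0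
    simp only [defect]
    rw [k1, k2, k0]; ring
  rw [e1]
  refine mul_le_mul_of_nonneg_left ?_ (Real.rpow_nonneg hY.le _)
  have hdH : |d| ≤ 2 * H := by
    rw [abs_le]; constructor
    · nlinarith
    · nlinarith
  have hk : ∀ t, 0 < t → t * H ≤ C → r / (4 * C) * (t * |d|) ≤ r / 2 := by
    intro t ht htC
    have h3 : t * |d| ≤ 2 * C := by nlinarith
    calc r / (4 * C) * (t * |d|) ≤ r / (4 * C) * (2 * C) := by gcongr
      _ = r / 2 := by field_simp; ring
  refine psi_gap hp hr ht₁ ht₂ (by positivity) ?_ ?_ (hk _ ht₁ hC1) (hk _ ht₂ hC2)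
  · rw [div_le_one (by positivity)]; linarith
  · rw [hc, abs_neg, abs_mul, abs_of_nonneg hζ0]
    nlinarith [abs_nonneg (x.1 - o.1)]

/-- The relative velocity `a - ζ * (b - a)` is affine in `ζ`, so it is of the order of `b` on a
subinterval of `[0, r / 4]` of length `r / 12`. -/
lemma vel_lower {a b r : ℝ} (hr : 0 < r) (hr1 : r ≤ 1 / 4) (ha : 0 ≤ a) (hb : 0 < b) :
    ∃ ζ₁, 0 ≤ ζ₁ ∧ ζ₁ + r / 12 ≤ r / 4 ∧ ∀ ζ, ζ₁ ≤ ζ → ζ ≤ ζ₁ + r / 12 →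
      (b * r / 32) ^ 2 ≤ (a - ζ * (b - a)) ^ 2 := by
  have hbr : 0 < b * r := mul_pos hb hr
  by_cases h1 : b / 4 ≤ a
  · refine ⟨0, le_rfl, by linarith, fun ζ h2 h3 => ?_⟩
    apply pow_le_pow_left₀ (by positivity)
    nlinarith
  · push Not at h1
    by_cases h4 : b * r / 32 ≤ a - r / 12 * (b - a)
    · refine ⟨0, le_rfl, by linarith, fun ζ h2 h3 => ?_⟩
      apply pow_le_pow_left₀ (by positivity)
      nlinarith
    · push Not at h4
      refine ⟨r / 6, by positivity, by linarith, fun ζ h2 h3 => ?_⟩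
      rw [← neg_sq (a - ζ * (b - a))]
      apply pow_le_pow_left₀ (by positivity)
      nlinarith

/-! ### Quantitative bounds for the convexity defects -/

/-- The constant in the lower bound for the convexity defect of the `p`-th moment, for a body
containing a static box of size `r` and shear displacements bounded by `C`. -/
def gapConst (r C p : ℝ) : ℝ :=
  (r / 12) * (r / 4) * (r / 4) ^ p * (r / (4 * C) * r ^ (p - 1) / 2 * (r / 64) ^ 2)

lemma gapConst_nonneg {r C p : ℝ} (hr : 0 < r) (hC : 1 ≤ C) : 0 ≤ gapConst r C p := by
  unfold gapConst
  have := Real.rpow_nonneg hr.le (p - 1)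
  have := Real.rpow_nonneg (show 0 ≤ r / 4 by linarith) p
  positivity

/-- The defect for a fixed point `x` high above the kink, integrated over the horizontal chords of
a static box below `o`. -/
lemma inner_gap {p r C s t₁ t₂ H a : ℝ} {o x : ℝ × ℝ} {K : Set (ℝ × ℝ)} (hp : 1 ≤ p) (hr : 0 < r)
    (hr1 : r ≤ 1 / 4) (hC : 1 ≤ C) (ht₁ : 0 < t₁) (ht₂ : 0 < t₂) (hH : 0 < H)
    (hC1 : t₁ * H ≤ C) (hC2 : t₂ * H ≤ C) (ha0 : 0 ≤ a) (haH : a ≤ H) (hK : IsCompact K)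
    (hbox : Icc (o.1 - r) (o.1 + r) ×ˢ Icc (o.2 - r) o.2 ⊆ K) (hos : o.2 ≤ s)
    (hY : r / 4 ≤ x.2 - o.2) (hY4 : x.2 - o.2 ≤ 4) (hX : |x.1 - o.1| ≤ 2)
    (hxs : H / 2 ≤ x.2 - s) (hxH : x.2 - s ≤ H) :
    gapConst r C p * (t₁ * t₂ * (t₁ + t₂) * H ^ 2) ≤
      ∫ y in K, defect (fun s => |s| ^ p) t₁ t₂ (cr o x y) (vel s a o x y) := by
  obtain ⟨ζ₁, hz0, hz1, hz⟩ := vel_lower hr hr1 ha0 (b := x.2 - s) (by linarith)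
  set Y := x.2 - o.2 with hYdef
  have hYpos : 0 < Y := by linarith
  set y₀ := o.2 - (ζ₁ + r / 12) * Y with hy₀
  set y₁ := o.2 - ζ₁ * Y with hy₁
  have hlen : y₁ - y₀ = r / 12 * Y := by rw [hy₀, hy₁]; ring
  have hle : y₀ ≤ y₁ := by nlinarith
  have hsub : Icc (o.1 - r) (o.1 + r) ×ˢ Icc y₀ y₁ ⊆ K := by
    refine Subset.trans (prod_mono le_rfl (Icc_subset_Icc ?_ ?_)) hbox
    · rw [hy₀]; nlinarith
    · rw [hy₁]; nlinarith
  have hcont : Continuous fun y => defect (fun s => |s| ^ p) t₁ t₂ (cr o x y) (vel s a o x y) :=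
    cont_left (defect_cont (abs_rpow_cont hp) s t₁ t₂ a o) x
  have hmono := setIntegral_mono_set (intOn_of_cont hK hcont)
    (ae_of_all _ fun y => defect_nonneg (abs_rpow_convex hp) ht₁ ht₂ (cr o x y) (vel s a o x y))
    (LE.le.eventuallyLE hsub)
  refine le_trans ?_ hmono
  have hfub : ∫ y in Icc (o.1 - r) (o.1 + r) ×ˢ Icc y₀ y₁,
      defect (fun s => |s| ^ p) t₁ t₂ (cr o x y) (vel s a o x y) =
      ∫ v in Icc y₀ y₁, ∫ u in Icc (o.1 - r) (o.1 + r),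
        defect (fun s => |s| ^ p) t₁ t₂ (cr o x (u, v)) (vel s a o x (u, v)) := by
    rw [Measure.volume_eq_prod, ← Measure.prod_restrict, integral_prod_symm]
    rw [Measure.prod_restrict]
    exact hcont.continuousOn.integrableOn_compact (isCompact_Icc.prod isCompact_Icc)
  rw [hfub]
  have hcont2 : Continuous fun v => ∫ u in Icc (o.1 - r) (o.1 + r),
      defect (fun s => |s| ^ p) t₁ t₂ (cr o x (u, v)) (vel s a o x (u, v)) := by
    refine continuous_parametric_integral_of_continuous ?_ isCompact_Icc
    exact hcont.comp (by fun_prop : Continuous fun q : ℝ × ℝ => (q.2, q.1))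
  have hT : 0 < t₁ * t₂ * (t₁ + t₂) := by positivity
  have hbound : ∀ v ∈ Icc y₀ y₁, (r / 4) ^ p * (r / (4 * C) * r ^ (p - 1) / 2 *
      (t₁ * t₂ * (t₁ + t₂)) * (H * r / 64) ^ 2) ≤ ∫ u in Icc (o.1 - r) (o.1 + r),
      defect (fun s => |s| ^ p) t₁ t₂ (cr o x (u, v)) (vel s a o x (u, v)) := by
    intro v hv
    have hv' : v = o.2 - ((o.2 - v) / Y) * Y := by field_simp; ring
    have g1 : ζ₁ ≤ (o.2 - v) / Y := by
      rw [le_div_iff₀ hYpos]; linarith [hv.2]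
    have g2 : (o.2 - v) / Y ≤ ζ₁ + r / 12 := by
      rw [div_le_iff₀ hYpos]; linarith [hv.1]
    have hl := line_gap (p := p) (C := C) (y₂ := v) (x := x) (o := o) (a := a) (s := s) hp hr
      (by linarith) hC ht₁ ht₂ hH
      hC1 hC2 ha0 haH hYpos hX (by linarith) hxH (by nlinarith [hv.2]) (hz0.trans g1)
      (g2.trans hz1) hv'
    rw [integral_Icc_eq_integral_Ioc, ← intervalIntegral.integral_of_le (by linarith)]
    refine le_trans ?_ hl
    have q1 : (r / 4) ^ p ≤ Y ^ p := Real.rpow_le_rpow (by positivity) hY (by linarith)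
    have q2 := hz _ g1 g2
    have q3 : (H * r / 64) ^ 2 ≤ ((x.2 - s) * r / 32) ^ 2 := by
      apply pow_le_pow_left₀ (by positivity)
      nlinarith
    have q4 : 0 ≤ r ^ (p - 1) := Real.rpow_nonneg hr.le _
    have q5 := Real.rpow_nonneg (show 0 ≤ r / 4 by linarith) p
    have q6 := q3.trans q2
    gcongr
  have := setIntegral_mono_on (μ := volume) (s := Icc y₀ y₁)
    (integrableOn_const (by simp)) (hcont2.continuousOn.integrableOn_compact isCompact_Icc)
    measurableSet_Icc hbound
  refine le_trans ?_ this
  rw [setIntegral_const, smul_eq_mul, Real.volume_real_Icc_of_le hle, hlen]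
  unfold gapConst
  have q4 : 0 ≤ r ^ (p - 1) := Real.rpow_nonneg hr.le _
  have q5 := Real.rpow_nonneg (show 0 ≤ r / 4 by linarith) p
  calc _ = (r / 12 * (r / 4)) * ((r / 4) ^ p * (r / (4 * C) * r ^ (p - 1) / 2 *
      (t₁ * t₂ * (t₁ + t₂)) * (H * r / 64) ^ 2)) := by ring
    _ ≤ _ := by gcongr

/-- A convex set has a definite proportion of its part above the level `s` in the upper half of
that part. -/
lemma area_upper {K : Set (ℝ × ℝ)} (hK : IsCompact K) (hc : Convex ℝ K) {s H : ℝ} {w : ℝ × ℝ}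
    (hw : w ∈ K) (hwH : w.2 - s = H) :
    area {z ∈ K | s < z.2} / 4 ≤ area {z ∈ K | H / 2 ≤ z.2 - s} := by
  have h1 := area_aff (1 / 2 * w.1, 1 / 2 * w.2) (1 / 2, 0) (0, 1 / 2) {z ∈ K | s < z.2}
  have h2 : |det2 ((1 : ℝ) / 2, (0 : ℝ)) (0, 1 / 2)| = 1 / 4 := by norm_num [det2]
  rw [h2] at h1
  have h3 : aff (1 / 2 * w.1, 1 / 2 * w.2) (1 / 2, 0) (0, 1 / 2) '' {z ∈ K | s < z.2} ⊆
      {z ∈ K | H / 2 ≤ z.2 - s} := by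
    rintro _ ⟨z, ⟨hz, hzs⟩, rfl⟩
    refine ⟨?_, ?_⟩
    · have := hc hz hw (show (0:ℝ) ≤ 1 / 2 by norm_num) (show (0:ℝ) ≤ 1 / 2 by norm_num)
        (by norm_num)
      convert this using 1
      ext <;> simp <;> ring
    · simp only [aff_snd]; linarith
  have hfin : volume {z ∈ K | H / 2 ≤ z.2 - s} ≠ ⊤ :=
    (lt_of_le_of_lt (measure_mono (sep_subset _ _)) hK.measure_lt_top).ne
  have h4 : area (aff (1 / 2 * w.1, 1 / 2 * w.2) (1 / 2, 0) (0, 1 / 2) '' {z ∈ K | s < z.2}) ≤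
    area {z ∈ K | H / 2 ≤ z.2 - s} := measureReal_mono h3 hfin
  linarith

/-- Lower bound for the integrated defect of the `p`-th moment: `x` ranges over the upper half of the
moving part of `K`, `y` over a static box below `o`. -/
lemma outer_gap {p r C s t₁ t₂ H a : ℝ} {o w : ℝ × ℝ} {K : Set (ℝ × ℝ)} (hp : 1 ≤ p) (hr : 0 < r)
    (hr1 : r ≤ 1 / 4) (hC : 1 ≤ C) (ht₁ : 0 < t₁) (ht₂ : 0 < t₂) (hH : 0 < H)
    (hC1 : t₁ * H ≤ C) (hC2 : t₂ * H ≤ C) (ha0 : 0 ≤ a) (haH : a ≤ H) (hK : Body K)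
    (hKb : ∀ z ∈ K, |z.1| ≤ 1 ∧ |z.2| ≤ 2) (ho : o ∈ K)
    (hbox : Icc (o.1 - r) (o.1 + r) ×ˢ Icc (o.2 - r) o.2 ⊆ K) (hos : o.2 ≤ s)
    (hKH : ∀ z ∈ K, z.2 - s ≤ H) (hw : w ∈ K) (hwH : w.2 - s = H)
    (hsep : r / 4 ≤ s + H / 2 - o.2) :
    gapConst r C p / 4 * (t₁ * t₂ * (t₁ + t₂) * H ^ 2 * area {z ∈ K | s < z.2}) ≤
      Wgap (fun s => |s| ^ p) s t₁ t₂ a K o := by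
  set S := {z ∈ K | H / 2 ≤ z.2 - s} with hS
  have hSc : IsCompact S := hK.cpt.inter_right
    (isClosed_le continuous_const (continuous_snd.sub continuous_const))
  have hcont := defect_cont (abs_rpow_cont hp) s t₁ t₂ a o
  have hci := cont_inner hK.cpt hcont
  have hmono : ∫ x in S, ∫ y in K, defect (fun s => |s| ^ p) t₁ t₂ (cr o x y) (vel s a o x y) ≤
      Wgap (fun s => |s| ^ p) s t₁ t₂ a K o :=
    setIntegral_mono_set (intOn_of_cont hK.cpt hci) (ae_of_all _ fun x => integral_nonneg fun y =>
      defect_nonneg (abs_rpow_convex hp) ht₁ ht₂ _ _)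
      (LE.le.eventuallyLE (sep_subset _ _))
  refine le_trans ?_ hmono
  have hb : ∀ x ∈ S, gapConst r C p * (t₁ * t₂ * (t₁ + t₂) * H ^ 2) ≤
      ∫ y in K, defect (fun s => |s| ^ p) t₁ t₂ (cr o x y) (vel s a o x y) := by
    rintro x ⟨hx, hxs⟩
    obtain ⟨x1, x2⟩ := hKb x hx
    obtain ⟨o1, o2⟩ := hKb o ho
    rw [abs_le] at x1 x2 o1 o2
    exact inner_gap hp hr hr1 hC ht₁ ht₂ hH hC1 hC2 ha0 haH hK.cpt hbox hos (by linarith)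
      (by linarith) (by rw [abs_le]; constructor <;> linarith) hxs (hKH x hx)
  have := setIntegral_mono_on (μ := volume) (s := S)
    (integrableOn_const hSc.measure_lt_top.ne) (intOn_of_cont hSc hci) hSc.measurableSet hb
  refine le_trans ?_ this
  rw [setIntegral_const, smul_eq_mul]
  have h4 := area_upper hK.cpt hK.cvx hw hwH
  have g0 := gapConst_nonneg (p := p) hr hC
  have hT : 0 ≤ gapConst r C p * (t₁ * t₂ * (t₁ + t₂) * H ^ 2) := by positivity
  have h5 : area {z ∈ K | s < z.2} / 4 ≤ volume.real S := h4
  calc _ = area {z ∈ K | s < z.2} / 4 * (gapConst r C p * (t₁ * t₂ * (t₁ + t₂) * H ^ 2)) := by ring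
    _ ≤ _ := mul_le_mul_of_nonneg_right h5 hT

/-- The constant decays at most exponentially in `p`. -/
lemma gapConst_lower (r C : ℝ) (hr : 0 < r) (hr1 : r ≤ 1 / 4) (hC : 1 ≤ C) :
    ∃ c, 0 < c ∧ c ≤ 1 ∧ ∀ p, 1 ≤ p → c ^ p ≤ gapConst r C p := by
  -- `k` collects the factors of `gapConst` that do not depend on `p`.
  set k := (r / 12) * (r / 4) * (r / (4 * C) / 2 * (r / 64) ^ 2) with hk
  have hk0 : 0 < k := by positivity
  set m := min k 1 with hm
  have hm0 : 0 < m := lt_min hk0 one_pos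
  refine ⟨m * ((r / 4) * r), by positivity, ?_, fun p hp => ?_⟩
  · have : m ≤ 1 := min_le_right _ _
    have : (r / 4) * r ≤ 1 := by nlinarith
    nlinarith
  · rw [Real.mul_rpow hm0.le (by positivity), Real.mul_rpow (by positivity) hr.le]
    have h1 : m ^ p ≤ k := by
      calc m ^ p ≤ m ^ (1 : ℝ) := Real.rpow_le_rpow_of_exponent_ge hm0 (min_le_right _ _) hp
        _ = m := Real.rpow_one m
        _ ≤ k := min_le_left _ _
    have h2 : r ^ p ≤ r ^ (p - 1) :=
      Real.rpow_le_rpow_of_exponent_ge hr (by linarith) (by linarith)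
    have h3 := Real.rpow_nonneg (show 0 ≤ r / 4 by linarith) p
    have h4 := Real.rpow_nonneg hr.le p
    calc m ^ p * ((r / 4) ^ p * r ^ p) ≤ k * ((r / 4) ^ p * r ^ (p - 1)) := by gcongr
      _ = gapConst r C p := by rw [hk]; unfold gapConst; ring

/-- Upper bound for the defect of the quadratic functional, of the same order as the lower bound in
`outer_gap`. -/
lemma sq_gap_upper {s t₁ t₂ H a : ℝ} {o : ℝ × ℝ} {K : Set (ℝ × ℝ)}
    (ht₁ : 0 < t₁) (ht₂ : 0 < t₂) (hK : Body K) (hA : area K ≤ 8)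
    (hKb : ∀ z ∈ K, |z.1| ≤ 1 ∧ |z.2| ≤ 2) (ho : o ∈ K) (hKH : ∀ z ∈ K, z.2 - s ≤ H)
    (ha : area K * a ^ 2 ≤ H ^ 2 * area {z ∈ K | s < z.2}) :
    Wgap (fun s => s ^ 2) s t₁ t₂ a K o ≤
      2048 * (t₁ * t₂ * (t₁ + t₂) * H ^ 2 * area {z ∈ K | s < z.2}) := by
  set P := {z ∈ K | s < z.2} with hP
  set β : ℝ × ℝ → ℝ := fun z => max (z.2 - s) 0 with hβ
  have hβc : Continuous β := by fun_prop
  have hT : 0 < t₁ * t₂ * (t₁ + t₂) := by positivity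
  have hPm : MeasurableSet P := hK.meas.inter (measurableSet_lt measurable_const measurable_snd)
  have hint : ∫ z in K, β z ^ 2 ≤ H ^ 2 * area P := by
    have e : ∀ z ∈ K, β z ^ 2 ≤ P.indicator (fun _ => H ^ 2) z := by
      intro z hz
      by_cases hzs : s < z.2
      · have hm : z ∈ P := ⟨hz, hzs⟩
        rw [indicator_of_mem hm]
        have : β z = z.2 - s := max_eq_left (by linarith)
        rw [this]
        exact pow_le_pow_left₀ (by linarith) (hKH z hz) 2
      · have : β z = 0 := max_eq_right (by linarith)
        rw [this]
        exact le_trans (by norm_num) (indicator_nonneg (fun _ _ => sq_nonneg H) z)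
    have hi : IntegrableOn (P.indicator fun _ => H ^ 2) K :=
      (integrableOn_const hK.cpt.measure_lt_top.ne).indicator hPm
    refine (setIntegral_mono_on (hK.intOn (hβc.pow 2)) hi hK.meas e).trans (le_of_eq ?_)
    rw [setIntegral_indicator hPm, setIntegral_const, smul_eq_mul, mul_comm,
      inter_eq_right.2 (sep_subset _ _)]
    rfl
  have hbd : ∀ x ∈ K, ∀ y ∈ K, defect (fun s => s ^ 2) t₁ t₂ (cr o x y) (vel s a o x y) ≤
      t₁ * t₂ * (t₁ + t₂) * (64 * (β x ^ 2 + β y ^ 2 + 2 * a ^ 2)) := by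
    intro x hx y hy
    rw [defect_sq]
    refine mul_le_mul_of_nonneg_left ?_ hT.le
    obtain ⟨-, x2⟩ := hKb x hx
    obtain ⟨-, y2⟩ := hKb y hy
    obtain ⟨-, o2⟩ := hKb o ho
    have q1 : (y.2 - o.2) ^ 2 ≤ 16 := by
      rw [abs_le] at x2 y2 o2; nlinarith
    have q2 : (x.2 - o.2) ^ 2 ≤ 16 := by
      rw [abs_le] at x2 y2 o2; nlinarith
    -- The velocity is a combination of `β x - a` and `β y - a` with coefficients at most `4`.
    have e : vel s a o x y = (β x - a) * (y.2 - o.2) - (x.2 - o.2) * (β y - a) := rfl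
    rw [e]
    have n1 : ((β x - a) * (y.2 - o.2)) ^ 2 ≤ 16 * (β x - a) ^ 2 := by
      rw [mul_pow]; nlinarith [sq_nonneg (β x - a)]
    have n2 : ((x.2 - o.2) * (β y - a)) ^ 2 ≤ 16 * (β y - a) ^ 2 := by
      rw [mul_pow]; nlinarith [sq_nonneg (β y - a)]
    nlinarith [sq_nonneg ((β x - a) * (y.2 - o.2) + (x.2 - o.2) * (β y - a)),
      sq_nonneg (β x + a), sq_nonneg (β y + a)]
  have hGc : Continuous (Function.uncurry fun x y : ℝ × ℝ =>
      t₁ * t₂ * (t₁ + t₂) * (64 * (β x ^ 2 + β y ^ 2 + 2 * a ^ 2))) := by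
    simp only [Function.uncurry_def]; fun_prop
  have h1 := double_mono hK.cpt (defect_cont (continuous_pow 2) s t₁ t₂ a o) hGc hbd
  have hi1 : IntegrableOn (fun z => β z ^ 2) K := hK.intOn (hβc.pow 2)
  have hic : ∀ c : ℝ, IntegrableOn (fun _ : ℝ × ℝ => c) K := fun c => hK.intOn continuous_const
  have hA0 := hK.area_pos
  have h2 : ∫ x in K, ∫ y in K, t₁ * t₂ * (t₁ + t₂) * (64 * (β x ^ 2 + β y ^ 2 + 2 * a ^ 2)) =
      t₁ * t₂ * (t₁ + t₂) * (64 * (2 * area K * (∫ z in K, β z ^ 2) +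
        2 * a ^ 2 * area K * area K)) := by
    have in1 : ∀ x, ∫ y in K, (β x ^ 2 + β y ^ 2 + 2 * a ^ 2) =
        area K * β x ^ 2 + ((∫ z in K, β z ^ 2) + area K * (2 * a ^ 2)) := by
      intro x
      have : ∫ y in K, (β x ^ 2 + β y ^ 2 + 2 * a ^ 2) =
          (∫ y in K, (β x ^ 2 + β y ^ 2)) + ∫ y in K, 2 * a ^ 2 :=
        integral_add ((hic _).add hi1) (hic _)
      rw [this, integral_add (hic _) hi1]
      rw [setIntegral_const, setIntegral_const, smul_eq_mul, smul_eq_mul]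
      unfold area; ring
    simp_rw [integral_const_mul, in1]
    rw [integral_add (hi1.const_mul _) (hic _), integral_const_mul, setIntegral_const, smul_eq_mul]
    unfold area; ring
  have h3 : Wgap (fun s => s ^ 2) s t₁ t₂ a K o ≤ _ := h1.trans (le_of_eq h2)
  refine h3.trans ?_
  have n0 : 0 ≤ H ^ 2 * area P := by
    have : 0 ≤ area P := measureReal_nonneg
    positivity
  have n1 : 2 * area K * (∫ z in K, β z ^ 2) ≤ 16 * (H ^ 2 * area P) := by
    have : 0 ≤ ∫ z in K, β z ^ 2 := integral_nonneg fun _ => sq_nonneg _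
    nlinarith
  have n2 : 2 * a ^ 2 * area K * area K ≤ 16 * (H ^ 2 * area P) := by
    have : 0 ≤ area K * a ^ 2 := by positivity
    nlinarith
  calc _ ≤ t₁ * t₂ * (t₁ + t₂) * (64 * (32 * (H ^ 2 * area P))) := by
        refine mul_le_mul_of_nonneg_left ?_ hT.le
        linarith
    _ = _ := by ring

/-! ### Bodies in normalised position -/

lemma abs_cr_swap_left (a b c : ℝ × ℝ) : |cr b a c| = |cr a b c| := by
  rw [← abs_neg (cr b a c)]; congr 1; unfold cr; ring

lemma abs_cr_swap_right (a b c : ℝ × ℝ) : |cr a c b| = |cr a b c| := by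
  rw [← abs_neg (cr a c b)]; congr 1; unfold cr; ring

lemma Body.nondeg {K : Set (ℝ × ℝ)} (hK : Body K) :
    ∃ a ∈ K, ∃ b ∈ K, ∃ c ∈ K, cr a b c ≠ 0 := by
  obtain ⟨z, hz⟩ := hK.int
  rw [mem_interior_iff_mem_nhds, Metric.mem_nhds_iff] at hz
  obtain ⟨ε, hε, hb⟩ := hz
  refine ⟨z, hb (Metric.mem_ball_self hε), (z.1 + ε / 2, z.2), hb ?_, (z.1, z.2 + ε / 2), hb ?_, ?_⟩
  · simp [Prod.dist_eq, abs_of_pos hε]; exact hε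
  · simp [Prod.dist_eq, abs_of_pos hε]; exact hε
  · simp [cr]; exact hε.ne'

/-- A triangle of maximal area inscribed in a convex body, its vertices ordered by height. -/
lemma exists_max_triangle {K : Set (ℝ × ℝ)} (hK : Body K) :
    ∃ a ∈ K, ∃ b ∈ K, ∃ c ∈ K, a.2 ≤ b.2 ∧ b.2 ≤ c.2 ∧ 0 < |cr a b c| ∧
      ∀ x ∈ K, ∀ y ∈ K, ∀ z ∈ K, |cr x y z| ≤ |cr a b c| := by
  have hc : Continuous fun q : (ℝ × ℝ) × (ℝ × ℝ) × (ℝ × ℝ) => |cr q.1 q.2.1 q.2.2| := by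
    unfold cr; fun_prop
  obtain ⟨a0, ha0, b0, hb0, c0, hc0, h0⟩ := hK.nondeg
  obtain ⟨⟨a, b, c⟩, ⟨ha, hb, hcc⟩, hmax⟩ := (hK.cpt.prod (hK.cpt.prod hK.cpt)).exists_isMaxOn
    ⟨(a0, b0, c0), ha0, hb0, hc0⟩ hc.continuousOn
  have hm : ∀ x ∈ K, ∀ y ∈ K, ∀ z ∈ K, |cr x y z| ≤ |cr a b c| :=
    fun x hx y hy z hz => hmax (show (x, y, z) ∈ K ×ˢ K ×ˢ K from ⟨hx, hy, hz⟩)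
  have hp : 0 < |cr a b c| := (abs_pos.2 h0).trans_le (hm _ ha0 _ hb0 _ hc0)
  have s1 := abs_cr_swap_left
  have s2 := abs_cr_swap_right
  rcases le_total a.2 b.2 with h1 | h1 <;> rcases le_total b.2 c.2 with h2 | h2 <;>
    rcases le_total a.2 c.2 with h3 | h3
  · exact ⟨a, ha, b, hb, c, hcc, h1, h2, hp, hm⟩
  · exact ⟨a, ha, b, hb, c, hcc, h1, h2, hp, hm⟩
  · refine ⟨a, ha, c, hcc, b, hb, h3, h2, ?_⟩; rw [s2 a b c]; exact ⟨hp, hm⟩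
  · refine ⟨c, hcc, a, ha, b, hb, h3, h1, ?_⟩; rw [s1 a c b, s2 a b c]; exact ⟨hp, hm⟩
  · refine ⟨b, hb, a, ha, c, hcc, h1, h3, ?_⟩; rw [s1 a b c]; exact ⟨hp, hm⟩
  · refine ⟨b, hb, c, hcc, a, ha, h2, h3, ?_⟩; rw [s2 b a c, s1 a b c]; exact ⟨hp, hm⟩
  · refine ⟨c, hcc, b, hb, a, ha, h2, h1, ?_⟩; rw [s2 c a b, s1 a c b, s2 a b c]; exact ⟨hp, hm⟩
  · refine ⟨c, hcc, b, hb, a, ha, h2, h1, ?_⟩; rw [s2 c a b, s1 a c b, s2 a b c]; exact ⟨hp, hm⟩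

lemma Body.integral_affine {K : Set (ℝ × ℝ)} (hK : Body K) (k l₁ l₂ : ℝ) :
    ∫ z in K, (k + l₁ * z.1 + l₂ * z.2) = area K * (k + l₁ * (cen K).1 + l₂ * (cen K).2) := by
  have hA := hK.area_pos.ne'
  have i1 : IntegrableOn (fun z : ℝ × ℝ => k + l₁ * z.1) K := hK.intOn (by fun_prop)
  have i2 : IntegrableOn (fun z : ℝ × ℝ => l₂ * z.2) K := hK.intOn (by fun_prop)
  have i3 : IntegrableOn (fun z : ℝ × ℝ => l₁ * z.1) K := hK.intOn (by fun_prop)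
  have i4 : IntegrableOn (fun _ : ℝ × ℝ => k) K := hK.intOn (by fun_prop)
  rw [integral_add i1 i2, integral_add i4 i3, integral_const_mul, integral_const_mul,
    setIntegral_const, smul_eq_mul]
  simp only [cen]
  change area K * k + _ + _ = _
  field_simp

lemma cen_T0 : cen T0 = (1 / 3, 1 / 3) := by
  have h1 : ∫ z in T0, z.1 = 1 / 6 := by
    rw [integral_T0 continuous_fst]
    have : ∀ x : ℝ, ∫ _ in (0:ℝ)..(1 - x), x = x - x ^ 2 := by intro x; simp; ring
    simp_rw [this]
    rw [intervalIntegral.integral_sub (by simp) (by simp)]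
    simp; norm_num
  have h2 : ∫ z in T0, z.2 = 1 / 6 := by
    rw [integral_T0 continuous_snd]
    have : ∀ x : ℝ, ∫ y in (0:ℝ)..(1 - x), y = 1 / 2 - x + x ^ 2 / 2 := by intro x; simp; ring
    simp_rw [this]
    have ii : ∀ f : ℝ → ℝ, Continuous f → IntervalIntegrable f volume 0 1 := fun f hf =>
      hf.intervalIntegrable _ _
    rw [intervalIntegral.integral_add (ii _ (by fun_prop)) (ii _ (by fun_prop)),
      intervalIntegral.integral_sub (ii _ (by fun_prop)) (ii _ (by fun_prop))]
    simp; norm_num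
  simp only [cen, area_T0, h1, h2]; norm_num

lemma tri_subset {K : Set (ℝ × ℝ)} (hK : Convex ℝ K) {a b c : ℝ × ℝ} (ha : a ∈ K) (hb : b ∈ K)
    (hc : c ∈ K) : tri a b c ⊆ K :=
  convexHull_min (by rintro z (rfl | rfl | rfl) <;> assumption) hK

lemma comb3 {K : Set (ℝ × ℝ)} (hK : Convex ℝ K) {a b c z : ℝ × ℝ} (ha : a ∈ K) (hb : b ∈ K)
    (hc : c ∈ K) {x y : ℝ} (hx : 0 ≤ x) (hy : 0 ≤ y) (hxy : x + y ≤ 1)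
    (h1 : z.1 = x * (b.1 - a.1) + y * (c.1 - a.1) + a.1)
    (h2 : z.2 = x * (b.2 - a.2) + y * (c.2 - a.2) + a.2) : z ∈ K := by
  apply tri_subset hK ha hb hc
  rw [tri_eq_aff]
  refine ⟨(x, y), ⟨hx, hy, hxy⟩, ?_⟩
  ext
  · rw [aff_fst, h1]; rfl
  · rw [aff_snd, h2]; rfl

lemma tri_body {a b c : ℝ × ℝ} (h : cr a b c ≠ 0) : Body (tri a b c) := by
  rw [tri_eq_aff]; exact T0_body.aff (by rwa [det2_eq_cr])

lemma cen_tri {a b c : ℝ × ℝ} (h : cr a b c ≠ 0) :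
    cen (tri a b c) = ((a.1 + b.1 + c.1) / 3, (a.2 + b.2 + c.2) / 3) := by
  rw [tri_eq_aff, cen_aff T0_body (by rwa [det2_eq_cr]), cen_T0]
  ext
  · rw [aff_fst]; simp; ring
  · rw [aff_snd]; simp; ring

lemma area_mono {K L : Set (ℝ × ℝ)} (h : K ⊆ L) (hL : IsCompact L) : area K ≤ area L :=
  measureReal_mono h hL.measure_lt_top.ne

/-- The body sits in a fixed frame with uniform bounds: it is contained in a fixed box, its area
is bounded below and above and it contains a fixed neighbourhood of its centroid. -/
structure Normed (K : Set (ℝ × ℝ)) : Prop where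
  bdd : ∀ z ∈ K, |z.1| ≤ 1 ∧ |z.2| ≤ 2
  area_ge : 1 / 2 ≤ area K
  area_le : area K ≤ 8
  box : ∀ z : ℝ × ℝ, |z.1 - (cen K).1| ≤ 1 / 96 → |z.2 - (cen K).2| ≤ 1 / 96 → z ∈ K

/-- A body in which `(0, 0)`, `(0, 1)`, `(±1, y)` span a triangle of maximal area is in normalised
position. -/
lemma normed_of_max {K : Set (ℝ × ℝ)} (hK : Body K) {e y : ℝ} (he : |e| = 1) (hy0 : 0 ≤ y)
    (hy1 : y ≤ 1) (h0 : ((0 : ℝ), (0 : ℝ)) ∈ K) (h1 : ((0 : ℝ), (1 : ℝ)) ∈ K) (hb : (e, y) ∈ K)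
    (hmax : ∀ a ∈ K, ∀ b ∈ K, ∀ c ∈ K, |cr a b c| ≤ 1) : Normed K := by
  have he2 : e = 1 ∨ e = -1 := by
    rcases abs_cases e with ⟨h, -⟩ | ⟨h, -⟩
    · left; linarith
    · right; linarith
  have hcr : cr ((0 : ℝ), (0 : ℝ)) (e, y) (0, 1) = e := by simp [cr]
  have hne : cr ((0 : ℝ), (0 : ℝ)) (e, y) (0, 1) ≠ 0 := by
    rw [hcr]; intro h; rw [h] at he; simp at he
  have hTK := tri_subset hK.cvx h0 hb h1
  have hTa : area (tri ((0 : ℝ), (0 : ℝ)) (e, y) (0, 1)) = 1 / 2 := by rw [area_tri, hcr, he]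
  have hbdd : ∀ z ∈ K, |z.1| ≤ 1 ∧ |z.2| ≤ 2 := by
    intro z hz
    have q1 := hmax _ h0 _ h1 _ hz
    have q2 := hmax _ h0 _ hb _ hz
    simp only [cr, sub_zero] at q1 q2
    have q3 : |z.1| ≤ 1 := by simpa using q1
    refine ⟨q3, ?_⟩
    rw [abs_le] at q2 q3 ⊢
    rcases he2 with rfl | rfl <;> constructor <;> nlinarith
  have hA8 : area K ≤ 8 := by
    have hs : K ⊆ Icc (-1) 1 ×ˢ Icc (-2) 2 := by
      intro z hz
      obtain ⟨q1, q2⟩ := hbdd z hz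
      exact ⟨abs_le.1 q1, abs_le.1 q2⟩
    refine (area_mono hs (isCompact_Icc.prod isCompact_Icc)).trans (le_of_eq ?_)
    rw [area, Measure.volume_eq_prod, measureReal_prod_prod,
      Real.volume_real_Icc_of_le (by norm_num), Real.volume_real_Icc_of_le (by norm_num)]
    norm_num
  refine ⟨hbdd, hTa ▸ area_mono hTK hK.cpt, hA8, ?_⟩
  intro q hq1 hq2
  by_contra hq
  -- If `q ∉ K`, some linear `f` satisfies `f < f q` on `K`. The integral of `f q - f` over the inscribed
  -- triangle is at least `(|l₁| + |l₂|) / 12`, since the box of half-width `1 / 6` about its centroid lies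
  -- in `K`; over `K` it is `area K * (f q - f (cen K))`, and `area K ≤ 8`, which bounds the distance of `q`
  -- to the centroid of `K` from below.
  obtain ⟨f, u, hf1, hf2⟩ := geometric_hahn_banach_closed_point hK.cvx hK.cpt.isClosed hq
  set l₁ := f (1, 0) with hl1
  set l₂ := f (0, 1) with hl2
  have hf : ∀ z : ℝ × ℝ, f z = l₁ * z.1 + l₂ * z.2 := clm_apply_prod f
  have hlt : ∀ z ∈ K, l₁ * z.1 + l₂ * z.2 < f q := fun z hz => by
    rw [← hf]; exact (hf1 z hz).trans hf2
  have hT := tri_body hne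
  have hmono : ∫ z in tri ((0 : ℝ), (0 : ℝ)) (e, y) (0, 1), (f q + (-l₁) * z.1 + (-l₂) * z.2) ≤
      ∫ z in K, (f q + (-l₁) * z.1 + (-l₂) * z.2) := by
    refine setIntegral_mono_set (hK.intOn (by fun_prop)) ?_ (LE.le.eventuallyLE hTK)
    filter_upwards [ae_restrict_mem hK.meas] with z hz
    have := hlt z hz
    simp only [Pi.zero_apply]; linarith
  rw [hT.integral_affine, hK.integral_affine, hTa, cen_tri hne] at hmono
  simp only [hf q] at hmono hlt
  have cor : ∀ a b : ℝ, |a| = 1 → |b| = 1 →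
      l₁ * (e / 3 + a / 6) + l₂ * ((y + 1) / 3 + b / 6) < l₁ * q.1 + l₂ * q.2 := by
    intro a b ha hb'
    have ha2 : a = 1 ∨ a = -1 := eq_or_eq_neg_of_abs_eq ha
    have hb2 : b = 1 ∨ b = -1 := eq_or_eq_neg_of_abs_eq hb'
    obtain ⟨x, hx⟩ : ∃ x, x = 1 / 3 + a * e / 6 := ⟨_, rfl⟩
    have hx0 : 1 / 6 ≤ x ∧ x ≤ 1 / 2 := by
      rcases ha2 with rfl | rfl <;> rcases he2 with rfl | rfl <;> constructor <;> linarith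
    have hb3 : -1 ≤ b ∧ b ≤ 1 := abs_le.1 hb'.le
    have m1 : x * y ≤ 1 / 2 * y := mul_le_mul_of_nonneg_right hx0.2 hy0
    have m2 : x * (1 - y) ≤ 1 / 2 * (1 - y) := mul_le_mul_of_nonneg_right hx0.2 (by linarith)
    refine hlt (e / 3 + a / 6, (y + 1) / 3 + b / 6) (comb3 hK.cvx h0 hb h1
      (x := x) (y := (y + 1) / 3 + b / 6 - x * y) (by linarith [hx0.1]) (by linarith)
      (by linarith) ?_ ?_)
    · have e2 : e * e = 1 := by rcases he2 with rfl | rfl <;> norm_num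
      simp only [sub_zero, sub_self, mul_zero, add_zero]
      rw [hx]; linear_combination (-a / 6) * e2
    · simp
  obtain ⟨a, ha, ha'⟩ : ∃ a : ℝ, |a| = 1 ∧ l₁ * a = |l₁| := by
    rcases abs_cases l₁ with ⟨h, -⟩ | ⟨h, -⟩
    · exact ⟨1, by simp, by rw [h]; ring⟩
    · exact ⟨-1, by simp, by rw [h]; ring⟩
  obtain ⟨b, hb1, hb'⟩ : ∃ b : ℝ, |b| = 1 ∧ l₂ * b = |l₂| := by
    rcases abs_cases l₂ with ⟨h, -⟩ | ⟨h, -⟩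
    · exact ⟨1, by simp, by rw [h]; ring⟩
    · exact ⟨-1, by simp, by rw [h]; ring⟩
  have hc := cor a b ha hb1
  have b1 : l₁ * (q.1 - (cen K).1) ≤ |l₁| * (1 / 96) :=
    (le_abs_self _).trans (by rw [abs_mul]; gcongr)
  have b2 : l₂ * (q.2 - (cen K).2) ≤ |l₂| * (1 / 96) :=
    (le_abs_self _).trans (by rw [abs_mul]; gcongr)
  have n1 := abs_nonneg l₁
  have n2 := abs_nonneg l₂
  have hA0 := hK.area_pos
  have b3 : area K * (l₁ * (q.1 - (cen K).1) + l₂ * (q.2 - (cen K).2)) ≤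
      8 * ((|l₁| + |l₂|) * (1 / 96)) := by
    calc _ ≤ area K * ((|l₁| + |l₂|) * (1 / 96)) := by gcongr; linarith
      _ ≤ _ := by gcongr
  nlinarith

/-- Every convex body can be normalised by an affine map that keeps horizontal lines horizontal
and preserves the directions of both axes: the triangle of maximal area, its vertices `a`, `b`, `c`
ordered by height, is mapped to `(0, 0)`, `(±1, y)`, `(0, 1)`. -/
lemma exists_normed {K : Set (ℝ × ℝ)} (hK : Body K) : ∃ (α κ μ : ℝ) (o : ℝ × ℝ), 0 < α ∧ 0 < μ ∧
    Normed (aff o (α, 0) (κ, μ) '' K) := by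
  obtain ⟨a, ha, b, hb, c, hc, hab, hbc, hD, hmax⟩ := exists_max_triangle hK
  set D := |cr a b c| with hDdef
  -- A triangle of positive area is not horizontal.
  have hac : 0 < c.2 - a.2 := by
    rcases (hab.trans hbc).lt_or_eq with h | h
    · linarith
    · exfalso
      have h1 : b.2 = a.2 := by linarith
      have : cr a b c = 0 := by unfold cr; rw [h1, ← h]; ring
      rw [hDdef, this] at hD; simp at hD
  set h := c.2 - a.2 with hh
  set L : (ℝ × ℝ) →ᵃ[ℝ] (ℝ × ℝ) := aff ((-(h * a.1) + (c.1 - a.1) * a.2) / D, -a.2 / h)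
    (h / D, 0) (-(c.1 - a.1) / D, 1 / h)
    with hL
  have hdet : det2 (h / D, (0 : ℝ)) (-(c.1 - a.1) / D, 1 / h) = 1 / D := by
    simp only [det2]; field_simp; ring
  have hdet0 : det2 (h / D, (0 : ℝ)) (-(c.1 - a.1) / D, 1 / h) ≠ 0 := by rw [hdet]; positivity
  have L1 : ∀ z, (L z).1 = (h * (z.1 - a.1) - (c.1 - a.1) * (z.2 - a.2)) / D := by
    intro z; rw [hL, aff_fst]; field_simp; ring
  have L2 : ∀ z, (L z).2 = (z.2 - a.2) / h := by
    intro z; rw [hL, aff_snd]; field_simp; ring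
  have Lb : |(L b).1| = 1 := by
    have : h * (b.1 - a.1) - (c.1 - a.1) * (b.2 - a.2) = cr a b c := by
      rw [hh]; unfold cr; ring
    rw [L1, this, abs_div, abs_of_pos hD, ← hDdef, div_self hD.ne']
  refine ⟨h / D, -(c.1 - a.1) / D, 1 / h, ((-(h * a.1) + (c.1 - a.1) * a.2) / D, -a.2 / h),
    by positivity, by positivity, ?_⟩
  refine normed_of_max (hK.aff hdet0) (e := (L b).1) (y := (L b).2) Lb ?_ ?_ ⟨a, ha, ?_⟩
    ⟨c, hc, ?_⟩ ⟨b, hb, rfl⟩ ?_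
  · rw [L2]; apply div_nonneg <;> linarith
  · rw [L2, div_le_one hac]; linarith
  · ext
    · change (L a).1 = _; rw [L1]; simp
    · change (L a).2 = _; rw [L2]; simp
  · ext
    · change (L c).1 = _; rw [L1, hh]; ring
    · change (L c).2 = _; rw [L2]; exact div_self hac.ne'
  · rintro _ ⟨x, hx, rfl⟩ _ ⟨y, hy, rfl⟩ _ ⟨z, hz, rfl⟩
    rw [cr_aff, hdet, abs_mul, abs_of_pos (by positivity : (0:ℝ) < 1 / D), one_div_mul_eq_div,
      div_le_one hD]
    exact hmax x hx y hy z hz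

/-! ### Shear convexity of the moments -/

/-- Invariance of a functional of convex bodies under nondegenerate affine maps. -/
def AffInv (F : Set (ℝ × ℝ) → ℝ) : Prop :=
  ∀ K, Body K → ∀ o u v : ℝ × ℝ, det2 u v ≠ 0 → F (aff o u v '' K) = F K

/-- The convexity defect of `F` along the family `sh s t '' K`. -/
def gap (F : Set (ℝ × ℝ) → ℝ) (s t₁ t₂ : ℝ) (K : Set (ℝ × ℝ)) : ℝ :=
  t₂ * F (sh s (-t₁) '' K) + t₁ * F (sh s t₂ '' K) - (t₁ + t₂) * F K

/-- A functional that is convex along every family `sh s t '' K` of convex bodies. -/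
def ShearConvex (F : Set (ℝ × ℝ) → ℝ) : Prop :=
  ∀ K s t₁ t₂, Body K → 0 < t₁ → 0 < t₂ → Convex ℝ (sh s (-t₁) '' K) → Convex ℝ (sh s t₂ '' K) →
    0 ≤ gap F s t₁ t₂ K

lemma half_rpow (p : ℝ) : (fun s : ℝ => (|s| / 2) ^ p) = fun s => (1 / 2) ^ p * |s| ^ p := by
  ext s
  rw [← Real.mul_rpow (by norm_num) (abs_nonneg s)]; congr 1; ring

lemma gap_Th {K : Set (ℝ × ℝ)} (hK : Body K) (s t₁ t₂ : ℝ) :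
    gap Th s t₁ t₂ K = (area K ^ 4)⁻¹ * Wgap (fun s => s ^ 2) s t₁ t₂ (mdis s K) K (cen K) := by
  unfold gap Th
  rw [← Wgap_eq (continuous_pow 2) s t₁ t₂ _ hK.cpt, cen_sh hK, cen_sh hK, area_sh, area_sh]
  ring

lemma gap_Es {p : ℝ} (hp : 1 ≤ p) {K : Set (ℝ × ℝ)} (hK : Body K) (s t₁ t₂ : ℝ) :
    gap (Es p) s t₁ t₂ K = area K ^ (-2 - p) * (1 / 2) ^ p *
      Wgap (fun s => |s| ^ p) s t₁ t₂ (mdis s K) K (cen K) := by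
  unfold gap Es
  rw [← Wgap_eq (abs_rpow_cont hp) s t₁ t₂ _ hK.cpt, cen_sh hK, cen_sh hK, area_sh, area_sh]
  simp only [half_rpow, W_const_mul]
  ring

lemma W_cont {φ : ℝ → ℝ} (hφ : Continuous φ) {K : Set (ℝ × ℝ)} (hK : IsCompact K) :
    Continuous (W φ K) := by
  unfold W
  refine cont_inner hK ?_
  simp only [Function.uncurry_def]
  refine cont_inner hK ?_
  simp only [Function.uncurry_def, cr]
  fun_prop

lemma gap_E3 {p : ℝ} (hp : 1 ≤ p) {K : Set (ℝ × ℝ)} (hK : Body K) (s t₁ t₂ : ℝ) :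
    gap (E3 p) s t₁ t₂ K = area K ^ (-3 - p) * (1 / 2) ^ p *
      ∫ o in K, Wgap (fun s => |s| ^ p) s t₁ t₂ (max (o.2 - s) 0) K o := by
  have hc := abs_rpow_cont hp
  have hW : ∀ t, Continuous fun o => W (fun s => |s| ^ p) (sh s t '' K) (sh s t o) := fun t =>
    (W_cont hc (hK.cpt.image (sh_cont s t))).comp (sh_cont s t)
  have h := single_lin hK.cpt t₂ t₁ (t₁ + t₂) (hW (-t₁)) (hW t₂) (W_cont hc hK.cpt)
  unfold gap E3
  simp only [half_rpow, W_const_mul, integral_const_mul, area_sh]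
  rw [integral_sh, integral_sh]
  have e : ∀ o, t₂ * W (fun s => |s| ^ p) (sh s (-t₁) '' K) (sh s (-t₁) o) +
      t₁ * W (fun s => |s| ^ p) (sh s t₂ '' K) (sh s t₂ o) - (t₁ + t₂) * W (fun s => |s| ^ p) K o =
      Wgap (fun s => |s| ^ p) s t₁ t₂ (max (o.2 - s) 0) K o := fun o =>
    Wgap_eq hc s t₁ t₂ (max (o.2 - s) 0) hK.cpt o
  simp only [e] at h
  rw [← h]; ring

/-- Bound for the admissible shear parameters: the highest point, after the shear, and two static
points near the centroid span a triangle whose area is at most that of the body. -/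
lemma shear_bound {K : Set (ℝ × ℝ)} (hK : Body K) (hN : Normed K) {s t H : ℝ} {w : ℝ × ℝ}
    (hs : (cen K).2 ≤ s) (hw : w ∈ K) (hwH : w.2 - s = H) (hH : 0 ≤ H)
    (hc : Convex ℝ (sh s t '' K)) : |t * H| ≤ 2000 := by
  have hb := hN.box
  have c0 : cen K ∈ K := hb _ (by simp) (by simp)
  have c1 : ((cen K).1, (cen K).2 - 1 / 96) ∈ K := hb _ (by simp) (by norm_num [abs_of_pos])
  have st : ∀ z ∈ K, z.2 ≤ s → z ∈ sh s t '' K := fun z hz hzs =>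
    ⟨z, hz, by ext <;> simp [sh, hzs]⟩
  have m0 := st _ c0 hs
  have m1 := st _ c1 (by simp only; linarith)
  have m2 : (w.1 + t * H, w.2) ∈ sh s t '' K :=
    ⟨w, hw, by ext <;> simp [sh, hwH, hH]⟩
  have ha := area_mono (tri_subset hc m0 m1 m2) (hK.sh hc).cpt
  rw [area_tri, area_sh] at ha
  have e : cr (cen K) ((cen K).1, (cen K).2 - 1 / 96) (w.1 + t * H, w.2) =
      1 / 96 * (w.1 + t * H - (cen K).1) := by unfold cr; ring
  rw [e] at ha
  have := hN.area_le
  have q1 := (hN.bdd w hw).1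
  have q2 := (hN.bdd _ c0).1
  have q3 : |1 / 96 * (w.1 + t * H - (cen K).1)| ≤ 16 := by linarith
  rw [abs_le] at q1 q2 q3 ⊢
  constructor <;> linarith [q3.1, q3.2, q1.1, q1.2, q2.1, q2.2]

lemma mdis_nonneg (s : ℝ) (K : Set (ℝ × ℝ)) : 0 ≤ mdis s K :=
  mul_nonneg (inv_nonneg.2 measureReal_nonneg) (integral_nonneg fun _ => le_max_right _ _)

lemma mdis_le {K : Set (ℝ × ℝ)} (hK : Body K) {s H : ℝ} (hH : 0 ≤ H)
    (hKH : ∀ z ∈ K, z.2 - s ≤ H) : mdis s K ≤ H * area {z ∈ K | s < z.2} / area K := by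
  have hA := hK.area_pos
  have hPm : MeasurableSet {z ∈ K | s < z.2} :=
    hK.meas.inter (measurableSet_lt measurable_const measurable_snd)
  have hi : IntegrableOn ({z ∈ K | s < z.2}.indicator fun _ => H) K :=
    (integrableOn_const hK.cpt.measure_lt_top.ne).indicator hPm
  have h : ∫ z in K, max (z.2 - s) 0 ≤ ∫ z in K, {z ∈ K | s < z.2}.indicator (fun _ => H) z := by
    refine setIntegral_mono_on (hK.intOn (by fun_prop)) hi hK.meas fun z hz => ?_
    by_cases hzs : s < z.2
    · have hm : z ∈ {z ∈ K | s < z.2} := ⟨hz, hzs⟩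
      rw [indicator_of_mem hm, max_eq_left (by linarith)]
      exact hKH z hz
    · rw [max_eq_right (by linarith)]
      exact indicator_nonneg (fun _ _ => hH) z
  rw [setIntegral_indicator hPm, setIntegral_const, smul_eq_mul,
    inter_eq_right.2 (sep_subset _ _)] at h
  unfold mdis
  rw [inv_mul_eq_div]
  gcongr
  refine h.trans (le_of_eq ?_)
  rw [mul_comm]; rfl

/-- In normalised position the convexity defects of both moments dominate `c ^ p` times that of the
quadratic functional, if the centroid lies below the kink. -/
lemma gap_normed : ∃ c : ℝ, 0 < c ∧ c ≤ 1 ∧ ∀ p : ℝ, 1 ≤ p → ∀ K s t₁ t₂, Body K → Normed K →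
    (cen K).2 ≤ s → 0 < t₁ → 0 < t₂ → Convex ℝ (sh s (-t₁) '' K) → Convex ℝ (sh s t₂ '' K) →
    c ^ p * gap Th s t₁ t₂ K ≤ gap (Es p) s t₁ t₂ K ∧
    c ^ p * gap Th s t₁ t₂ K ≤ gap (E3 p) s t₁ t₂ K ∧ 0 ≤ gap Th s t₁ t₂ K := by
  obtain ⟨c₁, hc1, hc1', hc1p⟩ := gapConst_lower (1 / 96) 2000 (by norm_num) (by norm_num)
    (by norm_num)
  obtain ⟨c₂, hc2, hc2', hc2p⟩ := gapConst_lower (1 / 192) 2000 (by norm_num) (by norm_num)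
    (by norm_num)
  set m := min c₁ c₂ with hm
  have hm0 : 0 < m := lt_min hc1 hc2
  have hm1 : m ≤ 1 := (min_le_left _ _).trans hc1'
  have hmp : ∀ p : ℝ, 1 ≤ p → 0 ≤ m ^ p ∧ m ^ p ≤ gapConst (1 / 96) 2000 p ∧
      m ^ p ≤ gapConst (1 / 192) 2000 p := fun p hp =>
    ⟨Real.rpow_nonneg hm0.le p,
      (Real.rpow_le_rpow hm0.le (min_le_left _ _) (by linarith)).trans (hc1p p hp),
      (Real.rpow_le_rpow hm0.le (min_le_right _ _) (by linarith)).trans (hc2p p hp)⟩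
  -- The factor `1 / 4` comes from `outer_gap`, `16 * 2048` from the bound for the defect of `Th`, and
  -- `20000` from the area of the set of static vertices used for `E3`.
  set k : ℝ := 1 / 4 / (16 * 2048) / 20000 with hk
  refine ⟨m * (1 / 2 * ((1 / 8 ^ 4) * k)), by positivity, by rw [hk]; nlinarith, ?_⟩
  intro p hp K s t₁ t₂ hK hN hs ht₁ ht₂ hv₁ hv₂
  have hTh := gap_Th hK s t₁ t₂
  have hEs := gap_Es hp hK s t₁ t₂
  have hE3 := gap_E3 hp hK s t₁ t₂
  have hA := hK.area_pos
  have hsqc : ConvexOn ℝ univ fun s : ℝ => s ^ 2 := (Even.convexOn_pow (by decide : Even 2))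
  have hTh0 : 0 ≤ gap Th s t₁ t₂ K := by
    rw [hTh]; exact mul_nonneg (by positivity) (Wgap_nonneg hsqc ht₁ ht₂ _ _)
  suffices hh : (m * (1 / 2 * ((1 / 8 ^ 4) * k))) ^ p * gap Th s t₁ t₂ K ≤ gap (Es p) s t₁ t₂ K ∧
      (m * (1 / 2 * ((1 / 8 ^ 4) * k))) ^ p * gap Th s t₁ t₂ K ≤ gap (E3 p) s t₁ t₂ K from
    ⟨hh.1, hh.2, hTh0⟩
  have c0 : cen K ∈ K := hN.box _ (by simp) (by simp)
  obtain ⟨w, hw, hwm⟩ := hK.cpt.exists_isMaxOn ⟨_, c0⟩ continuous_snd.continuousOn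
  obtain ⟨H, hwH⟩ : ∃ H, w.2 - s = H := ⟨_, rfl⟩
  have hKH : ∀ z ∈ K, z.2 - s ≤ H := fun z hz => by
    have : z.2 ≤ w.2 := hwm hz
    linarith
  rcases le_or_gt H 0 with hH | hH
  · -- the whole body lies below the kink
    have hid : ∀ t, sh s t '' K = K := by
      intro t
      have : ∀ z ∈ K, sh s t z = z := fun z hz => by
        have : z.2 - s ≤ 0 := (hKH z hz).trans hH
        ext <;> simp [sh, this]
      rw [image_congr this, image_id']
    have hg : ∀ F, gap F s t₁ t₂ K = 0 := by intro F; unfold gap; rw [hid, hid]; ring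
    simp [hg]
  set X := t₁ * t₂ * (t₁ + t₂) * H ^ 2 * area {z ∈ K | s < z.2} with hX
  have hP0 : 0 ≤ area {z ∈ K | s < z.2} := measureReal_nonneg
  have hX0 : 0 ≤ X := by positivity
  have hPK : area {z ∈ K | s < z.2} ≤ area K := area_mono (sep_subset _ _) hK.cpt
  have ha0 := mdis_nonneg s K
  have ha1 := mdis_le hK hH.le hKH
  have haH : mdis s K ≤ H := ha1.trans (by rw [div_le_iff₀ hA]; gcongr)
  have ha2 : area K * mdis s K ^ 2 ≤ H ^ 2 * area {z ∈ K | s < z.2} := by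
    rw [le_div_iff₀ hA] at ha1
    calc area K * mdis s K ^ 2 = mdis s K * (mdis s K * area K) := by ring
      _ ≤ H * (H * area {z ∈ K | s < z.2}) := by gcongr
      _ = _ := by ring
  have hup := sq_gap_upper ht₁ ht₂ hK hN.area_le hN.bdd c0 hKH ha2
  have hA1 := hN.area_ge
  have hA8 := hN.area_le
  have hThX : gap Th s t₁ t₂ K ≤ 16 * 2048 * X := by
    rw [hTh]
    have h1 : (area K ^ 4)⁻¹ ≤ 16 := by
      rw [inv_le_comm₀ (by positivity) (by norm_num)]
      calc (16 : ℝ)⁻¹ = (1 / 2) ^ 4 := by norm_num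
        _ ≤ _ := by gcongr
    calc _ ≤ 16 * (2048 * X) := by
          apply mul_le_mul h1 hup (Wgap_nonneg hsqc ht₁ ht₂ _ _) (by norm_num)
      _ = _ := by ring
  have hC1 : t₁ * H ≤ 2000 := by
    have := shear_bound hK hN hs hw hwH hH.le hv₁
    rw [neg_mul, abs_neg] at this
    exact (le_abs_self _).trans this
  have hC2 : t₂ * H ≤ 2000 := (le_abs_self _).trans (shear_bound hK hN hs hw hwH hH.le hv₂)
  have hsep : 1 / 96 / 4 ≤ s + H / 2 - (cen K).2 := by
    have h1 : ((cen K).1, (cen K).2 + 1 / 96) ∈ K :=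
      hN.box _ (by simp) (by norm_num [abs_of_pos])
    have := hKH _ h1
    simp only at this
    linarith
  obtain ⟨g0, g1, g2⟩ := hmp p hp
  have hp0 : (0:ℝ) ≤ p := by linarith
  have k1 : k ^ p ≤ k := by
    calc k ^ p ≤ k ^ (1 : ℝ) :=
          Real.rpow_le_rpow_of_exponent_ge (by positivity) (by rw [hk]; norm_num) hp
      _ = k := Real.rpow_one k
  have k0 : 0 ≤ k ^ p := Real.rpow_nonneg (by positivity) p
  have e0 : (0:ℝ) ≤ (1 / 2 : ℝ) ^ p := Real.rpow_nonneg (by norm_num) p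
  have a0 : ∀ q : ℝ, 0 ≤ area K ^ q := fun q => Real.rpow_nonneg hA.le q
  have b0 : (0:ℝ) ≤ (1 / 8 ^ 4 : ℝ) ^ p := Real.rpow_nonneg (by norm_num) p
  have aw : ∀ j : ℝ, 0 ≤ j → j ≤ 3 → (1 / 8 ^ 4 : ℝ) ^ p ≤ area K ^ (-j - p) := by
    intro j hj0 hj
    have h1 : (8 : ℝ) ^ (-j - p) ≤ area K ^ (-j - p) :=
      Real.rpow_le_rpow_of_nonpos hA hA8 (by linarith)
    refine le_trans ?_ h1
    have : (1 / 8 ^ 4 : ℝ) ^ p = 8 ^ (-(4 * p)) := by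
      rw [one_div, Real.inv_rpow (by norm_num), Real.rpow_neg (by norm_num),
        Real.rpow_mul (by norm_num)]
      norm_num
    rw [this]
    exact Real.rpow_le_rpow_of_exponent_le (by norm_num) (by linarith)
  have hsplit : (m * (1 / 2 * ((1 / 8 ^ 4) * k))) ^ p =
      m ^ p * ((1 / 2) ^ p * ((1 / 8 ^ 4) ^ p * k ^ p)) := by
    rw [Real.mul_rpow hm0.le (by positivity), Real.mul_rpow (by norm_num) (by positivity),
      Real.mul_rpow (by norm_num) (by positivity)]
  rw [hsplit]
  constructor
  · have hlow := outer_gap (p := p) (r := 1 / 96) (C := 2000) (a := mdis s K) (o := cen K) hp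
      (by norm_num) (by norm_num) (by norm_num) ht₁ ht₂ hH hC1 hC2 ha0 haH hK hN.bdd c0
      (fun z hz => hN.box z (by rw [abs_le]; constructor <;> linarith [hz.1.1, hz.1.2])
        (by rw [abs_le]; constructor <;> linarith [hz.2.1, hz.2.2]))
      hs hKH hw hwH hsep
    rw [hEs]
    have hk' : k * (16 * 2048) ≤ 1 / 4 := by rw [hk]; norm_num
    calc m ^ p * ((1 / 2) ^ p * ((1 / 8 ^ 4) ^ p * k ^ p)) * gap Th s t₁ t₂ K
        ≤ m ^ p * ((1 / 2) ^ p * (area K ^ (-2 - p) * k)) * (16 * 2048 * X) := by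
          have := aw 2 (by norm_num) (by norm_num)
          gcongr
      _ = area K ^ (-2 - p) * (1 / 2) ^ p * (m ^ p * (k * (16 * 2048)) * X) := by ring
      _ ≤ area K ^ (-2 - p) * (1 / 2) ^ p * (gapConst (1 / 96) 2000 p * (1 / 4) * X) := by
          have := a0 (-2 - p)
          have := g0.trans g1
          gcongr
      _ ≤ _ := by
          have := a0 (-2 - p)
          refine mul_le_mul_of_nonneg_left ?_ (by positivity)
          refine le_trans (le_of_eq ?_) hlow
          ring
  -- For `E3` only the static vertices `o` in a small box below the centroid are used.
  · set Q : Set (ℝ × ℝ) := Icc ((cen K).1 - 1 / 192) ((cen K).1 + 1 / 192) ×ˢ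
      Icc ((cen K).2 - 1 / 192) (cen K).2 with hQ
    have hQK : Q ⊆ K := fun z hz => hN.box z
      (by rw [abs_le]; constructor <;> linarith [hz.1.1, hz.1.2])
      (by rw [abs_le]; constructor <;> linarith [hz.2.1, hz.2.2])
    have hQc : IsCompact Q := isCompact_Icc.prod isCompact_Icc
    have hc : Continuous fun o : ℝ × ℝ =>
        Wgap (fun s => |s| ^ p) s t₁ t₂ (max (o.2 - s) 0) K o := by
      unfold Wgap
      refine cont_inner hK.cpt ?_
      simp only [Function.uncurry_def]
      refine cont_inner hK.cpt ?_
      have := abs_rpow_cont hp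
      simp only [Function.uncurry_def, defect, cr, vel]
      fun_prop
    have h1 : ∀ o ∈ Q, gapConst (1 / 192) 2000 p / 4 * X ≤
        Wgap (fun s => |s| ^ p) s t₁ t₂ (max (o.2 - s) 0) K o := by
      intro o ho
      have ho2 : o.2 ≤ s := ho.2.2.trans hs
      rw [max_eq_right (by linarith)]
      refine outer_gap (p := p) (r := 1 / 192) (C := 2000) (a := 0) (o := o) hp
        (by norm_num) (by norm_num) (by norm_num) ht₁ ht₂ hH hC1 hC2 le_rfl hH.le hK hN.bdd
        (hQK ho) (fun z hz => hN.box z ?_ ?_) ho2 hKH hw hwH ?_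
      · rw [abs_le]; constructor <;> linarith [hz.1.1, hz.1.2, ho.1.1, ho.1.2]
      · rw [abs_le]; constructor <;> linarith [hz.2.1, hz.2.2, ho.2.1, ho.2.2]
      · linarith [ho.2.2]
    have h2 := setIntegral_mono_on (μ := volume) (s := Q)
      (integrableOn_const hQc.measure_lt_top.ne) (intOn_of_cont hQc hc) hQc.measurableSet h1
    have h3 : ∫ o in Q, Wgap (fun s => |s| ^ p) s t₁ t₂ (max (o.2 - s) 0) K o ≤
        ∫ o in K, Wgap (fun s => |s| ^ p) s t₁ t₂ (max (o.2 - s) 0) K o :=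
      setIntegral_mono_set (hK.intOn hc) (ae_of_all _ fun o =>
        Wgap_nonneg (abs_rpow_convex hp) ht₁ ht₂ _ _) (LE.le.eventuallyLE hQK)
    rw [setIntegral_const, smul_eq_mul] at h2
    have hQa : (1 : ℝ) / 20000 ≤ volume.real Q := by
      rw [hQ, Measure.volume_eq_prod, measureReal_prod_prod,
        Real.volume_real_Icc_of_le (by linarith), Real.volume_real_Icc_of_le (by linarith)]
      norm_num
    have hlow : 1 / 20000 * (gapConst (1 / 192) 2000 p / 4 * X) ≤ _ :=
      (mul_le_mul_of_nonneg_right hQa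
        (mul_nonneg (div_nonneg (g0.trans g2) (by norm_num)) hX0)).trans (h2.trans h3)
    rw [hE3]
    have hk' : k * (16 * 2048) = 1 / 4 * (1 / 20000) := by rw [hk]; norm_num
    calc m ^ p * ((1 / 2) ^ p * ((1 / 8 ^ 4) ^ p * k ^ p)) * gap Th s t₁ t₂ K
        ≤ m ^ p * ((1 / 2) ^ p * (area K ^ (-3 - p) * k)) * (16 * 2048 * X) := by
          have := aw 3 (by norm_num) (by norm_num)
          gcongr
      _ = area K ^ (-3 - p) * (1 / 2) ^ p * (m ^ p * (k * (16 * 2048)) * X) := by ring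
      _ ≤ area K ^ (-3 - p) * (1 / 2) ^ p *
            (gapConst (1 / 192) 2000 p * (k * (16 * 2048)) * X) := by
          have := a0 (-3 - p)
          gcongr
      _ ≤ _ := by
          have := a0 (-3 - p)
          refine mul_le_mul_of_nonneg_left ?_ (by positivity)
          refine le_trans (le_of_eq ?_) hlow
          rw [hk']; ring

/-- Reduction of shear convexity to bodies in normalised position whose centroid does not move. -/
lemma shearConvex_of_normed {F : Set (ℝ × ℝ) → ℝ} (hF : AffInv F)
    (h : ∀ K s t₁ t₂, Body K → Normed K → (cen K).2 ≤ s → 0 < t₁ → 0 < t₂ →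
      Convex ℝ (sh s (-t₁) '' K) → Convex ℝ (sh s t₂ '' K) → 0 ≤ gap F s t₁ t₂ K) :
    ShearConvex F := by
  have main : ∀ K s t₁ t₂, Body K → (cen K).2 ≤ s → 0 < t₁ → 0 < t₂ →
      Convex ℝ (sh s (-t₁) '' K) → Convex ℝ (sh s t₂ '' K) → 0 ≤ gap F s t₁ t₂ K := by
    intro K s t₁ t₂ hK hs ht₁ ht₂ hv₁ hv₂
    obtain ⟨α, κ, μ, o, hα, hμ, hN⟩ := exists_normed hK
    have hd : det2 (α, (0 : ℝ)) (κ, μ) ≠ 0 := by simp [det2]; exact ⟨hα.ne', hμ.ne'⟩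
    set L := aff o (α, 0) (κ, μ) with hL
    have hcomm : ∀ t, L '' (sh s t '' K) = sh (μ * s + o.2) (α / μ * t) '' (L '' K) := by
      intro t
      rw [← image_comp, ← image_comp]
      refine image_congr fun z _ => ?_
      have : max (z.2 * μ + o.2 - (μ * s + o.2)) 0 = μ * max (z.2 - s) 0 := by
        rw [mul_max_of_nonneg _ _ hμ.le]; congr 1 <;> ring
      ext
      · simp only [Function.comp, hL, sh, aff_fst, aff_snd, mul_zero, zero_add, this]
        field_simp; ring
      · simp [Function.comp, hL, sh]
    have hcv : ∀ t, Convex ℝ (sh s t '' K) →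
        Convex ℝ (sh (μ * s + o.2) (α / μ * t) '' (L '' K)) := fun t hv => by
      rw [← hcomm]; exact hv.affine_image L
    have hv1' := hcv _ hv₁
    have hv2' := hcv _ hv₂
    have hpos : 0 < α / μ := by positivity
    have g := h (L '' K) (μ * s + o.2) (α / μ * t₁) (α / μ * t₂) (hK.aff hd) hN
      (by rw [hL, cen_aff hK hd, aff_snd]; nlinarith) (by positivity) (by positivity)
      (by convert hv1' using 2; ring_nf) hv2'
    have e : gap F (μ * s + o.2) (α / μ * t₁) (α / μ * t₂) (L '' K) =
        α / μ * gap F s t₁ t₂ K := by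
      unfold gap
      rw [show -(α / μ * t₁) = α / μ * (-t₁) by ring, ← hcomm, ← hcomm, hL,
        hF _ (hK.sh hv₁) _ _ _ hd, hF _ (hK.sh hv₂) _ _ _ hd, hF _ hK _ _ _ hd]
      ring
    rw [e] at g
    exact nonneg_of_mul_nonneg_right g hpos
  intro K s t₁ t₂ hK ht₁ ht₂ hv₁ hv₂
  rcases le_total (cen K).2 s with hs | hs
  · exact main K s t₁ t₂ hK hs ht₁ ht₂ hv₁ hv₂
  -- If the centroid lies above the kink, compose with a linear shear that makes the upper part static,
  -- and reflect.
  have hdR : det2 ((1 : ℝ), (0 : ℝ)) (0, -1) ≠ 0 := by simp [det2]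
  have hdS : ∀ t : ℝ, det2 ((1 : ℝ), (0 : ℝ)) (-t, 1) ≠ 0 := by intro t; simp [det2]
  set R := aff (0, 0) (1, 0) (0, -1) with hR
  have hcomm : ∀ t, R '' (sh s t '' K) =
      aff (-(t * s), 0) (1, 0) (-t, 1) '' (sh (-s) t '' (R '' K)) := by
    intro t
    rw [← image_comp, ← image_comp, ← image_comp]
    refine image_congr fun z _ => ?_
    have : max (z.2 - s) 0 = max (-z.2 + s) 0 + (z.2 - s) := by
      rcases le_total z.2 s with h | h
      · rw [max_eq_right (by linarith), max_eq_left (by linarith)]; ring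
      · rw [max_eq_left (by linarith), max_eq_right (by linarith)]; ring
    ext
    · simp [Function.comp, hR, sh, this]; ring
    · simp [Function.comp, hR, sh]
  have hcv : ∀ t, Convex ℝ (sh s t '' K) → Convex ℝ (sh (-s) t '' (R '' K)) := fun t hv => by
    have h1 := hv.affine_image R
    rw [hcomm] at h1
    have h2 := h1.affine_preimage (aff (-(t * s), 0) (1, 0) (-t, 1))
    rwa [preimage_image_eq _ (aff_inj _ _ _ (hdS t))] at h2
  have hFe : ∀ t, Convex ℝ (sh s t '' K) → F (sh (-s) t '' (R '' K)) = F (sh s t '' K) := by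
    intro t hv
    rw [← hF _ (hK.sh hv) _ _ _ hdR, ← hR, hcomm,
      hF _ ((hK.aff hdR).sh (hcv t hv)) _ _ _ (hdS t)]
  have g := main (R '' K) (-s) t₁ t₂ (hK.aff hdR)
    (by rw [hR, cen_aff hK hdR, aff_snd]; simp; exact hs) ht₁ ht₂ (hcv _ hv₁) (hcv _ hv₂)
  unfold gap at g ⊢
  rwa [hFe _ hv₁, hFe _ hv₂, hF _ hK _ _ _ hdR] at g

/-- Both moment functionals dominate a definite multiple of the quadratic functional in shear
convexity. -/
theorem shearConvex_moments : ShearConvex Th ∧ ∃ c : ℝ, 0 < c ∧ c ≤ 1 ∧ ∀ p : ℝ, 1 ≤ p →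
    ShearConvex (fun K => Es p K - c ^ p * Th K) ∧
    ShearConvex (fun K => E3 p K - c ^ p * Th K) := by
  obtain ⟨c, hc0, hc1, h⟩ := gap_normed
  have hsub : ∀ (E : Set (ℝ × ℝ) → ℝ) (k s t₁ t₂ : ℝ) (K : Set (ℝ × ℝ)),
      gap (fun K => E K - k * Th K) s t₁ t₂ K = gap E s t₁ t₂ K - k * gap Th s t₁ t₂ K := by
    intros; unfold gap; ring
  refine ⟨shearConvex_of_normed (fun K hK o u v hd => Th_aff hK hd) fun K s t₁ t₂ hK hN hs h1 h2
    hv1 hv2 => (h 1 le_rfl K s t₁ t₂ hK hN hs h1 h2 hv1 hv2).2.2, c, hc0, hc1, fun p hp => ⟨?_, ?_⟩⟩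
  · refine shearConvex_of_normed (fun K hK o u v hd => ?_) fun K s t₁ t₂ hK hN hs h1 h2
      hv1 hv2 => ?_
    · simp only [Es_aff p hK hd, Th_aff hK hd]
    · rw [hsub]; linarith [(h p hp K s t₁ t₂ hK hN hs h1 h2 hv1 hv2).1]
  · refine shearConvex_of_normed (fun K hK o u v hd => ?_) fun K s t₁ t₂ hK hN hs h1 h2
      hv1 hv2 => ?_
    · simp only [E3_aff p hK hd, Th_aff hK hd]
    · rw [hsub]; linarith [(h p hp K s t₁ t₂ hK hN hs h1 h2 hv1 hv2).2.1]

/-! ### Moving a vertex of a polygon -/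

/-- The polygon with vertices `(t, 1)`, `(0, 0)`, `(1, 0)` and the points of `F`. -/
def poly (F : Set (ℝ × ℝ)) (t : ℝ) : Set (ℝ × ℝ) :=
  convexHull ℝ (insert (t, 1) (insert (0, 0) (insert (1, 0) F)))

lemma convex_cone (t : ℝ) : Convex ℝ {z : ℝ × ℝ | 0 ≤ z.1 - t * z.2 ∧ z.1 - t * z.2 ≤ 1 - z.2} := by
  rintro x ⟨hx1, hx2⟩ y ⟨hy1, hy2⟩ a b ha hb hab
  simp only [mem_ofPred_eq, Prod.fst_add, Prod.smul_fst, Prod.snd_add, Prod.smul_snd, smul_eq_mul]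
  have e : a * x.1 + b * y.1 - t * (a * x.2 + b * y.2) =
    a * (x.1 - t * x.2) + b * (y.1 - t * y.2) := by ring
  rw [e]
  constructor
  · positivity
  · nlinarith [mul_le_mul_of_nonneg_left hx2 ha, mul_le_mul_of_nonneg_left hy2 hb]

lemma lower_subset {F : Set (ℝ × ℝ)} (hF : ∀ f ∈ F, f.2 < 0) :
    convexHull ℝ (insert (0, 0) (insert (1, 0) F)) ⊆ {z : ℝ × ℝ | z.2 ≤ 0} := by
  refine convexHull_min ?_ ?_
  · rintro z (rfl | rfl | hz)
    · simp
    · simp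
    · exact (hF z hz).le
  · exact convex_halfSpace_le (LinearMap.snd ℝ ℝ ℝ).isLinear 0

/-- As long as the segments from `(t, 1)` to the points of `F` cross the unit segment, the polygon
is the union of its fixed lower part and a triangle. -/
lemma poly_eq {F : Set (ℝ × ℝ)} {t : ℝ} (hF : ∀ f ∈ F, f.2 < 0)
    (ht : ∀ f ∈ F, 0 ≤ f.1 - t * f.2 ∧ f.1 - t * f.2 ≤ 1 - f.2) :
    poly F t = convexHull ℝ (insert (0, 0) (insert (1, 0) F)) ∪
      {z | 0 ≤ z.2 ∧ 0 ≤ z.1 - t * z.2 ∧ z.1 - t * z.2 ≤ 1 - z.2} := by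
  set X : Set (ℝ × ℝ) := insert (0, 0) (insert (1, 0) F) with hX
  have hXC : convexHull ℝ X ⊆ poly F t := convexHull_mono (subset_insert _ _)
  have hvt : ((t, 1) : ℝ × ℝ) ∈ poly F t := subset_convexHull _ _ (mem_insert _ _)
  have h00 : ((0, 0) : ℝ × ℝ) ∈ convexHull ℝ X := subset_convexHull _ _ (by simp [hX])
  have h10 : ((1, 0) : ℝ × ℝ) ∈ convexHull ℝ X := subset_convexHull _ _ (by simp [hX])
  have hcone : poly F t ⊆ {z : ℝ × ℝ | 0 ≤ z.1 - t * z.2 ∧ z.1 - t * z.2 ≤ 1 - z.2} := by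
    refine convexHull_min ?_ (convex_cone t)
    rintro z (rfl | rfl | rfl | hz)
    · simp
    · simp
    · simp
    · exact ht z hz
  have hlow : convexHull ℝ X ⊆ {z : ℝ × ℝ | z.2 ≤ 0} := lower_subset hF
  apply Subset.antisymm
  · intro z hz
    rcases le_or_gt 0 z.2 with h | h
    · exact Or.inr ⟨h, hcone hz⟩
    left
    rw [poly, convexHull_insert (insert_nonempty _ _)] at hz
    simp only [convexJoin_singleton_left, mem_iUnion] at hz
    obtain ⟨c, hc, a, k, ha, hk, hak, rfl⟩ := hz
    have hc2 : c.2 ≤ 0 := hlow hc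
    obtain rfl : a = 1 - k := by linarith
    simp only [Prod.snd_add, Prod.smul_snd, smul_eq_mul, mul_one] at h
    have hc2' : c.2 < 0 := by
      rcases hc2.lt_or_eq with h' | h'
      · exact h'
      · rw [h'] at h; linarith
    have hq := hcone ((convex_convexHull ℝ _) hvt (hXC hc) (a := -c.2 / (1 - c.2))
      (b := 1 / (1 - c.2)) (div_nonneg (by linarith) (by linarith))
      (div_nonneg (by linarith) (by linarith)) (by
        have : 1 - c.2 ≠ 0 := by linarith
        field_simp; ring))
    -- `q` is the point where the segment from `(t, 1)` to `c` crosses the first axis.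
    set q : ℝ × ℝ := (-c.2 / (1 - c.2)) • (t, 1) + (1 / (1 - c.2)) • c with hqd
    have hd : 0 < 1 - c.2 := by linarith
    have q2 : q.2 = 0 := by simp [hqd]; field_simp; ring
    have q1 : q.1 = (-c.2 * t + c.1) / (1 - c.2) := by simp [hqd]; field_simp
    obtain ⟨w1, w2⟩ := hq
    rw [q2] at w1 w2
    have hqC : q ∈ convexHull ℝ X := by
      have := (convex_convexHull ℝ X) h00 h10 (a := 1 - q.1) (b := q.1) (by linarith)
        (by linarith) (by ring)
      convert this using 1
      ext <;> simp [q2]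
    have := (convex_convexHull ℝ X) hqC hc (a := 1 - (1 - k + k * c.2) / c.2)
      (b := (1 - k + k * c.2) / c.2) ?_ (div_nonneg_of_nonpos h.le hc2) (by ring)
    · convert this using 1
      have hc0 := hc2'.ne
      ext
      · simp only [Prod.fst_add, Prod.smul_fst, smul_eq_mul, q1]; field_simp; ring
      · simp only [Prod.snd_add, Prod.smul_snd, smul_eq_mul, q2]; field_simp; ring
    · rw [sub_nonneg, div_le_one_of_neg hc2']; nlinarith
  · rintro z (hz | ⟨h1, h2, h3⟩)
    · exact hXC hz
    · refine comb3 (convex_convexHull ℝ _) (hXC h00) (hXC h10) hvt (x := z.1 - t * z.2) (y := z.2)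
        h2 h1 (by linarith) ?_ ?_
      · simp; ring
      · simp

/-- The polygons `poly F t` are the images of `poly F 0` under the shears with kink on the first
axis. -/
lemma sh_poly {F : Set (ℝ × ℝ)} {t : ℝ} (hF : ∀ f ∈ F, f.2 < 0)
    (h0 : ∀ f ∈ F, 0 ≤ f.1 ∧ f.1 + f.2 ≤ 1)
    (ht : ∀ f ∈ F, 0 ≤ f.1 - t * f.2 ∧ f.1 - t * f.2 ≤ 1 - f.2) :
    sh 0 t '' poly F 0 = poly F t := by
  have hlow := lower_subset hF
  rw [poly_eq hF ht, poly_eq hF (fun f hf => ⟨by simpa using (h0 f hf).1, by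
    have := (h0 f hf).2; simp only [zero_mul, sub_zero]; linarith⟩), image_union]
  congr 1
  · have : ∀ z ∈ convexHull ℝ (insert (0, 0) (insert (1, 0) F)), sh 0 t z = z := fun z hz => by
      have : z.2 ≤ 0 := hlow hz
      ext <;> simp [sh, this]
    rw [image_congr this, image_id']
  · ext z
    constructor
    · rintro ⟨w, ⟨h1, h2, h3⟩, rfl⟩
      simp only [zero_mul, sub_zero] at h2 h3
      simp only [sh, sub_zero, max_eq_left h1, mem_ofPred_eq]
      refine ⟨h1, ?_, ?_⟩ <;> linarith
    · rintro ⟨h1, h2, h3⟩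
      refine ⟨(z.1 - t * z.2, z.2), ⟨h1, by simpa using h2, by simpa using h3⟩, ?_⟩
      ext <;> simp [sh, h1]

/-- Moving the vertex `(0, 1)` parallel to the line through its neighbours: the motion can be
continued in both directions until one of the neighbours becomes redundant. -/
lemma frame_move (F : Finset (ℝ × ℝ)) (hne : F.Nonempty)
    (hF : ∀ f ∈ F, f.2 < 0 ∧ 0 < f.1 ∧ f.1 + f.2 < 1) :
    ∃ t₁ t₂ : ℝ, 0 < t₁ ∧ 0 < t₂ ∧
      (∀ t, -t₁ ≤ t → t ≤ t₂ → sh 0 t '' poly F 0 = poly F t) ∧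
      poly F (-t₁) = convexHull ℝ (insert (-t₁, 1) (insert (1, 0) F)) ∧
      poly F t₂ = convexHull ℝ (insert (t₂, 1) (insert (0, 0) F)) := by
  -- The motion stops when the line from the moving vertex through a neighbour first meets another
  -- vertex: `f` for the neighbour `(0, 0)`, `g` for the neighbour `(1, 0)`.
  obtain ⟨f, hf, hfm⟩ := F.exists_min_image (fun f => f.1 / (-f.2)) hne
  obtain ⟨g, hg, hgm⟩ := F.exists_min_image (fun f => (1 - f.2 - f.1) / (-f.2)) hne
  obtain ⟨f1, f2, f3⟩ := hF f hf
  obtain ⟨g1, g2, g3⟩ := hF g hg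
  have cond : ∀ t, -(f.1 / (-f.2)) ≤ t → t ≤ (1 - g.2 - g.1) / (-g.2) → ∀ x ∈ F,
      0 ≤ x.1 - t * x.2 ∧ x.1 - t * x.2 ≤ 1 - x.2 := by
    intro t h1 h2 x hx
    obtain ⟨x1, x2, x3⟩ := hF x hx
    have q1 := hfm x hx
    have q2 := hgm x hx
    have r1 : -t ≤ x.1 / (-x.2) := by linarith
    have r2 := h2.trans q2
    rw [le_div_iff₀ (by linarith)] at r1 r2
    constructor <;> linarith
  have hp1 : 0 < f.1 / (-f.2) := div_pos f2 (by linarith)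
  have hp2 : 0 < (1 - g.2 - g.1) / (-g.2) := div_pos (by linarith) (by linarith)
  refine ⟨_, _, hp1, hp2, fun t h1 h2 => sh_poly (fun f hf => (hF f hf).1)
    (fun f hf => ⟨(hF f hf).2.1.le, (hF f hf).2.2.le⟩) (cond t h1 h2), ?_, ?_⟩
  · apply Subset.antisymm
    · refine convexHull_min ?_ (convex_convexHull ℝ _)
      rintro z (rfl | rfl | rfl | hz)
      · exact subset_convexHull _ _ (by simp)
      · have m1 : ((-(f.1 / -f.2), 1) : ℝ × ℝ) ∈
          convexHull ℝ (insert (-(f.1 / -f.2), 1) (insert (1, 0) (F : Set (ℝ × ℝ)))) :=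
            subset_convexHull _ _ (by simp)
        have m2 : f ∈ convexHull ℝ (insert (-(f.1 / -f.2), 1) (insert (1, 0) (F : Set (ℝ × ℝ)))) :=
            subset_convexHull _ _ (by simp [hf])
        have := (convex_convexHull ℝ _) m1 m2 (a := -f.2 / (1 - f.2)) (b := 1 / (1 - f.2))
          (div_nonneg (by linarith) (by linarith)) (div_nonneg (by linarith) (by linarith))
          (by have : 1 - f.2 ≠ 0 := by linarith
              field_simp; ring)
        convert this using 1
        have h1 : 1 - f.2 ≠ 0 := by linarith
        have h2 := f1.ne
        ext
        · simp; field_simp; ring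
        · simp; field_simp; ring
      · exact subset_convexHull _ _ (by simp)
      · exact subset_convexHull _ _ (by simp [Finset.mem_coe.1 hz])
    · refine convexHull_mono ?_
      rintro z (rfl | rfl | hz) <;> simp
      exact Or.inr (Or.inr (Or.inr hz))
  · apply Subset.antisymm
    · refine convexHull_min ?_ (convex_convexHull ℝ _)
      rintro z (rfl | rfl | rfl | hz)
      · exact subset_convexHull _ _ (by simp)
      · exact subset_convexHull _ _ (by simp)
      · have m1 : (((1 - g.2 - g.1) / (-g.2), 1) : ℝ × ℝ) ∈
          convexHull ℝ (insert ((1 - g.2 - g.1) / (-g.2), 1) (insert (0, 0) (F : Set (ℝ × ℝ)))) :=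
            subset_convexHull _ _ (by simp)
        have m2 : g ∈
          convexHull ℝ (insert ((1 - g.2 - g.1) / (-g.2), 1) (insert (0, 0) (F : Set (ℝ × ℝ)))) :=
            subset_convexHull _ _ (by simp [hg])
        have := (convex_convexHull ℝ _) m1 m2 (a := -g.2 / (1 - g.2)) (b := 1 / (1 - g.2))
          (div_nonneg (by linarith) (by linarith)) (div_nonneg (by linarith) (by linarith))
          (by have : 1 - g.2 ≠ 0 := by linarith
              field_simp; ring)
        convert this using 1
        have h1 : 1 - g.2 ≠ 0 := by linarith
        have h2 := g1.ne
        ext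
        · simp; field_simp; ring
        · simp; field_simp; ring
      · exact subset_convexHull _ _ (by simp [Finset.mem_coe.1 hz])
    · refine convexHull_mono ?_
      rintro z (rfl | rfl | hz) <;> simp
      exact Or.inr (Or.inr (Or.inr hz))

/-- Seen from an extreme point `v`, the remaining points of a set in convex position have a first
and a last one in angular order, and no two of them are aligned with `v`. -/
lemma exists_neighbours {S : Finset (ℝ × ℝ)} {v : ℝ × ℝ} (hv : v ∈ S)
    (hS : ∀ s ∈ S, s ∉ convexHull ℝ ((S.erase s : Finset (ℝ × ℝ)) : Set (ℝ × ℝ)))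
    (hc : 2 ≤ (S.erase v).card) :
    ∃ a ∈ S.erase v, ∃ b ∈ S.erase v, a ≠ b ∧ 0 < cr v a b ∧ (∀ s ∈ S.erase v, s ≠ a → 0 < cr v a s) ∧
      ∀ s ∈ S.erase v, s ≠ b → 0 < cr v s b := by
  have hfin : (S.erase v : Set (ℝ × ℝ)).Finite := Finset.finite_toSet _
  obtain ⟨f, w, hf1, hf2⟩ := geometric_hahn_banach_closed_point
    (convex_convexHull ℝ ((S.erase v : Finset (ℝ × ℝ)) : Set (ℝ × ℝ)))
    (Set.Finite.isCompact_convexHull (𝕜 := ℝ) hfin).isClosed (hS v hv)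
  set l₁ := f (1, 0) with hl1
  set l₂ := f (0, 1) with hl2
  have hf : ∀ z : ℝ × ℝ, f z = l₁ * z.1 + l₂ * z.2 := clm_apply_prod f
  -- Coordinates of `v - z` along the separating direction and orthogonal to it. As `ℓ` is positive, the
  -- angular order is the order of `μ / ℓ`.
  set ℓ : ℝ × ℝ → ℝ := fun z => l₁ * (v.1 - z.1) + l₂ * (v.2 - z.2) with hℓ
  set μ : ℝ × ℝ → ℝ := fun z => -l₂ * (v.1 - z.1) + l₁ * (v.2 - z.2) with hμ
  have hpos : ∀ s ∈ S.erase v, 0 < ℓ s := by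
    intro s hs
    have := (hf1 s (subset_convexHull _ _ (Finset.mem_coe.2 hs))).trans hf2
    rw [hf, hf] at this
    simp only [hℓ]; linarith
  have hne : (S.erase v).Nonempty := Finset.card_pos.1 (by omega)
  have hN : 0 < l₁ ^ 2 + l₂ ^ 2 := by
    obtain ⟨s, hs⟩ := hne
    by_contra h
    have h1 : l₁ = 0 := by nlinarith [sq_nonneg l₁, sq_nonneg l₂]
    have h2 : l₂ = 0 := by nlinarith [sq_nonneg l₁, sq_nonneg l₂]
    have := hpos s hs
    simp [hℓ, h1, h2] at this
  have hcr : ∀ s s', (l₁ ^ 2 + l₂ ^ 2) * cr v s s' = ℓ s * μ s' - μ s * ℓ s' := by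
    intro s s'; simp only [hℓ, hμ, cr]; ring
  have hlt : ∀ s ∈ S.erase v, ∀ s' ∈ S.erase v, μ s / ℓ s < μ s' / ℓ s' → 0 < cr v s s' := by
    intro s hs s' hs' h
    rw [div_lt_div_iff₀ (hpos s hs) (hpos s' hs')] at h
    have := hcr s s'
    exact (mul_pos_iff_of_pos_left hN).1 (by rw [this]; linarith)
  have hvS : ∀ s ∈ S.erase v, s ∈ S ∧ s ≠ v := fun s hs =>
    ⟨Finset.mem_of_mem_erase hs, Finset.ne_of_mem_erase hs⟩
  -- aligned points would make one of them redundant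
  have half : ∀ s ∈ S.erase v, ∀ s' ∈ S.erase v, s ≠ s' → μ s / ℓ s = μ s' / ℓ s' →
      ℓ s ≤ ℓ s' → False := by
    intro s hs s' hs' hss h hle
    have p1 := hpos s hs
    have p2 := hpos s' hs'
    rw [div_eq_div_iff p1.ne' p2.ne'] at h
    refine hS s (hvS s hs).1 ?_
    have m1 : v ∈ convexHull ℝ ((S.erase s : Finset (ℝ × ℝ)) : Set (ℝ × ℝ)) :=
      subset_convexHull _ _ (by simp [hv, (hvS s hs).2.symm])
    have m2 : s' ∈ convexHull ℝ ((S.erase s : Finset (ℝ × ℝ)) : Set (ℝ × ℝ)) :=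
      subset_convexHull _ _ (by simp [(hvS s' hs').1, hss.symm])
    have := (convex_convexHull ℝ _) m1 m2 (a := 1 - ℓ s / ℓ s') (b := ℓ s / ℓ s')
      (by rw [sub_nonneg, div_le_one p2]; exact hle) (by positivity) (by ring)
    convert this using 1
    -- the displacement is determined by its two components
    have e1 : (l₁ ^ 2 + l₂ ^ 2) * (v.1 - s.1) = l₁ * ℓ s - l₂ * μ s := by
      simp only [hℓ, hμ]; ring
    have e2 : (l₁ ^ 2 + l₂ ^ 2) * (v.2 - s.2) = l₂ * ℓ s + l₁ * μ s := by
      simp only [hℓ, hμ]; ring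
    have e3 : (l₁ ^ 2 + l₂ ^ 2) * (v.1 - s'.1) = l₁ * ℓ s' - l₂ * μ s' := by
      simp only [hℓ, hμ]; ring
    have e4 : (l₁ ^ 2 + l₂ ^ 2) * (v.2 - s'.2) = l₂ * ℓ s' + l₁ * μ s' := by
      simp only [hℓ, hμ]; ring
    have k1 : (v.1 - s.1) * ℓ s' = (v.1 - s'.1) * ℓ s := by
      apply mul_left_cancel₀ hN.ne'
      linear_combination ℓ s' * e1 - ℓ s * e3 - l₂ * h
    have k2 : (v.2 - s.2) * ℓ s' = (v.2 - s'.2) * ℓ s := by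
      apply mul_left_cancel₀ hN.ne'
      linear_combination ℓ s' * e2 - ℓ s * e4 + l₁ * h
    have p2' := p2.ne'
    ext
    · simp only [Prod.fst_add, Prod.smul_fst, smul_eq_mul]
      rw [← mul_left_inj' p2']; field_simp; linear_combination -k1
    · simp only [Prod.snd_add, Prod.smul_snd, smul_eq_mul]
      rw [← mul_left_inj' p2']; field_simp; linear_combination -k2
  have hinj : ∀ s ∈ S.erase v, ∀ s' ∈ S.erase v, s ≠ s' → μ s / ℓ s ≠ μ s' / ℓ s' := by
    intro s hs s' hs' hss h
    rcases le_total (ℓ s) (ℓ s') with hle | hle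
    · exact half s hs s' hs' hss h hle
    · exact half s' hs' s hs hss.symm h.symm hle
  obtain ⟨a, ha, ham⟩ := (S.erase v).exists_min_image (fun s => μ s / ℓ s) hne
  obtain ⟨b, hb, hbm⟩ := (S.erase v).exists_max_image (fun s => μ s / ℓ s) hne
  have h1 : ∀ s ∈ S.erase v, s ≠ a → 0 < cr v a s := fun s hs hsa =>
    hlt a ha s hs (lt_of_le_of_ne (ham s hs) (hinj a ha s hs hsa.symm))
  have h2 : ∀ s ∈ S.erase v, s ≠ b → 0 < cr v s b := fun s hs hsb =>
    hlt s hs b hb (lt_of_le_of_ne (hbm s hs) (hinj s hs b hb hsb))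
  have hab : a ≠ b := by
    rintro rfl
    obtain ⟨s, hs, hsa⟩ := Finset.exists_mem_ne (s := S.erase v) (by omega) a
    exact hinj s hs a ha hsa (le_antisymm (hbm s hs) (ham s hs))
  exact ⟨a, ha, b, hb, hab, h1 b hb hab.symm, h1, h2⟩

/-! ### The maximum principle for polygons -/

lemma card_ge_three {S : Finset (ℝ × ℝ)} (hB : Body (convexHull ℝ (S : Set (ℝ × ℝ)))) :
    3 ≤ S.card := by
  by_contra h
  have : ∃ a b : ℝ × ℝ, (S : Set (ℝ × ℝ)) ⊆ {a, b, b} := by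
    have h3 : S.card < 3 := by omega
    interval_cases hc : S.card
    · rw [Finset.card_eq_zero] at hc
      exact ⟨0, 0, by simp [hc]⟩
    · obtain ⟨a, rfl⟩ := Finset.card_eq_one.1 hc
      exact ⟨a, a, by simp⟩
    · obtain ⟨a, b, -, rfl⟩ := Finset.card_eq_two.1 hc
      exact ⟨a, b, by simp⟩
  obtain ⟨a, b, hab⟩ := this
  have h1 : area (convexHull ℝ (S : Set (ℝ × ℝ))) ≤ area (tri a b b) :=
    area_mono (convexHull_mono hab)
      (Set.Finite.isCompact_convexHull (𝕜 := ℝ) (by simp : ({a, b, b} : Set (ℝ × ℝ)).Finite))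
  have h2 : cr a b b = 0 := by unfold cr; ring
  rw [area_tri, h2] at h1
  have := hB.area_pos
  simp at h1; linarith

/-- A convex polygon is spanned by fewer points, or is a triangle, or can be moved by a piecewise
linear shear in both directions until it is spanned by fewer points. -/
lemma polygon_move {S : Finset (ℝ × ℝ)} (hB : Body (convexHull ℝ (S : Set (ℝ × ℝ)))) :
    (∃ S' : Finset (ℝ × ℝ), S'.card < S.card ∧
      convexHull ℝ (S' : Set (ℝ × ℝ)) = convexHull ℝ (S : Set (ℝ × ℝ))) ∨
    (∃ o u v : ℝ × ℝ, det2 u v ≠ 0 ∧ convexHull ℝ (S : Set (ℝ × ℝ)) = aff o u v '' T0) ∨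
    ∃ (o u v : ℝ × ℝ) (P : Set (ℝ × ℝ)) (t₁ t₂ : ℝ) (S₁ S₂ : Finset (ℝ × ℝ)), det2 u v ≠ 0 ∧
      Body P ∧ (interior (P ∩ {z | z.2 ≤ 0})).Nonempty ∧
      convexHull ℝ (S : Set (ℝ × ℝ)) = aff o u v '' P ∧ 0 < t₁ ∧ 0 < t₂ ∧
      (∀ t, -t₁ ≤ t → t ≤ t₂ → Convex ℝ (sh 0 t '' P)) ∧ S₁.card < S.card ∧ S₂.card < S.card ∧
      sh 0 (-t₁) '' P = convexHull ℝ (S₁ : Set (ℝ × ℝ)) ∧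
      sh 0 t₂ '' P = convexHull ℝ (S₂ : Set (ℝ × ℝ)) := by
  by_cases hS : ∀ s ∈ S, s ∉ convexHull ℝ ((S.erase s : Finset (ℝ × ℝ)) : Set (ℝ × ℝ))
  swap
  · push Not at hS
    obtain ⟨s, hs, hsS⟩ := hS
    refine Or.inl ⟨S.erase s, Finset.card_erase_lt_of_mem hs, ?_⟩
    apply Subset.antisymm (convexHull_mono (by simp))
    refine convexHull_min (fun z hz => ?_) (convex_convexHull ℝ _)
    by_cases hzs : z = s
    · rwa [hzs]
    · exact subset_convexHull _ _ (by simp [hzs, Finset.mem_coe.1 hz])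
  have h3 := card_ge_three hB
  obtain ⟨v, hv⟩ : S.Nonempty := Finset.card_pos.1 (by omega)
  obtain ⟨a, ha, b, hb, hab, hD, h1, h2⟩ := exists_neighbours hv hS
    (by rw [Finset.card_erase_of_mem hv]; omega)
  obtain ⟨hav, haS⟩ := Finset.mem_erase.1 ha
  obtain ⟨hbv, hbS⟩ := Finset.mem_erase.1 hb
  -- Frame with the neighbours of `v` at `(0, 0)` and `(1, 0)` and `v` itself at `(0, 1)`.
  have hdet : det2 (b - a) (v - a) = cr v a b := by rw [det2_eq_cr]; unfold cr; ring
  have hd0 : det2 (b - a) (v - a) ≠ 0 := by rw [hdet]; exact hD.ne'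
  obtain ⟨o', u', v', hd', -, hinv1, hinv2⟩ := aff_inv a (b - a) (v - a) hd0
  set L := aff a (b - a) (v - a) with hL
  have La : L (0, 0) = a := by ext <;> simp [hL]
  have Lb : L (1, 0) = b := by ext <;> simp [hL]
  have Lv : L (0, 1) = v := by ext <;> simp [hL]
  set G := ((S.erase v).erase a).erase b with hG
  have hGcard : G.card + 3 = S.card := by
    rw [hG, Finset.card_erase_of_mem (Finset.mem_erase.2 ⟨hab.symm, hb⟩),
      Finset.card_erase_of_mem ha, Finset.card_erase_of_mem hv]
    omega
  have hGm : ∀ s, s ∈ G ↔ s ≠ b ∧ s ≠ a ∧ s ≠ v ∧ s ∈ S := by intro s; simp [hG]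
  have hSset : (S : Set (ℝ × ℝ)) = insert v (insert a (insert b (G : Set (ℝ × ℝ)))) := by
    ext s
    simp only [mem_insert_iff, Finset.mem_coe, hGm]
    constructor
    · intro hs; tauto
    · rintro (rfl | rfl | rfl | h)
      exacts [hv, haS, hbS, h.2.2.2]
  rcases G.eq_empty_or_nonempty with hGe | hGne
  · refine Or.inr (Or.inl ⟨a, b - a, v - a, hd0, ?_⟩)
    rw [← tri_eq_aff, hSset, hGe, tri]
    congr 1
    ext s; simp; tauto
  set F := G.image (aff o' u' v') with hF
  have hFcard : F.card ≤ G.card := Finset.card_image_le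
  have hLF : L '' (F : Set (ℝ × ℝ)) = G := by
    rw [hF, Finset.coe_image, ← image_comp]
    have : (L ∘ aff o' u' v') = id := funext hinv2
    rw [this, image_id]
  have hFc : ∀ f ∈ F, f.2 < 0 ∧ 0 < f.1 ∧ f.1 + f.2 < 1 := by
    intro f hf
    have hLf : L f ∈ G := by
      have : L f ∈ L '' (F : Set (ℝ × ℝ)) := ⟨f, hf, rfl⟩
      rwa [hLF] at this
    obtain ⟨q1, q2, q3, q4⟩ := (hGm _).1 hLf
    have w1 := h1 _ (Finset.mem_erase.2 ⟨q3, q4⟩) q2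
    have w2 := h2 _ (Finset.mem_erase.2 ⟨q3, q4⟩) q1
    rw [← La, ← Lv, hL, cr_aff, hdet] at w1
    rw [← Lb, ← Lv, hL, cr_aff, hdet] at w2
    have x1 := (mul_pos_iff_of_pos_left hD).1 w1
    have x2 := (mul_pos_iff_of_pos_left hD).1 w2
    simp only [cr] at x1 x2
    have y1 : 0 < f.1 := by linarith
    have y2 : f.1 + f.2 < 1 := by linarith
    refine ⟨?_, y1, y2⟩
    -- A vertex on the side of `v` would lie in the triangle `a b v`.
    by_contra hneg
    refine hS _ q4 ?_
    have : L f ∈ tri a b v := by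
      rw [tri_eq_aff]; exact ⟨f, ⟨y1.le, not_lt.1 hneg, y2.le⟩, rfl⟩
    refine tri_subset (convex_convexHull ℝ _) ?_ ?_ ?_ this <;> apply subset_convexHull
    · simp [haS, q2.symm]
    · simp [hbS, q1.symm]
    · simp [hv, q3.symm]
  obtain ⟨t₁, t₂, ht₁, ht₂, hsh, he1, he2⟩ := frame_move F
    (hGne.image _) hFc
  have hconv : convexHull ℝ (S : Set (ℝ × ℝ)) = L '' poly F 0 := by
    rw [poly, AffineMap.image_convexHull, image_insert_eq, image_insert_eq, image_insert_eq, hLF,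
      La, Lb, Lv, hSset]
  have hP : Body (poly F 0) := by
    have := hB.aff (o := o') hd'
    rwa [hconv, ← image_comp, show (aff o' u' v' ∘ L) = id from funext hinv1, image_id] at this
  refine Or.inr (Or.inr ⟨a, b - a, v - a, poly F 0, t₁, t₂, insert (-t₁, 1) (insert (1, 0) F),
    insert (t₂, 1) (insert (0, 0) F), hd0, hP, ?_, hconv, ht₁, ht₂, ?_, ?_, ?_, ?_, ?_⟩)
  · obtain ⟨f, hf⟩ := hGne.image (aff o' u' v')
    have hf2 := (hFc f hf).1
    have hcr : cr (0, 0) (1, 0) f ≠ 0 := by simp [cr]; exact hf2.ne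
    refine (tri_body hcr).int.mono (interior_mono (subset_inter ?_ ?_))
    · refine convexHull_mono ?_
      rintro z (rfl | rfl | rfl)
      · simp
      · simp
      · simp only [mem_insert_iff]; exact Or.inr (Or.inr (Or.inr hf))
    · refine convexHull_min ?_ (convex_halfSpace_le (LinearMap.snd ℝ ℝ ℝ).isLinear 0)
      rintro z (rfl | rfl | rfl)
      · simp
      · simp
      · exact hf2.le
  · intro t h1 h2
    rw [hsh t h1 h2]; exact convex_convexHull ℝ _
  · have q1 := Finset.card_insert_le (-t₁, 1) (insert (1, 0) F)
    have q2 := Finset.card_insert_le (1, 0) F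
    omega
  · have q1 := Finset.card_insert_le (t₂, 1) (insert (0, 0) F)
    have q2 := Finset.card_insert_le (0, 0) F
    omega
  · rw [hsh _ le_rfl (by linarith), he1]; simp
  · rw [hsh _ (by linarith) le_rfl, he2]; simp

/-- The maximum principle: among polygons, an affinely invariant shear-convex functional is
maximal at triangles. -/
theorem polygon_le_T0 {F : Set (ℝ × ℝ) → ℝ} (hF : AffInv F) (hc : ShearConvex F)
    (S : Finset (ℝ × ℝ)) (hB : Body (convexHull ℝ (S : Set (ℝ × ℝ)))) :
    F (convexHull ℝ (S : Set (ℝ × ℝ))) ≤ F T0 := by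
  induction hn : S.card using Nat.strong_induction_on generalizing S with
  | _ n ih =>
    rcases polygon_move hB with ⟨S', hcard, he⟩ | ⟨o, u, v, hd, he⟩ |
      ⟨o, u, v, P, t₁, t₂, S₁, S₂, hd, hP, -, he, ht₁, ht₂, hv, hc1, hc2, h1, h2⟩
    · rw [← he] at hB ⊢
      exact ih _ (hn ▸ hcard) S' hB rfl
    · rw [he, hF _ T0_body _ _ _ hd]
    · rw [he, hF _ hP _ _ _ hd]
      have hv1 := hv (-t₁) le_rfl (by linarith)
      have hv2 := hv t₂ (by linarith) le_rfl
      have g := hc P 0 t₁ t₂ hP ht₁ ht₂ hv1 hv2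
      have i1 := ih _ (hn ▸ hc1) S₁ (h1 ▸ hP.sh hv1) rfl
      have i2 := ih _ (hn ▸ hc2) S₂ (h2 ▸ hP.sh hv2) rfl
      rw [← h1] at i1
      rw [← h2] at i2
      unfold gap at g
      have hT : 0 < t₁ + t₂ := by linarith
      nlinarith

/-! ### Bodies nearly filling a triangle -/

/-- A subset of the standard triangle containing the midpoints of its three sides. -/
structure Mid (K : Set (ℝ × ℝ)) : Prop where
  sub : K ⊆ T0
  m₁ : ((1 / 2, 0) : ℝ × ℝ) ∈ K
  m₂ : ((0, 1 / 2) : ℝ × ℝ) ∈ K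
  m₃ : ((1 / 2, 1 / 2) : ℝ × ℝ) ∈ K

/-- If a point of a corner is missing from `K` then so are all points between it and the vertex. -/
lemma Mid.box {K : Set (ℝ × ℝ)} (hK : Body K) (hM : Mid K) {z w : ℝ × ℝ} (hz : z ∉ K)
    (hz1 : z.1 ≤ 1 / 2) (hz2 : z.2 ≤ 1 / 2) (hw1 : w.1 ≤ z.1) (hw2 : w.2 ≤ z.2)
    (hw1' : 0 ≤ w.1) (hw2' : 0 ≤ w.2) : w ∉ K := by
  intro hw
  obtain ⟨f, u, hf1, hf2⟩ := geometric_hahn_banach_closed_point hK.cvx hK.cpt.isClosed hz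
  have hlt : ∀ k ∈ K, f (1, 0) * k.1 + f (0, 1) * k.2 < f (1, 0) * z.1 + f (0, 1) * z.2 :=
    fun k hk => by
      rw [← clm_apply_prod, ← clm_apply_prod]; exact (hf1 k hk).trans hf2
  generalize f (1, 0) = a at hlt
  generalize f (0, 1) = b at hlt
  have q1 := hlt _ hM.m₁
  have q2 := hlt _ hM.m₂
  have q3 := hlt _ hM.m₃
  have q4 := hlt _ hw
  simp only at q1 q2 q3
  -- The midpoints exclude every sign of `a` and `b` except both negative; then the value at `w` is
  -- at least the value at `z`.
  rcases le_or_gt 0 a with ha | ha <;> rcases le_or_gt 0 b with hb | hb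
  · nlinarith
  · nlinarith
  · nlinarith
  · nlinarith

lemma area_diff {K : Set (ℝ × ℝ)} (hK : Body K) (hs : K ⊆ T0) :
    area (T0 \ K) = 1 / 2 - area K := by
  have := measureReal_sdiff (μ := volume) hs hK.meas T0_compact.measure_lt_top.ne
  rw [area, this, ← area_T0]; rfl

lemma Mid.area_ge {K : Set (ℝ × ℝ)} (hK : Body K) (hM : Mid K) {z : ℝ × ℝ} (hz : z ∉ K)
    (h1 : 0 ≤ z.1) (h2 : 0 ≤ z.2) (hz1 : z.1 ≤ 1 / 2) (hz2 : z.2 ≤ 1 / 2) :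
    z.1 * z.2 ≤ area (T0 \ K) := by
  have hsub : Icc 0 z.1 ×ˢ Icc 0 z.2 ⊆ T0 \ K := by
    rintro w ⟨⟨a1, a2⟩, b1, b2⟩
    exact ⟨⟨a1, b1, by linarith⟩, hM.box hK hz hz1 hz2 a2 b2 a1 b1⟩
  have h3 : volume.real (Icc 0 z.1 ×ˢ Icc 0 z.2) ≤ area (T0 \ K) :=
    measureReal_mono hsub
      (lt_of_le_of_lt (measure_mono sdiff_subset) T0_compact.measure_lt_top).ne
  rwa [Measure.volume_eq_prod, measureReal_prod_prod, Real.volume_real_Icc_of_le h1,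
    Real.volume_real_Icc_of_le h2, sub_zero, sub_zero] at h3

/-- The sum of the squares of the barycentric coordinates. -/
def bary2 (z : ℝ × ℝ) : ℝ := z.1 ^ 2 + z.2 ^ 2 + (1 - z.1 - z.2) ^ 2

lemma bary2_cont : Continuous bary2 := by unfold bary2; fun_prop

/-- The integral of `r * (2 * r ^ 2 - k)` over a terminal segment `(a, R]` is
`(R ^ 2 - a ^ 2) * (R ^ 2 + a ^ 2 - k) / 2`. -/
lemma terminal_integral_nonneg {I : Set ℝ} {R k : ℝ} (hR : 0 < R) (hI : I ⊆ Ioc 0 R)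
    (hup : ∀ r ∈ I, ∀ r', r ≤ r' → r' < R → r' ∈ I) (hk : k ≤ R ^ 2) :
    0 ≤ ∫ r in I, r * (2 * r ^ 2 - k) := by
  rcases I.eq_empty_or_nonempty with rfl | hne
  · simp
  have hbd : BddBelow I := ⟨0, fun r hr => (hI hr).1.le⟩
  set a := sInf I with ha
  have ha0 : 0 ≤ a := le_csInf hne fun r hr => (hI hr).1.le
  have haR : a ≤ R := by
    obtain ⟨r, hr⟩ := hne
    exact (csInf_le hbd hr).trans (hI hr).2
  have hIe : I =ᵐ[volume] Ioc a R := by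
    have h1 : Ioo a R ⊆ I := by
      rintro r ⟨h1, h2⟩
      obtain ⟨r', hr', hlt⟩ := exists_lt_of_csInf_lt hne h1
      exact hup r' hr' r hlt.le h2
    have h2 : I ⊆ Icc a R := fun r hr => ⟨csInf_le hbd hr, (hI hr).2⟩
    refine Filter.EventuallyLE.antisymm ?_ ?_
    · exact (LE.le.eventuallyLE h2).trans Ioc_ae_eq_Icc.symm.le
    · exact Ioo_ae_eq_Ioc.symm.le.trans (LE.le.eventuallyLE h1)
  rw [setIntegral_congr_set hIe, ← intervalIntegral.integral_of_le haR]
  have hd : ∀ r ∈ uIcc a R, HasDerivAt (fun r : ℝ => r ^ 4 / 2 - k * r ^ 2 / 2)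
      (r * (2 * r ^ 2 - k)) r := by
    intro r _
    refine (((hasDerivAt_pow 4 r).div_const 2).sub
      (((hasDerivAt_pow 2 r).const_mul k).div_const 2)).congr_deriv ?_
    simp; ring
  rw [intervalIntegral.integral_eq_sub_of_hasDerivAt hd
    (Continuous.intervalIntegrable (by fun_prop) _ _)]
  have : R ^ 4 / 2 - k * R ^ 2 / 2 - (a ^ 4 / 2 - k * a ^ 2 / 2) =
      (R ^ 2 - a ^ 2) / 2 * (R ^ 2 + a ^ 2 - k) := by ring
  rw [this]
  refine mul_nonneg ?_ (by nlinarith [sq_nonneg a])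
  nlinarith

/-- Integration along the rays from `(1 / 2, 0)`, of slope `σ`, of a function supported to the left of
that point; the Jacobian of `(r, σ) ↦ (1 / 2 - r, r * σ)` is `|r|`. -/
lemma integral_rays {G : ℝ × ℝ → ℝ} (hG : Measurable G) {M : ℝ} (hM : ∀ z, |G z| ≤ M)
    (hsupp : ∀ z, G z ≠ 0 → 0 < 1 / 2 - z.1 ∧ 1 / 2 - z.1 ≤ 1 ∧ 0 ≤ z.2 ∧ z.2 ≤ 1 / 2 - z.1) :
    ∫ z, G z = ∫ σ, ∫ r, |r| * G (1 / 2 - r, r * σ) := by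
  have hsub : ∀ r : ℝ, ∫ y, G (1 / 2 - r, y) = ∫ σ, |r| * G (1 / 2 - r, r * σ) := by
    intro r
    rw [integral_const_mul]
    rcases eq_or_ne r 0 with rfl | hr
    · have : ∀ y, G (1 / 2 - 0, y) = 0 := by
        intro y
        by_contra h
        have := (hsupp _ h).1
        simp at this
      simp only [this]; simp
    · rw [Measure.integral_comp_mul_left (fun y => G (1 / 2 - r, y)) r, smul_eq_mul, abs_inv,
        ← mul_assoc, mul_inv_cancel₀ (abs_pos.2 hr).ne', one_mul]
  have hMnn : 0 ≤ M := (abs_nonneg _).trans (hM 0)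
  have hint0 : Integrable G := by
    have hb : IntegrableOn G (Icc (-1) 1 ×ˢ Icc (-1) 1) :=
      Measure.integrableOn_of_bounded (isCompact_Icc.prod isCompact_Icc).measure_lt_top.ne
        hG.aestronglyMeasurable (M := M) (ae_of_all _ fun z => by simpa using hM z)
    refine hb.integrable_of_forall_notMem_eq_zero fun z hz => ?_
    by_contra h
    obtain ⟨h1, h2, h3, h4⟩ := hsupp z h
    exact hz ⟨⟨by linarith, by linarith⟩, ⟨by linarith, by linarith⟩⟩
  have hint : Integrable (Function.uncurry fun r σ : ℝ => |r| * G (1 / 2 - r, r * σ))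
      (volume.prod volume) := by
    have hm : Measurable (Function.uncurry fun r σ : ℝ => |r| * G (1 / 2 - r, r * σ)) := by
      simp only [Function.uncurry_def]
      exact (measurable_fst.abs).mul (hG.comp (by fun_prop))
    rw [← Measure.volume_eq_prod]
    have hb : IntegrableOn (Function.uncurry fun r σ : ℝ => |r| * G (1 / 2 - r, r * σ))
        (Icc (-1) 1 ×ˢ Icc (-1) 1) := by
      refine Measure.integrableOn_of_bounded
        (isCompact_Icc.prod isCompact_Icc).measure_lt_top.ne hm.aestronglyMeasurable (M := M) ?_
      refine (ae_restrict_iff' (measurableSet_Icc.prod measurableSet_Icc)).2 (ae_of_all _ ?_)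
      rintro ⟨r, σ⟩ ⟨hr, -⟩
      have h1 : |r| ≤ 1 := abs_le.2 hr
      simp only [Function.uncurry, norm_mul, Real.norm_eq_abs, abs_abs]
      calc |r| * |G (1 / 2 - r, r * σ)| ≤ 1 * M := by gcongr; exact hM _
        _ = M := one_mul M
    refine hb.integrable_of_forall_notMem_eq_zero ?_
    rintro ⟨r, σ⟩ hz
    by_contra h
    have hne : G (1 / 2 - r, r * σ) ≠ 0 := by
      intro h0; apply h
      change |r| * G (1 / 2 - r, r * σ) = 0
      rw [h0, mul_zero]
    obtain ⟨h1, h2, h3, h4⟩ := hsupp _ hne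
    simp only [sub_sub_cancel] at h1 h2 h4 h3
    have hσ0 : 0 ≤ σ := by
      by_contra hneg
      nlinarith [mul_pos h1 (neg_pos.2 (not_le.1 hneg))]
    have hσ1 : σ ≤ 1 := by
      by_contra hneg
      nlinarith [mul_pos h1 (sub_pos.2 (not_le.1 hneg))]
    exact hz ⟨⟨by simp only; linarith, by simp only; linarith⟩, ⟨by simp only; linarith, hσ1⟩⟩
  calc ∫ z, G z = ∫ x, ∫ y, G (x, y) := by
        rw [Measure.volume_eq_prod] at hint0 ⊢
        exact integral_prod _ hint0
    _ = ∫ r, ∫ y, G (1 / 2 - r, y) := (integral_sub_left_eq_self (fun x => ∫ y, G (x, y)) volume (1/2)).symm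
    _ = ∫ r, ∫ σ, |r| * G (1 / 2 - r, r * σ) := by simp_rw [hsub]
    _ = _ := integral_integral_swap hint

/-- The contribution of one half of a corner of the triangle: along each ray from the midpoint of a
side the missing points form a terminal segment, on which the mean of `bary2` is at least `17 / 24`. The
bound on the missing area ensures that the rays with missing points are nearly parallel to the side. -/
lemma half_corner {K D : Set (ℝ × ℝ)} (hK : Body K) (hM : Mid K)
    (hA : area (T0 \ K) < 1 / 5476) (hDm : MeasurableSet D)
    (hD : ∀ z ∈ D, 0 ≤ z.2 ∧ z.2 ≤ z.1 ∧ z.1 + z.2 < 1 / 2 ∧ z ∉ K)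
    (hD' : ∀ z : ℝ × ℝ, 0 ≤ z.2 → z.2 < z.1 → z.1 + z.2 < 1 / 2 → z ∉ K → z ∈ D) :
    0 ≤ ∫ z in D, (bary2 z - 17 / 24) := by
  rw [← integral_indicator hDm, integral_rays (M := 10)]
  rotate_left
  · exact (bary2_cont.measurable.sub measurable_const).indicator hDm
  · intro z
    by_cases hz : z ∈ D
    · rw [indicator_of_mem hz]
      obtain ⟨h1, h2, h3, -⟩ := hD z hz
      unfold bary2
      rw [abs_le]; constructor <;> nlinarith
    · rw [indicator_of_notMem hz]; norm_num
  · intro z hz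
    obtain ⟨h1, h2, h3, -⟩ := hD z (mem_of_indicator_ne_zero hz)
    refine ⟨?_, ?_, ?_, ?_⟩ <;> linarith
  refine integral_nonneg fun σ => ?_
  simp only [Pi.zero_apply]
  set I : Set ℝ := {r | (1 / 2 - r, r * σ) ∈ D} with hI
  have hIm : MeasurableSet I := hDm.preimage (by fun_prop)
  -- points of the ray
  have hIp : ∀ r ∈ I, 0 < r ∧ 0 ≤ σ ∧ r * σ ≤ 1 / 2 - r ∧ (1 / 2 - r, r * σ) ∉ K := by
    intro r hr
    obtain ⟨h1, h2, h3, h4⟩ := hD _ hr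
    simp only at h1 h2 h3
    have hr0 : 0 < r := by linarith
    exact ⟨hr0, nonneg_of_mul_nonneg_right h1 hr0, h2, h4⟩
  have hex : ∀ r : ℝ, |r| * D.indicator (fun z => bary2 z - 17 / 24) (1 / 2 - r, r * σ) =
      I.indicator (fun r => r * (bary2 (1 / 2 - r, r * σ) - 17 / 24)) r := by
    intro r
    by_cases hr : r ∈ I
    · rw [indicator_of_mem hr, indicator_of_mem (show (1 / 2 - r, r * σ) ∈ D from hr),
        abs_of_pos (hIp r hr).1]
    · rw [indicator_of_notMem hr, indicator_of_notMem (show (1 / 2 - r, r * σ) ∉ D from hr), mul_zero]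
  simp_rw [hex]
  rw [integral_indicator hIm]
  rcases I.eq_empty_or_nonempty with he | ⟨r₁, hr₁⟩
  · rw [he]; simp
  obtain ⟨p1, hσ, p2, p3⟩ := hIp r₁ hr₁
  have h1σ : 0 < 1 + σ := by linarith
  set R := 1 / 2 / (1 + σ) with hR
  have hR0 : 0 < R := by positivity
  have hRσ : R * σ = 1 / 2 - R := by rw [hR]; field_simp; ring
  have hrR : ∀ r, r * σ ≤ 1 / 2 - r → r ≤ R := by
    intro r h; rw [hR, le_div_iff₀ h1σ]; linarith
  -- a point missing from `K` stays missing when moved away from the midpoint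
  have hray : ∀ r, 0 < r → (1 / 2 - r, r * σ) ∉ K → ∀ r', r ≤ r' → (1 / 2 - r', r' * σ) ∉ K := by
    intro r hr hn r' hr' hin
    apply hn
    have hr'0 : 0 < r' := by linarith
    have := hK.cvx hM.m₁ hin (a := 1 - r / r') (b := r / r')
      (by rw [sub_nonneg, div_le_one hr'0]; exact hr') (by positivity) (by ring)
    convert this using 1
    ext
    · simp; field_simp; ring
    · simp; field_simp
  -- Otherwise `Mid.area_ge` at the end of the ray gives a missing area of at least `1 / 74 ^ 2`.
  have hσ1 : σ ≤ 1 / 36 := by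
    by_contra hcon
    push Not at hcon
    have hend := hray r₁ p1 p3 R (hrR _ p2)
    have hx : 1 / 74 ≤ 1 / 2 - R := by
      have : R ≤ 18 / 37 := by rw [hR, div_le_iff₀ h1σ]; linarith
      linarith
    have := hM.area_ge hK hend (by simp only; linarith) (by simp only; linarith)
      (by simp only; linarith) (by simp only; linarith)
    simp only [hRσ] at this
    nlinarith
  have hIsub : I ⊆ Ioc 0 R := fun r hr => ⟨(hIp r hr).1, hrR r (hIp r hr).2.2.1⟩
  have hR12 : R ≤ 1 / 2 := by rw [hR, div_le_iff₀ h1σ]; linarith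
  have key := terminal_integral_nonneg (k := 1 / 6 + 1 / 24 + σ) hR0 hIsub ?_ ?_
  · refine key.trans (setIntegral_mono_on ?_ ?_ hIm ?_)
    · exact ((show Continuous fun r : ℝ => r * (2 * r ^ 2 - (1 / 6 + 1 / 24 + σ)) by
        fun_prop).continuousOn.integrableOn_compact isCompact_Icc).mono_set
          (hIsub.trans Ioc_subset_Icc_self)
    · exact ((show Continuous fun r : ℝ => r * (bary2 (1 / 2 - r, r * σ) - 17 / 24) by
        unfold bary2; fun_prop).continuousOn.integrableOn_compact isCompact_Icc).mono_set
          (hIsub.trans Ioc_subset_Icc_self)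
    · intro r hr
      obtain ⟨h0, h1⟩ := hIsub hr
      refine mul_le_mul_of_nonneg_left ?_ h0.le
      unfold bary2
      simp only
      have e : (1 / 2 - r) ^ 2 + (r * σ) ^ 2 + (1 - (1 / 2 - r) - r * σ) ^ 2 - 17 / 24 =
        2 * r ^ 2 - 1 / 6 - 1 / 24 - σ * (r * (1 + 2 * r)) + 2 * (r * σ) ^ 2 := by ring
      rw [e]
      have : r * (1 + 2 * r) ≤ 1 := by nlinarith
      nlinarith [sq_nonneg (r * σ), mul_le_mul_of_nonneg_left this hσ]
  · intro r hr r' hrr' hr'R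
    have hr0 := (hIp r hr).1
    have hr'0 : 0 < r' := by linarith
    have hlt : r' * σ < 1 / 2 - r' := by
      rw [hR, lt_div_iff₀ h1σ] at hr'R; linarith
    refine hD' _ (by simp only; positivity) hlt ?_ (hray r hr0 (hIp r hr).2.2.2 r' hrr')
    simp only; nlinarith
  · have : 1 / 4 - σ / 2 ≤ R ^ 2 := by
      have h : 1 / 2 - σ / 2 ≤ R := by rw [hR, le_div_iff₀ h1σ]; nlinarith
      nlinarith
    linarith

lemma bary2_intOn {A : Set (ℝ × ℝ)} (hA : A ⊆ T0) (k : ℝ) :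
    IntegrableOn (fun z => bary2 z - k) A :=
  (T0_body.intOn (bary2_cont.sub continuous_const)).mono_set hA

/-- Invariance of integrals of `bary2` under the symmetries of the triangle. -/
lemma integral_bary2_sym {o u v : ℝ × ℝ} (hd : |det2 u v| = 1)
    (hb : ∀ z, bary2 (aff o u v z) = bary2 z) {A B : Set (ℝ × ℝ)} (hA : MeasurableSet A)
    (hAB : ∀ z, aff o u v z ∈ B ↔ z ∈ A) (k : ℝ) :
    ∫ z in B, (bary2 z - k) = ∫ z in A, (bary2 z - k) := by
  have hd0 : det2 u v ≠ 0 := by intro h; rw [h] at hd; simp at hd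
  obtain ⟨o', u', v', -, -, -, h2⟩ := aff_inv o u v hd0
  have hB : B = aff o u v '' A := by
    ext z; constructor
    · intro hz
      refine ⟨aff o' u' v' z, ?_, h2 z⟩
      rw [← hAB, h2]; exact hz
    · rintro ⟨w, hw, rfl⟩; exact (hAB w).2 hw
  rw [hB, integral_aff _ _ _ hd0 hA, hd, one_mul]
  simp only [hb]

/-- The hypotheses on a body with missing corners are invariant under the symmetries of the triangle. -/
lemma Mid.pull {K : Set (ℝ × ℝ)} (hK : Body K) (hM : Mid K) {o u v : ℝ × ℝ}
    (hd : |det2 u v| = 1) (hT : ∀ z, aff o u v z ∈ T0 ↔ z ∈ T0)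
    (h1 : aff o u v (1 / 2, 0) ∈ K) (h2 : aff o u v (0, 1 / 2) ∈ K)
    (h3 : aff o u v (1 / 2, 1 / 2) ∈ K) :
    Body (aff o u v ⁻¹' K) ∧ Mid (aff o u v ⁻¹' K) ∧
      area (T0 \ aff o u v ⁻¹' K) = area (T0 \ K) := by
  have hd0 : det2 u v ≠ 0 := by intro h; rw [h] at hd; simp at hd
  obtain ⟨K₀, hB, he, rfl⟩ := hK.pull (o := o) hd0
  have hs : aff o u v ⁻¹' K ⊆ T0 := fun z hz => (hT z).1 (hM.sub hz)
  refine ⟨hB, ⟨hs, h1, h2, h3⟩, ?_⟩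
  rw [area_diff hB hs, area_diff hK hM.sub]
  conv_rhs => rw [he, area_aff, hd, one_mul]

lemma mem_T0 {z : ℝ × ℝ} : z ∈ T0 ↔ 0 ≤ z.1 ∧ 0 ≤ z.2 ∧ z.1 + z.2 ≤ 1 := Iff.rfl

/-- The missing points in a corner: the two halves of the corner are exchanged by a reflection. -/
lemma corner {K : Set (ℝ × ℝ)} (hK : Body K) (hM : Mid K) (hA : area (T0 \ K) < 1 / 5476) :
    0 ≤ ∫ z in {z | z ∈ T0 \ K ∧ z.1 + z.2 < 1 / 2}, (bary2 z - 17 / 24) := by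
  set D := {z : ℝ × ℝ | z ∈ T0 \ K ∧ z.1 + z.2 < 1 / 2} with hD
  have hDm : MeasurableSet D := (T0_body.meas.diff hK.meas).inter
    (measurableSet_lt (measurable_fst.add measurable_snd) measurable_const)
  have hE : MeasurableSet {z : ℝ × ℝ | z.2 < z.1} := measurableSet_lt measurable_snd measurable_fst
  have hi := bary2_intOn (A := D) (fun z hz => hz.1.1) (17 / 24)
  rw [← integral_inter_add_sdiff hE hi]
  refine add_nonneg ?_ ?_
  · refine half_corner hK hM hA (hDm.inter hE) ?_ ?_
    · rintro z ⟨⟨⟨⟨a1, a2, a3⟩, hz⟩, h1⟩, h2⟩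
      exact ⟨a2, le_of_lt h2, h1, hz⟩
    · intro z h1 h2 h3 h4
      exact ⟨⟨⟨⟨by linarith, h1, by linarith⟩, h4⟩, h3⟩, h2⟩
  · have hd : |det2 ((0 : ℝ), (1 : ℝ)) (1, 0)| = 1 := by norm_num [det2]
    have hs : ∀ z, aff (0, 0) (0, 1) (1, 0) z = (z.2, z.1) := by intro z; ext <;> simp
    obtain ⟨hK', hM', hA'⟩ := hM.pull (o := (0, 0)) hK hd (fun z => by
      rw [hs]; simp only [mem_T0]; constructor <;> rintro ⟨h1, h2, h3⟩ <;>
      exact ⟨h2, h1, by linarith⟩) (by rw [hs]; exact hM.m₂) (by rw [hs]; exact hM.m₁)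
      (by rw [hs]; exact hM.m₃)
    set K' := aff (0, 0) ((0 : ℝ), (1 : ℝ)) (1, 0) ⁻¹' K with hK'd
    have hDm' : MeasurableSet {z : ℝ × ℝ | z ∈ T0 \ K' ∧ z.1 + z.2 < 1 / 2 ∧ z.2 ≤ z.1} :=
      (T0_body.meas.diff hK'.meas).inter ((measurableSet_lt (measurable_fst.add measurable_snd) measurable_const).inter
        (measurableSet_le measurable_snd measurable_fst))
    have key := half_corner hK' hM' (hA' ▸ hA) hDm'
      (by
        rintro z ⟨⟨⟨a1, a2, a3⟩, hz⟩, h1, h2⟩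
        exact ⟨a2, h2, h1, hz⟩)
      (by
        intro z h1 h2 h3 h4
        exact ⟨⟨⟨by linarith, h1, by linarith⟩, h4⟩, h3, h2.le⟩)
    rw [← integral_bary2_sym hd (fun z => by rw [hs]; unfold bary2; ring) hDm' (B := D \ {z | z.2 < z.1})] at key
    · exact key
    · intro z
      rw [hs]
      have : z ∈ K' ↔ (z.2, z.1) ∈ K := by rw [hK'd, mem_preimage, hs]
      simp only [hD, Set.mem_sdiff, mem_ofPred_eq, mem_T0, this, not_lt]
      constructor
      · rintro ⟨⟨⟨⟨h1, h2, h3⟩, h4⟩, h5⟩, h6⟩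
        exact ⟨⟨⟨h2, h1, by linarith⟩, h4⟩, by linarith, h6⟩
      · rintro ⟨⟨⟨h1, h2, h3⟩, h4⟩, h5, h6⟩
        exact ⟨⟨⟨⟨h2, h1, by linarith⟩, h4⟩, by linarith⟩, h6⟩

/-- On average over the missing points the sum of squares of the barycentric coordinates is at least
`17 / 24`. The three corners are exchanged by rotations of the triangle. -/
lemma integral_missing {K : Set (ℝ × ℝ)} (hK : Body K) (hM : Mid K)
    (hA : area (T0 \ K) < 1 / 5476) : 0 ≤ ∫ z in T0 \ K, (bary2 z - 17 / 24) := by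
  set D := T0 \ K with hD
  have hDm : MeasurableSet D := T0_body.meas.diff hK.meas
  have hi := bary2_intOn (A := D) (fun z hz => hz.1) (17 / 24)
  have e1 : MeasurableSet {z : ℝ × ℝ | z.1 + z.2 < 1 / 2} :=
    measurableSet_lt (by fun_prop) measurable_const
  have e2 : MeasurableSet {z : ℝ × ℝ | 1 / 2 < z.1} :=
    measurableSet_lt measurable_const measurable_fst
  have hmed : ∀ z ∈ D, z.1 + z.2 < 1 / 2 ∨ 1 / 2 < z.1 ∨ 1 / 2 < z.2 := by
    rintro z ⟨⟨h1, h2, h3⟩, hz⟩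
    by_contra hcon
    push Not at hcon
    obtain ⟨c1, c2, c3⟩ := hcon
    refine hz (comb3 hK.cvx hM.m₃ hM.m₂ hM.m₁ (x := 1 - 2 * z.1) (y := 1 - 2 * z.2)
      (by linarith) (by linarith) (by linarith) ?_ ?_) <;> simp only <;> ring
  rw [← integral_inter_add_sdiff e1 hi, ← integral_inter_add_sdiff e2 (hi.mono_set sdiff_subset)]
  refine add_nonneg (corner hK hM hA) (add_nonneg ?_ ?_)
  · have hd : |det2 ((-1 : ℝ), (1 : ℝ)) (-1, 0)| = 1 := by norm_num [det2]
    have hs : ∀ z, aff (1, 0) (-1, 1) (-1, 0) z = (1 - z.1 - z.2, z.1) := by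
      intro z; ext <;> simp; ring
    obtain ⟨hK', hM', hA'⟩ := hM.pull (o := (1, 0)) hK hd (fun z => by
      rw [hs]; simp only [mem_T0]; constructor <;> rintro ⟨h1, h2, h3⟩ <;>
      refine ⟨?_, ?_, ?_⟩ <;> linarith)
      (by rw [hs]; convert hM.m₃ using 2; norm_num) (by rw [hs]; convert hM.m₁ using 2; norm_num)
      (by rw [hs]; convert hM.m₂ using 2; norm_num)
    have key := corner hK' hM' (hA' ▸ hA)
    rw [← integral_bary2_sym hd (fun z => by rw [hs]; unfold bary2; ring)
      (B := (D \ {z | z.1 + z.2 < 1 / 2}) ∩ {z | 1 / 2 < z.1})] at key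
    · exact key
    · exact (T0_body.meas.diff hK'.meas).inter (measurableSet_lt (measurable_fst.add measurable_snd) measurable_const)
    · intro z
      simp only [hD, mem_inter_iff, Set.mem_sdiff, mem_ofPred_eq, mem_T0, hs, mem_preimage, not_lt]
      constructor
      · rintro ⟨⟨⟨⟨h1, h2, h3⟩, h4⟩, h5⟩, h6⟩
        exact ⟨⟨⟨h2, by linarith, by linarith⟩, h4⟩, by linarith⟩
      · rintro ⟨⟨⟨h1, h2, h3⟩, h4⟩, h5⟩
        exact ⟨⟨⟨⟨by linarith, h1, by linarith⟩, h4⟩, by linarith⟩, by linarith⟩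
  · have hd : |det2 ((0 : ℝ), (-1 : ℝ)) (1, -1)| = 1 := by norm_num [det2]
    have hs : ∀ z, aff (0, 1) (0, -1) (1, -1) z = (z.2, 1 - z.1 - z.2) := by
      intro z; ext <;> simp; ring
    obtain ⟨hK', hM', hA'⟩ := hM.pull (o := (0, 1)) hK hd (fun z => by
      rw [hs]; simp only [mem_T0]; constructor <;> rintro ⟨h1, h2, h3⟩ <;>
      refine ⟨?_, ?_, ?_⟩ <;> linarith)
      (by rw [hs]; convert hM.m₂ using 2; norm_num) (by rw [hs]; convert hM.m₃ using 2; norm_num)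
      (by rw [hs]; convert hM.m₁ using 2; norm_num)
    have key := corner hK' hM' (hA' ▸ hA)
    rw [← integral_bary2_sym hd (fun z => by rw [hs]; unfold bary2; ring)
      (B := (D \ {z | z.1 + z.2 < 1 / 2}) \ {z | 1 / 2 < z.1})] at key
    · exact key
    · exact (T0_body.meas.diff hK'.meas).inter (measurableSet_lt (measurable_fst.add measurable_snd) measurable_const)
    · intro z
      constructor
      · rintro ⟨⟨h1, h2⟩, h3⟩
        have h4 := hmed _ h1
        obtain ⟨⟨h5, h6, h7⟩, h8⟩ := h1
        rw [hs] at h4 h5 h6 h7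
        simp only [hs, mem_ofPred_eq, not_lt] at h2 h3 h4 h5 h6 h7
        refine ⟨⟨⟨by linarith, h5, by linarith⟩, h8⟩, ?_⟩
        rcases h4 with h4 | h4 | h4 <;> linarith
      · rintro ⟨⟨⟨h1, h2, h3⟩, h4⟩, h5⟩
        simp only [hD, Set.mem_sdiff, mem_ofPred_eq, mem_T0, hs, not_lt]
        refine ⟨⟨⟨⟨h2, by linarith, by linarith⟩, ?_⟩, by linarith⟩, by linarith⟩
        rw [mem_preimage, hs] at h4; exact h4

lemma integral_bary2_T0 : ∫ z in T0, bary2 z = 1 / 4 := by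
  rw [integral_T0 bary2_cont]
  have hd : ∀ x y : ℝ, HasDerivAt (fun y : ℝ => x ^ 2 * y + y ^ 3 / 3 - (1 - x - y) ^ 3 / 3)
      (bary2 (x, y)) y := by
    intro x y
    have := (((hasDerivAt_id' y).const_mul (x ^ 2)).add ((hasDerivAt_pow 3 y).div_const 3)).sub
      ((((hasDerivAt_id' y).const_sub (1 - x)).pow 3).div_const 3)
    refine this.congr_deriv ?_
    unfold bary2; simp; ring
  have h1 : ∀ x : ℝ, ∫ y in (0:ℝ)..(1 - x), bary2 (x, y) =
      x ^ 2 * (1 - x) + 2 * (1 - x) ^ 3 / 3 := by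
    intro x
    rw [intervalIntegral.integral_eq_sub_of_hasDerivAt (fun y _ => hd x y)
      ((bary2_cont.comp (Continuous.prodMk_right x)).intervalIntegrable _ _)]
    ring
  simp_rw [h1]
  have hd2 : ∀ x : ℝ, HasDerivAt (fun x : ℝ => x ^ 3 / 3 - x ^ 4 / 4 - (1 - x) ^ 4 / 6)
      (x ^ 2 * (1 - x) + 2 * (1 - x) ^ 3 / 3) x := by
    intro x
    have := (((hasDerivAt_pow 3 x).div_const 3).sub ((hasDerivAt_pow 4 x).div_const 4)).sub
      ((((hasDerivAt_id' x).const_sub 1).pow 4).div_const 6)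
    refine this.congr_deriv ?_
    simp; ring
  rw [intervalIntegral.integral_eq_sub_of_hasDerivAt (fun x _ => hd2 x)
    (Continuous.intervalIntegrable (by fun_prop) _ _)]
  norm_num

/-- The quadratic functional is twice the determinant of the matrix of second moments. -/
lemma W_sq {K : Set (ℝ × ℝ)} (hK : IsCompact K) (o : ℝ × ℝ) :
    W (fun s => s ^ 2) K o = 2 * ((∫ z in K, (z.1 - o.1) ^ 2) * (∫ z in K, (z.2 - o.2) ^ 2) -
      (∫ z in K, (z.1 - o.1) * (z.2 - o.2)) ^ 2) := by
  have i1 : IntegrableOn (fun z : ℝ × ℝ => (z.1 - o.1) ^ 2) K := intOn_of_cont hK (by fun_prop)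
  have i2 : IntegrableOn (fun z : ℝ × ℝ => (z.2 - o.2) ^ 2) K := intOn_of_cont hK (by fun_prop)
  have i3 : IntegrableOn (fun z : ℝ × ℝ => (z.1 - o.1) * (z.2 - o.2)) K :=
    intOn_of_cont hK (by fun_prop)
  set a := ∫ z in K, (z.1 - o.1) ^ 2 with ha
  set c := ∫ z in K, (z.2 - o.2) ^ 2 with hc
  set b := ∫ z in K, (z.1 - o.1) * (z.2 - o.2) with hb
  have key : ∀ k l m : ℝ, ∫ z in K, (k * (z.1 - o.1) ^ 2 + l * (z.2 - o.2) ^ 2 -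
      m * ((z.1 - o.1) * (z.2 - o.2))) = k * a + l * c - m * b := by
    intro k l m
    rw [ha, hc, hb]
    exact (single_lin hK k l m (by fun_prop) (by fun_prop) (by fun_prop)).symm
  unfold W
  have h1 : ∀ x : ℝ × ℝ, ∫ y in K, cr o x y ^ 2 = (x.2 - o.2) ^ 2 * a + (x.1 - o.1) ^ 2 * c -
      (2 * ((x.1 - o.1) * (x.2 - o.2))) * b := by
    intro x
    rw [← key]
    congr 1; ext y; unfold cr; ring
  simp_rw [h1]
  have h2 : ∀ x : ℝ × ℝ, (x.2 - o.2) ^ 2 * a + (x.1 - o.1) ^ 2 * c -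
      (2 * ((x.1 - o.1) * (x.2 - o.2))) * b = c * (x.1 - o.1) ^ 2 + a * (x.2 - o.2) ^ 2 -
      (2 * b) * ((x.1 - o.1) * (x.2 - o.2)) := by intro x; ring
  simp_rw [h2, key]
  ring

/-- The quadratic functional is controlled by the second moment with respect to the quadratic
form `bary2`: the determinant of a positive semidefinite matrix is at most a multiple of the square of
its trace with respect to this form, and the second moment is smallest about the centroid. -/
lemma Th_le {K : Set (ℝ × ℝ)} (hK : Body K) :
    Th K ≤ 1 / 6 * (((∫ z in K, bary2 z) - area K / 3) / area K ^ 2) ^ 2 := by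
  have hA := hK.area_pos
  set g := cen K with hg
  set a := ∫ z in K, (z.1 - g.1) ^ 2 with ha
  set c := ∫ z in K, (z.2 - g.2) ^ 2 with hc
  set b := ∫ z in K, (z.1 - g.1) * (z.2 - g.2) with hb
  have h1 : ∫ z in K, (2 * (z.1 - g.1) ^ 2 + 2 * (z.2 - g.2) ^ 2 -
      (-2) * ((z.1 - g.1) * (z.2 - g.2))) = 2 * a + 2 * c - (-2) * b := by
    rw [ha, hc, hb]
    exact (single_lin hK.cpt 2 2 (-2) (by fun_prop) (by fun_prop) (by fun_prop)).symm
  obtain ⟨e, he⟩ : ∃ e, e = 2 * ((g.1 - 1 / 3) ^ 2 + (g.1 - 1 / 3) * (g.2 - 1 / 3) +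
    (g.2 - 1 / 3) ^ 2) := ⟨_, rfl⟩
  have he0 : 0 ≤ e := by
    rw [he]
    nlinarith [sq_nonneg (g.1 - 1 / 3 + (g.2 - 1 / 3)), sq_nonneg (g.1 - 1 / 3),
      sq_nonneg (g.2 - 1 / 3)]
  -- the second moment about the centroid is the smallest one
  have h2 : (∫ z in K, bary2 z) = 2 * a + 2 * c + 2 * b + area K * (e + 1 / 3) := by
    have e1 : ∀ z : ℝ × ℝ, bary2 z = (2 * (z.1 - g.1) ^ 2 + 2 * (z.2 - g.2) ^ 2 -
      (-2) * ((z.1 - g.1) * (z.2 - g.2))) +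
      ((e + 1 / 3 - (4 * (g.1 - 1 / 3) + 2 * (g.2 - 1 / 3)) * g.1 -
        (2 * (g.1 - 1 / 3) + 4 * (g.2 - 1 / 3)) * g.2) +
        (4 * (g.1 - 1 / 3) + 2 * (g.2 - 1 / 3)) * z.1 +
        (2 * (g.1 - 1 / 3) + 4 * (g.2 - 1 / 3)) * z.2) := by
      intro z; rw [he]; unfold bary2; ring
    simp_rw [e1]
    rw [integral_add (hK.intOn (by fun_prop)) (hK.intOn (by fun_prop)), h1, hK.integral_affine]
    ring
  set σ := (∫ z in K, bary2 z) - area K / 3 with hσ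
  have hσe : σ = 2 * a + 2 * c + 2 * b + area K * e := by rw [hσ, h2]; ring
  have hs0 : 0 ≤ 2 * a + 2 * c + 2 * b := by
    have : 0 ≤ ∫ z in K, (2 * (z.1 - g.1) ^ 2 + 2 * (z.2 - g.2) ^ 2 -
      (-2) * ((z.1 - g.1) * (z.2 - g.2))) := integral_nonneg fun z => by
        simp only [Pi.zero_apply]
        nlinarith [sq_nonneg (z.1 - g.1 + (z.2 - g.2)), sq_nonneg (z.1 - g.1),
          sq_nonneg (z.2 - g.2)]
    linarith
  have hdet : 12 * (a * c - b ^ 2) ≤ (2 * a + 2 * c + 2 * b) ^ 2 := by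
    nlinarith [sq_nonneg (a - c), sq_nonneg (a + c + 4 * b)]
  have hσ2 : (2 * a + 2 * c + 2 * b) ^ 2 ≤ σ ^ 2 := by
    apply pow_le_pow_left₀ hs0
    rw [hσe]; nlinarith [mul_nonneg hA.le he0]
  unfold Th
  rw [W_sq hK.cpt, div_pow, ← hg, ← ha, ← hc, ← hb, inv_mul_eq_div, ← pow_mul, ← mul_div_assoc]
  exact div_le_div_of_nonneg_right (by linarith) (by positivity)

/-- Stability of the quadratic functional for bodies of nearly full area in a triangle which
contain the midpoints of its sides. Removing missing points of mean `bary2` equal to `2 / 3` would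
leave the bound in `Th_le` unchanged to first order; `17 / 24` is larger than `2 / 3`. -/
lemma Th_near {K : Set (ℝ × ℝ)} (hK : Body K) (hM : Mid K) (hA : area (T0 \ K) < 1 / 5476) :
    Th K ≤ 1 / 54 - area (T0 \ K) / 108 := by
  have h0 := integral_missing hK hM hA
  have hdiff := area_diff hK hM.sub
  set η := area (T0 \ K) with hη
  have hη0 : 0 ≤ η := measureReal_nonneg
  have hDfin : volume (T0 \ K) ≠ ⊤ :=
    (lt_of_le_of_lt (measure_mono sdiff_subset) T0_compact.measure_lt_top).ne
  have hb : IntegrableOn bary2 (T0 \ K) :=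
    (T0_body.intOn bary2_cont).mono_set sdiff_subset
  rw [integral_sub hb (integrableOn_const hDfin), setIntegral_const, smul_eq_mul] at h0
  have hK0 : ∫ z in K, bary2 z = 1 / 4 - ∫ z in T0 \ K, bary2 z := by
    have := integral_inter_add_sdiff hK.meas (T0_body.intOn bary2_cont)
    rw [inter_eq_right.2 hM.sub, integral_bary2_T0] at this
    linarith
  have h0' : 17 / 24 * η ≤ ∫ z in T0 \ K, bary2 z := by
    have : volume.real (T0 \ K) = η := rfl
    rw [this] at h0; linarith
  have hAK : area K = 1 / 2 - η := by linarith
  have hApos := hK.area_pos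
  have hσ0 : 0 ≤ (∫ z in K, bary2 z) - area K / 3 := by
    have : ∫ z in K, (bary2 z - 1 / 3) = (∫ z in K, bary2 z) - area K / 3 := by
      rw [integral_sub (hK.intOn bary2_cont) (hK.intOn continuous_const), setIntegral_const,
        smul_eq_mul]
      unfold area; ring
    rw [← this]
    refine integral_nonneg fun z => ?_
    simp only [Pi.zero_apply]; unfold bary2
    nlinarith [sq_nonneg (z.1 - z.2), sq_nonneg (z.1 + 2 * z.2 - 1), sq_nonneg (2 * z.1 + z.2 - 1)]
  have hσ1 : ((∫ z in K, bary2 z) - area K / 3) / area K ^ 2 ≤ 1 / 3 - η / 6 := by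
    rw [div_le_iff₀ (by positivity), hK0, hAK]
    nlinarith [mul_nonneg (sq_nonneg η) (show 0 ≤ 1 / 2 - η / 6 by linarith)]
  refine (Th_le hK).trans ?_
  have h1 : (((∫ z in K, bary2 z) - area K / 3) / area K ^ 2) ^ 2 ≤ (1 / 3 - η / 6) ^ 2 :=
    pow_le_pow_left₀ (by positivity) hσ1 2
  nlinarith

/-! ### Smallest circumscribed triangles -/

lemma mem_tri_iff {a b c k : ℝ × ℝ} (h : 0 < cr a b c) :
    k ∈ tri a b c ↔ 0 ≤ cr a b k ∧ 0 ≤ cr b c k ∧ 0 ≤ cr c a k := by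
  have hd : det2 (b - a) (c - a) ≠ 0 := by rw [det2_eq_cr]; exact h.ne'
  obtain ⟨o', u', v', -, -, -, h2⟩ := aff_inv a (b - a) (c - a) hd
  set L := aff a (b - a) (c - a) with hL
  have La : L (0, 0) = a := by ext <;> simp [hL]
  have Lb : L (1, 0) = b := by ext <;> simp [hL]
  have Lc : L (0, 1) = c := by ext <;> simp [hL]
  obtain ⟨z, rfl⟩ : ∃ z, L z = k := ⟨_, h2 k⟩
  have e1 : cr a b (L z) = cr a b c * z.2 := by
    rw [← det2_eq_cr a b c]
    conv_lhs => rw [← La, ← Lb, hL, cr_aff]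
    simp [cr]
  have e2 : cr b c (L z) = cr a b c * (1 - z.1 - z.2) := by
    rw [← det2_eq_cr a b c]
    conv_lhs => rw [← Lb, ← Lc, hL, cr_aff]
    simp [cr]; left; ring
  have e3 : cr c a (L z) = cr a b c * z.1 := by
    rw [← det2_eq_cr a b c]
    conv_lhs => rw [← Lc, ← La, hL, cr_aff]
    simp [cr]
  rw [e1, e2, e3, mul_nonneg_iff_of_pos_left h, mul_nonneg_iff_of_pos_left h,
    mul_nonneg_iff_of_pos_left h, tri_eq_aff, ← hL, (aff_inj _ _ _ hd).mem_set_image, mem_T0]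
  constructor
  · rintro ⟨h1, h2, h3⟩; exact ⟨h2, by linarith, h1⟩
  · rintro ⟨h1, h2, h3⟩; exact ⟨h3, h1, by linarith⟩

lemma tri_compact (a b c : ℝ × ℝ) : IsCompact (tri a b c) :=
  Set.Finite.isCompact_convexHull (𝕜 := ℝ) (by simp)

lemma Body.exists_ball {K : Set (ℝ × ℝ)} (hK : Body K) :
    ∃ z ρ, 0 < ρ ∧ Metric.closedBall z ρ ⊆ K := by
  obtain ⟨z, hz⟩ := hK.int
  obtain ⟨ρ, hρ, hb⟩ := Metric.nhds_basis_closedBall.mem_iff.1 (mem_interior_iff_mem_nhds.1 hz)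
  exact ⟨z, ρ, hρ, hb⟩

/-- A triangle containing a ball has diameter bounded in terms of its area. -/
lemma vertex_bound {K : Set (ℝ × ℝ)} {z a b c p : ℝ × ℝ} {ρ : ℝ} (hρ : 0 < ρ)
    (hb : Metric.closedBall z ρ ⊆ K) (hK : K ⊆ tri a b c) (hp : p ∈ tri a b c) :
    2 * ρ * |p.1 - z.1| ≤ |cr a b c| ∧ 2 * ρ * |p.2 - z.2| ≤ |cr a b c| := by
  have hm : ∀ q ∈ tri a b c, ∀ q' ∈ tri a b c, |cr p q q'| ≤ |cr a b c| := by
    intro q hq q' hq'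
    have : area (tri p q q') ≤ area (tri a b c) :=
      area_mono (tri_subset (convex_convexHull ℝ _) hp hq hq') (tri_compact a b c)
    rw [area_tri, area_tri] at this
    linarith
  have hball : ∀ x y, |x| ≤ ρ → |y| ≤ ρ → (z.1 + x, z.2 + y) ∈ tri a b c := by
    intro x y hx hy
    apply hK; apply hb
    rw [Metric.mem_closedBall, Prod.dist_eq, Real.dist_eq, Real.dist_eq]
    simp [hx, hy]
  have hr : |ρ| ≤ ρ := (abs_of_pos hρ).le
  have hr' : |-ρ| ≤ ρ := by rw [abs_neg]; exact hr
  have h0 : |(0 : ℝ)| ≤ ρ := by simp [hρ.le]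
  constructor
  · have := hm _ (hball 0 ρ h0 hr) _ (hball 0 (-ρ) h0 hr')
    have e : cr p (z.1 + 0, z.2 + ρ) (z.1 + 0, z.2 + -ρ) = 2 * ρ * (p.1 - z.1) := by
      unfold cr; ring
    rwa [e, abs_mul, abs_of_pos (by linarith : 0 < 2 * ρ)] at this
  · have := hm _ (hball ρ 0 hr h0) _ (hball (-ρ) 0 hr' h0)
    have e : cr p (z.1 + ρ, z.2 + 0) (z.1 + -ρ, z.2 + 0) = 2 * ρ * (-(p.2 - z.2)) := by
      unfold cr; ring
    rwa [e, abs_mul, abs_neg, abs_of_pos (by linarith : 0 < 2 * ρ)] at this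

/-- Among the triangles containing a convex body there is one of minimal area, because those of
bounded area form a compact set. -/
lemma exists_min_triangle {K : Set (ℝ × ℝ)} (hK : Body K) : ∃ a b c, 0 < cr a b c ∧ K ⊆ tri a b c ∧
    ∀ a' b' c', K ⊆ tri a' b' c' → cr a b c ≤ |cr a' b' c'| := by
  obtain ⟨z, ρ, hρ, hball⟩ := hK.exists_ball
  have hA := hK.area_pos
  -- some triangle containing `K`
  obtain ⟨R, hR0, hR⟩ : ∃ R : ℝ, 0 < R ∧ ∀ k ∈ K, |k.1| ≤ R ∧ |k.2| ≤ R := by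
    obtain ⟨R, hR⟩ := hK.cpt.isBounded.exists_norm_le
    refine ⟨max R 1, by positivity, fun k hk => ?_⟩
    have := hR k hk
    rw [Prod.norm_def] at this
    exact ⟨(le_max_left _ _).trans (this.trans (le_max_left _ _)),
      (le_max_right _ _).trans (this.trans (le_max_left _ _))⟩
  set M := 16 * R ^ 2 with hM
  set V : Set ((ℝ × ℝ) × (ℝ × ℝ) × (ℝ × ℝ)) := {q | 2 * area K ≤ cr q.1 q.2.1 q.2.2 ∧
    cr q.1 q.2.1 q.2.2 ≤ M ∧ ∀ k ∈ K, 0 ≤ cr q.1 q.2.1 k ∧ 0 ≤ cr q.2.1 q.2.2 k ∧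
      0 ≤ cr q.2.2 q.1 k} with hV
  have hVtri : ∀ q ∈ V, 0 < cr q.1 q.2.1 q.2.2 ∧ K ⊆ tri q.1 q.2.1 q.2.2 := by
    rintro q ⟨h1, -, h3⟩
    have hp : 0 < cr q.1 q.2.1 q.2.2 := by linarith
    exact ⟨hp, fun k hk => (mem_tri_iff hp).2 (h3 k hk)⟩
  have htriV : ∀ a b c, 0 < cr a b c → cr a b c ≤ M → K ⊆ tri a b c → (a, b, c) ∈ V := by
    intro a b c h1 h2 h3
    refine ⟨?_, h2, fun k hk => (mem_tri_iff h1).1 (h3 hk)⟩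
    have := area_mono h3 (tri_compact a b c)
    rw [area_tri, abs_of_pos h1] at this
    simp only; linarith
  have hVcl : IsClosed V := by
    have c1 : Continuous fun q : (ℝ × ℝ) × (ℝ × ℝ) × (ℝ × ℝ) => cr q.1 q.2.1 q.2.2 := by
      unfold cr; fun_prop
    have c2 : ∀ k, Continuous fun q : (ℝ × ℝ) × (ℝ × ℝ) × (ℝ × ℝ) => cr q.1 q.2.1 k := by
      unfold cr; fun_prop
    have c3 : ∀ k, Continuous fun q : (ℝ × ℝ) × (ℝ × ℝ) × (ℝ × ℝ) => cr q.2.1 q.2.2 k := by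
      unfold cr; fun_prop
    have c4 : ∀ k, Continuous fun q : (ℝ × ℝ) × (ℝ × ℝ) × (ℝ × ℝ) => cr q.2.2 q.1 k := by
      unfold cr; fun_prop
    refine (isClosed_le continuous_const c1).inter ((isClosed_le c1 continuous_const).inter ?_)
    have : {q : (ℝ × ℝ) × (ℝ × ℝ) × (ℝ × ℝ) | ∀ k ∈ K, 0 ≤ cr q.1 q.2.1 k ∧ 0 ≤ cr q.2.1 q.2.2 k ∧
        0 ≤ cr q.2.2 q.1 k} = ⋂ k ∈ K, {q | 0 ≤ cr q.1 q.2.1 k ∧ 0 ≤ cr q.2.1 q.2.2 k ∧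
        0 ≤ cr q.2.2 q.1 k} := by ext; simp
    change IsClosed {q : (ℝ × ℝ) × (ℝ × ℝ) × (ℝ × ℝ) | ∀ k ∈ K, 0 ≤ cr q.1 q.2.1 k ∧
      0 ≤ cr q.2.1 q.2.2 k ∧ 0 ≤ cr q.2.2 q.1 k}
    rw [this]
    refine isClosed_biInter fun k _ => ?_
    exact (isClosed_le continuous_const (c2 k)).inter
      ((isClosed_le continuous_const (c3 k)).inter (isClosed_le continuous_const (c4 k)))
  have hVc : IsCompact V := by
    set B := Metric.closedBall z (M / (2 * ρ)) with hB
    refine IsCompact.of_isClosed_subset ((isCompact_closedBall z (M / (2 * ρ))).prod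
      ((isCompact_closedBall z (M / (2 * ρ))).prod (isCompact_closedBall z (M / (2 * ρ))))) hVcl ?_
    intro q hq
    obtain ⟨h1, h2⟩ := hVtri q hq
    have hb : ∀ p ∈ tri q.1 q.2.1 q.2.2, p ∈ Metric.closedBall z (M / (2 * ρ)) := by
      intro p hp
      obtain ⟨g1, g2⟩ := vertex_bound hρ hball h2 hp
      rw [abs_of_pos h1] at g1 g2
      have := hq.2.1
      rw [Metric.mem_closedBall, Prod.dist_eq, Real.dist_eq, Real.dist_eq]
      refine max_le ?_ ?_ <;> rw [le_div_iff₀ (by positivity)] <;> linarith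
    exact ⟨hb _ (subset_convexHull _ _ (by simp)), hb _ (subset_convexHull _ _ (by simp)),
      hb _ (subset_convexHull _ _ (by simp))⟩
  have hne : (((-R, -R) : ℝ × ℝ), ((3 * R, -R) : ℝ × ℝ), ((-R, 3 * R) : ℝ × ℝ)) ∈ V := by
    have e : cr ((-R, -R) : ℝ × ℝ) (3 * R, -R) (-R, 3 * R) = M := by rw [hM]; unfold cr; ring
    have hp : 0 < cr ((-R, -R) : ℝ × ℝ) (3 * R, -R) (-R, 3 * R) := by rw [e]; positivity
    refine htriV _ _ _ hp e.le fun k hk => (mem_tri_iff hp).2 ?_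
    obtain ⟨h1, h2⟩ := hR k hk
    rw [abs_le] at h1 h2
    unfold cr
    simp only
    refine ⟨?_, ?_, ?_⟩ <;> nlinarith
  have c1 : Continuous fun q : (ℝ × ℝ) × (ℝ × ℝ) × (ℝ × ℝ) => cr q.1 q.2.1 q.2.2 := by
    unfold cr; fun_prop
  obtain ⟨q, hq, hmin⟩ := hVc.exists_isMinOn ⟨_, hne⟩ c1.continuousOn
  obtain ⟨h1, h2⟩ := hVtri q hq
  refine ⟨q.1, q.2.1, q.2.2, h1, h2, fun a b c h => ?_⟩
  by_contra hlt
  push Not at hlt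
  have hpos : 0 < |cr a b c| := by
    have := area_mono h (tri_compact a b c)
    rw [area_tri] at this
    linarith
  rcases abs_cases (cr a b c) with ⟨h3, -⟩ | ⟨h3, -⟩
  · rw [h3] at hlt hpos
    have := hmin (htriV a b c hpos (hlt.le.trans hq.2.1) h)
    exact absurd this (not_le.2 hlt)
  · have e : cr b a c = -cr a b c := by unfold cr; ring
    rw [h3, ← e] at hlt hpos
    have hs : tri b a c = tri a b c := by unfold tri; rw [insert_comm]
    have := hmin (htriV b a c hpos (hlt.le.trans hq.2.1) (hs ▸ h))
    exact absurd this (not_le.2 hlt)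

/-- `K` is inscribed in the standard triangle, and no triangle containing `K` has smaller area. -/
structure MinIn (K : Set (ℝ × ℝ)) : Prop where
  body : Body K
  sub : K ⊆ T0
  min : ∀ a b c, K ⊆ tri a b c → 1 ≤ |cr a b c|

/-- A line separating the midpoint `(1 / 2, 1 / 2)` from the body by a margin `ε`, with normal `(l, m)`,
yields a small rotation and shift of the side on `x + y = 1` that decreases the area of the
circumscribed triangle. The new side is `(1 + s l) x + (1 + s m) y = 1 + s (l + m) / 2 - s ε`; to first
order in `s` the area changes by the shift `- s ε` only. -/
lemma exists_tilt (l m ε : ℝ) (hε0 : 0 < ε) : ∃ s, 0 < s ∧ 0 < 1 + s * l ∧ 0 < 1 + s * m ∧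
    0 < 1 + s * (l + m) / 2 - s * ε ∧
    (1 + s * (l + m) / 2 - s * ε) ^ 2 < (1 + s * l) * (1 + s * m) := by
  obtain ⟨N, hN⟩ : ∃ N, N = 1 + |l| + |m| + ε := ⟨_, rfl⟩
  have al := abs_nonneg l
  have am := abs_nonneg m
  have l1 := le_abs_self l
  have l2 := neg_abs_le l
  have m1 := le_abs_self m
  have m2 := neg_abs_le m
  have hN1 : 1 ≤ N := by linarith
  obtain ⟨s, hs⟩ : ∃ s, s = ε / (10 * N ^ 2) := ⟨_, rfl⟩
  have hs0 : 0 < s := by rw [hs]; positivity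
  have hsN : s * N ≤ 1 / 10 := by
    have : s * N = ε / (10 * N) := by rw [hs]; field_simp
    rw [this, div_le_iff₀ (by positivity)]; linarith
  have hsN2 : s * N ^ 2 = ε / 10 := by rw [hs]; field_simp
  have hl : -(1 / 10) ≤ s * l := by
    have := mul_le_mul_of_nonneg_left (show -N ≤ l by linarith) hs0.le
    linarith
  have hm : -(1 / 10) ≤ s * m := by
    have := mul_le_mul_of_nonneg_left (show -N ≤ m by linarith) hs0.le
    linarith
  have hsε : s * ε ≤ 1 / 10 := by
    have := mul_le_mul_of_nonneg_left (show ε ≤ N by linarith) hs0.le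
    linarith
  have e : (1 + s * (l + m) / 2 - s * ε) ^ 2 - (1 + s * l) * (1 + s * m) =
      s * (s * ((l - m) ^ 2 / 4 - ε * (l + m) + ε ^ 2) - 2 * ε) := by ring
  have b1 : (l - m) ^ 2 ≤ (2 * N) ^ 2 := by
    apply sq_le_sq' <;> linarith
  have b2 : ε * -(l + m) ≤ N * N := by
    rcases le_or_gt 0 (-(l + m)) with h | h
    · exact mul_le_mul (by linarith) (by linarith) h (by linarith)
    · have h1 := mul_neg_of_pos_of_neg hε0 h
      have h2 : 0 ≤ N * N := mul_self_nonneg N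
      linarith
  have b3 : ε ^ 2 ≤ N ^ 2 := pow_le_pow_left₀ hε0.le (by linarith) 2
  have h3 : s * ((l - m) ^ 2 / 4 - ε * (l + m) + ε ^ 2) ≤ s * (3 * N ^ 2) :=
    mul_le_mul_of_nonneg_left (by linarith) hs0.le
  have h4 : s * (s * ((l - m) ^ 2 / 4 - ε * (l + m) + ε ^ 2) - 2 * ε) < 0 :=
    mul_neg_of_pos_of_neg hs0 (by linarith)
  exact ⟨s, hs0, by linarith, by linarith, by linarith, by linarith⟩

/-- The midpoint of a side of a minimal circumscribed triangle belongs to the body. -/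
lemma MinIn.mid {K : Set (ℝ × ℝ)} (hK : MinIn K) : ((1 / 2, 1 / 2) : ℝ × ℝ) ∈ K := by
  by_contra hm
  obtain ⟨f, u, hf1, hf2⟩ := geometric_hahn_banach_closed_point hK.body.cvx hK.body.cpt.isClosed hm
  have hlt : ∀ k ∈ K, f (1, 0) * k.1 + f (0, 1) * k.2 < u := fun k hk => by
    rw [← clm_apply_prod]; exact hf1 k hk
  rw [clm_apply_prod] at hf2
  generalize f (1, 0) = l at hlt hf2
  generalize f (0, 1) = m at hlt hf2
  simp only at hf2
  obtain ⟨ε, hε⟩ : ∃ ε, ε = l * (1 / 2) + m * (1 / 2) - u := ⟨_, rfl⟩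
  obtain ⟨s, hs0, hα, hβ, hγ, hlt'⟩ := exists_tilt l m ε (by linarith)
  have hk5 : ∀ k ∈ K, (1 + s * l) * k.1 + (1 + s * m) * k.2 ≤ 1 + s * (l + m) / 2 - s * ε := by
    intro k hk
    have h1 : l * k.1 + m * k.2 ≤ (l + m) / 2 - ε := by linarith [hlt k hk]
    have h2 := mul_le_mul_of_nonneg_left h1 hs0.le
    linarith [(hK.sub hk).2.2]
  generalize 1 + s * (l + m) / 2 - s * ε = γ at hk5 hlt' hγ
  generalize 1 + s * l = α at hk5 hlt' hα
  generalize 1 + s * m = β at hk5 hlt' hβ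
  have hcr : cr ((0 : ℝ), (0 : ℝ)) (γ / α, 0) (0, γ / β) = γ ^ 2 / (α * β) := by
    unfold cr; simp only; field_simp; ring
  have hcr0 : 0 < γ ^ 2 / (α * β) := by positivity
  have hle := hK.min (0, 0) (γ / α, 0) (0, γ / β) ?_
  · rw [hcr, abs_of_pos hcr0, le_div_iff₀ (by positivity), one_mul] at hle
    linarith
  · intro k hk
    rw [mem_tri_iff (by rw [hcr]; exact hcr0)]
    obtain ⟨k1, k2, k3⟩ := hK.sub hk
    have hk6 := hk5 k hk
    refine ⟨?_, ?_, ?_⟩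
    · have : cr ((0 : ℝ), (0 : ℝ)) (γ / α, 0) k = γ / α * k.2 := by unfold cr; ring
      rw [this]; positivity
    · have : cr (γ / α, 0) (0, γ / β) k = γ / (α * β) * (γ - α * k.1 - β * k.2) := by
        unfold cr; simp only; field_simp; ring
      rw [this]
      have : 0 < γ / (α * β) := by positivity
      exact mul_nonneg this.le (by linarith)
    · have : cr (0, γ / β) ((0 : ℝ), (0 : ℝ)) k = γ / β * k.1 := by unfold cr; ring
      rw [this]; positivity

lemma tri_aff (o u v a b c : ℝ × ℝ) :
    aff o u v '' tri a b c = tri (aff o u v a) (aff o u v b) (aff o u v c) := by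
  unfold tri
  rw [AffineMap.image_convexHull, image_insert_eq, image_insert_eq, image_singleton]

lemma MinIn.image {K : Set (ℝ × ℝ)} (hK : MinIn K) {o u v : ℝ × ℝ} (hd : |det2 u v| = 1)
    (hT : ∀ z ∈ T0, aff o u v z ∈ T0) : MinIn (aff o u v '' K) := by
  have hd0 : det2 u v ≠ 0 := by intro h; rw [h] at hd; simp at hd
  refine ⟨hK.body.aff hd0, ?_, fun a b c h => ?_⟩
  · rintro _ ⟨z, hz, rfl⟩; exact hT z (hK.sub hz)
  · obtain ⟨o', u', v', -, hdd, h1, h2⟩ := aff_inv o u v hd0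
    have := hK.min (aff o' u' v' a) (aff o' u' v' b) (aff o' u' v' c) (by
      rw [← tri_aff]
      intro k hk
      exact ⟨aff o u v k, h ⟨k, hk, rfl⟩, h1 k⟩)
    rw [cr_aff, abs_mul] at this
    have h3 : |det2 u' v'| = 1 := by
      have := congrArg abs hdd
      rwa [abs_mul, hd, mul_one, abs_one] at this
    rwa [h3, one_mul] at this

/-- The midpoints of all sides of a minimal circumscribed triangle belong to the body. -/
lemma MinIn.toMid {K : Set (ℝ × ℝ)} (hK : MinIn K) : Mid K := by
  refine ⟨hK.sub, ?_, ?_, hK.mid⟩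
  · have hd : |det2 ((-1 : ℝ), (1 : ℝ)) (-1, 0)| = 1 := by norm_num [det2]
    have hs : ∀ z, aff (1, 0) (-1, 1) (-1, 0) z = (1 - z.1 - z.2, z.1) := by
      intro z; ext <;> simp; ring
    obtain ⟨z, hz, he⟩ := (hK.image (o := (1, 0)) hd (fun z hz => by
      obtain ⟨h1, h2, h3⟩ := hz
      rw [hs]; refine ⟨?_, ?_, ?_⟩ <;> simp only <;> linarith)).mid
    rw [hs, Prod.mk.injEq] at he
    convert hz using 1
    ext <;> simp only <;> linarith [he.1, he.2]
  · have hd : |det2 ((0 : ℝ), (-1 : ℝ)) (1, -1)| = 1 := by norm_num [det2]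
    have hs : ∀ z, aff (0, 1) (0, -1) (1, -1) z = (z.2, 1 - z.1 - z.2) := by
      intro z; ext <;> simp; ring
    obtain ⟨z, hz, he⟩ := (hK.image (o := (0, 1)) hd (fun z hz => by
      obtain ⟨h1, h2, h3⟩ := hz
      rw [hs]; refine ⟨?_, ?_, ?_⟩ <;> simp only <;> linarith)).mid
    rw [hs, Prod.mk.injEq] at he
    convert hz using 1
    ext <;> simp only <;> linarith [he.1, he.2]

/-- Twice the area of a smallest triangle containing `K`. -/
def mT (K : Set (ℝ × ℝ)) : ℝ := sInf {d | ∃ a b c, K ⊆ tri a b c ∧ d = |cr a b c|}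

lemma mT_le {K : Set (ℝ × ℝ)} {a b c : ℝ × ℝ} (h : K ⊆ tri a b c) : mT K ≤ |cr a b c| :=
  csInf_le ⟨0, by rintro _ ⟨a, b, c, -, rfl⟩; exact abs_nonneg _⟩ ⟨a, b, c, h, rfl⟩

/-- Every convex body is an affine image of a body in minimal position in the standard triangle. -/
lemma exists_minIn {K : Set (ℝ × ℝ)} (hK : Body K) : ∃ (o u v : ℝ × ℝ) (K₀ : Set (ℝ × ℝ)),
    det2 u v ≠ 0 ∧ MinIn K₀ ∧ K = aff o u v '' K₀ ∧ mT K = |det2 u v| := by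
  obtain ⟨a, b, c, h0, hsub, hmin⟩ := exists_min_triangle hK
  have hd : det2 (b - a) (c - a) ≠ 0 := by rw [det2_eq_cr]; exact h0.ne'
  obtain ⟨K₀, hB, he, he'⟩ := hK.pull (o := a) hd
  refine ⟨a, b - a, c - a, K₀, hd, ⟨hB, ?_, ?_⟩, he, ?_⟩
  · intro k hk
    rw [he'] at hk
    have := hsub hk
    rwa [tri_eq_aff, (aff_inj _ _ _ hd).mem_set_image] at this
  · intro x y z h
    have h1 : K ⊆ tri (aff a (b - a) (c - a) x) (aff a (b - a) (c - a) y)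
        (aff a (b - a) (c - a) z) := by
      rw [he, ← tri_aff]; exact image_mono h
    have h2 := hmin _ _ _ h1
    rw [cr_aff, abs_mul, det2_eq_cr, abs_of_pos h0] at h2
    by_contra hlt
    push Not at hlt
    nlinarith
  · rw [det2_eq_cr, abs_of_pos h0]
    refine le_antisymm ((mT_le hsub).trans (abs_of_pos h0).le) ?_
    refine le_csInf ⟨_, a, b, c, hsub, rfl⟩ ?_
    rintro _ ⟨x, y, z, h, rfl⟩
    exact hmin _ _ _ h

/-! ### The area deficit -/

/-- The homothety with centre `z` and ratio `r`. -/
def hom (z : ℝ × ℝ) (r : ℝ) : (ℝ × ℝ) →ᵃ[ℝ] (ℝ × ℝ) := aff ((1 - r) • z) (r, 0) (0, r)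

lemma det_hom (r : ℝ) : det2 (r, 0) (0, r) = r ^ 2 := by simp [det2]; ring

lemma hom_apply (z : ℝ × ℝ) (r : ℝ) (w : ℝ × ℝ) :
    hom z r w = (r * w.1 + (1 - r) * z.1, r * w.2 + (1 - r) * z.2) := by
  ext <;> simp [hom] <;> ring

/-- A set close to a convex set containing a ball is contained in a slightly enlarged copy. -/
lemma subset_hom {P L : Set (ℝ × ℝ)} (hP : Convex ℝ P) {z : ℝ × ℝ} {ρ ε : ℝ} (hε : 0 < ε)
    (hb : Metric.closedBall z ρ ⊆ P) (h : ∀ w ∈ L, ∃ p ∈ P, dist w p ≤ ε * ρ) :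
    L ⊆ hom z (1 + ε) '' P := by
  intro w hw
  obtain ⟨p, hp, hd⟩ := h w hw
  have hq : z + ε⁻¹ • (w - p) ∈ P := by
    apply hb
    rw [Metric.mem_closedBall, dist_eq_norm, add_sub_cancel_left, norm_smul, Real.norm_eq_abs,
      abs_of_pos (inv_pos.2 hε), ← dist_eq_norm, inv_mul_le_iff₀ hε]
    exact hd
  refine ⟨_, hP hp hq (a := 1 / (1 + ε)) (b := ε / (1 + ε)) (by positivity) (by positivity)
    (by field_simp), ?_⟩
  rw [hom_apply]
  ext
  · simp; field_simp; ring
  · simp; field_simp; ring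

lemma mT_attained {K : Set (ℝ × ℝ)} (hK : Body K) :
    ∃ a b c, K ⊆ tri a b c ∧ mT K = |cr a b c| ∧ 0 < mT K := by
  obtain ⟨a, b, c, h0, hsub, hmin⟩ := exists_min_triangle hK
  have : mT K = |cr a b c| := by
    refine le_antisymm (mT_le hsub) (le_csInf ⟨_, a, b, c, hsub, rfl⟩ ?_)
    rintro _ ⟨x, y, z, h, rfl⟩
    rw [abs_of_pos h0]; exact hmin _ _ _ h
  exact ⟨a, b, c, hsub, this, by rw [this]; exact abs_pos.2 h0.ne'⟩

lemma mT_le_aff {K L : Set (ℝ × ℝ)} (hK : Body K) {o u v : ℝ × ℝ} (h : L ⊆ aff o u v '' K) :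
    mT L ≤ |det2 u v| * mT K := by
  obtain ⟨a, b, c, hs, he, -⟩ := mT_attained hK
  rw [he, ← abs_mul, ← cr_aff o]
  apply mT_le
  rw [← tri_aff]
  exact h.trans (image_mono hs)

lemma mT_le_hom {K L : Set (ℝ × ℝ)} (hK : Body K) {z : ℝ × ℝ} {r : ℝ} (h : L ⊆ hom z r '' K) :
    mT L ≤ r ^ 2 * mT K := by
  have := mT_le_aff hK h
  rwa [det_hom, abs_of_nonneg (sq_nonneg r)] at this

lemma mT_aff {K : Set (ℝ × ℝ)} (hK : Body K) {o u v : ℝ × ℝ} (hd : det2 u v ≠ 0) :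
    mT (aff o u v '' K) = |det2 u v| * mT K := by
  refine le_antisymm (mT_le_aff hK Subset.rfl) ?_
  obtain ⟨o', u', v', -, hdd, h1, -⟩ := aff_inv o u v hd
  have h : K ⊆ aff o' u' v' '' (aff o u v '' K) := by
    rw [← image_comp, show (aff o' u' v' ∘ aff o u v) = id from funext h1, image_id]
  have := mT_le_aff (hK.aff hd) h
  have h2 : |det2 u v| * |det2 u' v'| = 1 := by rw [← abs_mul, mul_comm, hdd, abs_one]
  calc |det2 u v| * mT K ≤ |det2 u v| * (|det2 u' v'| * mT (aff o u v '' K)) := by gcongr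
    _ = _ := by rw [← mul_assoc, h2, one_mul]

/-- Half of the relative deficit of the area of `K` in a smallest triangle containing it. -/
def eta (K : Set (ℝ × ℝ)) : ℝ := 1 / 2 - area K / mT K

lemma eta_aff {K : Set (ℝ × ℝ)} (hK : Body K) {o u v : ℝ × ℝ} (hd : det2 u v ≠ 0) :
    eta (aff o u v '' K) = eta K := by
  unfold eta
  rw [mT_aff hK hd, area_aff, mul_div_mul_left _ _ (abs_ne_zero.2 hd)]

/-- In minimal position the deficit is the missing area. -/
lemma eta_eq {K₀ : Set (ℝ × ℝ)} (hK : MinIn K₀) : eta K₀ = area (T0 \ K₀) := by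
  have h1 : mT K₀ = 1 := by
    refine le_antisymm ?_ ?_
    · have : K₀ ⊆ tri (0, 0) (1, 0) (0, 1) := by
        intro k hk
        have := hK.sub hk
        rw [T0_eq_hull] at this; exact this
      refine (mT_le this).trans (by simp [cr])
    · obtain ⟨a, b, c, hs, he, -⟩ := mT_attained hK.body
      rw [he]; exact hK.min a b c hs
  rw [eta, h1, div_one, area_diff hK.body hK.sub]

lemma exists_minIn_eta {K : Set (ℝ × ℝ)} (hK : Body K) : ∃ (o u v : ℝ × ℝ) (K₀ : Set (ℝ × ℝ)),
    det2 u v ≠ 0 ∧ MinIn K₀ ∧ K = aff o u v '' K₀ ∧ eta K = area (T0 \ K₀) := by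
  obtain ⟨o, u, v, K₀, hd, hm, he, -⟩ := exists_minIn hK
  exact ⟨o, u, v, K₀, hd, hm, he, by rw [he, eta_aff hm.body hd, eta_eq hm]⟩

/-- Stability of the quadratic functional for bodies close to a triangle. -/
lemma Th_le_of_eta {K : Set (ℝ × ℝ)} (hK : Body K) (h : eta K < 1 / 5476) :
    Th K ≤ 1 / 54 - eta K / 108 := by
  obtain ⟨o, u, v, K₀, hd, hm, he, he2⟩ := exists_minIn_eta hK
  rw [he2] at h ⊢
  rw [he, Th_aff hm.body hd]
  exact Th_near hm.body hm.toMid h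

lemma eta_T0 : eta T0 ≤ 0 := by
  have h1 : mT T0 ≤ 1 := by
    refine (mT_le (a := (0, 0)) (b := (1, 0)) (c := (0, 1)) ?_).trans (by simp [cr])
    rw [T0_eq_hull]; exact Subset.rfl
  obtain ⟨-, -, -, -, -, h0⟩ := mT_attained T0_body
  unfold eta
  rw [area_T0, sub_nonpos, le_div_iff₀ h0]
  linarith

/-- The area deficit is continuous along a shear family of convex bodies: the static part contains a
ball, so that nearby members of the family are contained in slightly enlarged copies of each other. -/
lemma eta_continuousOn {P : Set (ℝ × ℝ)} (hP : Body P)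
    (hint : (interior (P ∩ {z | z.2 ≤ 0})).Nonempty) {t₁ t₂ : ℝ}
    (hv : ∀ t, -t₁ ≤ t → t ≤ t₂ → Convex ℝ (sh 0 t '' P)) :
    ContinuousOn (fun t => eta (sh 0 t '' P)) (Icc (-t₁) t₂) := by
  obtain ⟨z, hz⟩ := hint
  obtain ⟨ρ, hρ, hb⟩ := Metric.nhds_basis_closedBall.mem_iff.1 (mem_interior_iff_mem_nhds.1 hz)
  have hball : ∀ t, Metric.closedBall z ρ ⊆ sh 0 t '' P := by
    intro t w hw
    obtain ⟨h1, h2⟩ := hb hw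
    refine ⟨w, h1, ?_⟩
    have : w.2 ≤ 0 := h2
    ext <;> simp [sh, this]
  obtain ⟨H, hH⟩ := hP.cpt.isBounded.exists_norm_le
  have hH0 : 0 ≤ H := (norm_nonneg _).trans (hH z (hb (Metric.mem_closedBall_self hρ.le)).1)
  have hbody : ∀ t ∈ Icc (-t₁) t₂, Body (sh 0 t '' P) := fun t ht => hP.sh (hv t ht.1 ht.2)
  have hcomp : ∀ t ∈ Icc (-t₁) t₂, ∀ t' ∈ Icc (-t₁) t₂, t ≠ t' →
      mT (sh 0 t '' P) ≤ (1 + |t - t'| * (H + 1) / ρ) ^ 2 * mT (sh 0 t' '' P) := by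
    intro t ht t' ht' hne
    have hpos : 0 < |t - t'| := abs_pos.2 (sub_ne_zero.2 hne)
    refine mT_le_hom (z := z) (hbody t' ht') (subset_hom (hv t' ht'.1 ht'.2) (by positivity)
      (hball t') ?_)
    rintro _ ⟨p, hp, rfl⟩
    refine ⟨sh 0 t' p, ⟨p, hp, rfl⟩, ?_⟩
    have hp2 : |p.2| ≤ H := (norm_snd_le p).trans (hH p hp)
    rw [div_mul_cancel₀ _ hρ.ne', Prod.dist_eq, Real.dist_eq, Real.dist_eq]
    simp only [sh, sub_zero, sub_self, abs_zero]
    refine max_le ?_ (by positivity)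
    have e : p.1 + t * max p.2 0 - (p.1 + t' * max p.2 0) = (t - t') * max p.2 0 := by ring
    rw [e, abs_mul]
    gcongr
    rw [abs_of_nonneg (le_max_right _ _)]
    refine max_le ?_ (by linarith)
    linarith [le_abs_self p.2]
  unfold eta
  refine continuousOn_const.sub (ContinuousOn.div ?_ ?_ ?_)
  · simp only [area_sh]; exact continuousOn_const
  · intro t ht
    have c1 : Tendsto (fun s => (1 + |s - t| * (H + 1) / ρ) ^ 2 * mT (sh 0 t '' P))
        (𝓝[Icc (-t₁) t₂] t) (𝓝 (mT (sh 0 t '' P))) := by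
      have : Continuous fun s => (1 + |s - t| * (H + 1) / ρ) ^ 2 * mT (sh 0 t '' P) := by fun_prop
      have h2 := this.tendsto t
      simp only [sub_self, abs_zero, zero_mul, zero_div, add_zero, one_pow, one_mul] at h2
      exact h2.mono_left nhdsWithin_le_nhds
    have c2 : Tendsto (fun s => mT (sh 0 t '' P) / (1 + |s - t| * (H + 1) / ρ) ^ 2)
        (𝓝[Icc (-t₁) t₂] t) (𝓝 (mT (sh 0 t '' P))) := by
      have : Continuous fun s => mT (sh 0 t '' P) / (1 + |s - t| * (H + 1) / ρ) ^ 2 := by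
        refine continuous_const.div (by fun_prop) fun s => ?_
        positivity
      have h2 := this.tendsto t
      simp only [sub_self, abs_zero, zero_mul, zero_div, add_zero, one_pow, div_one] at h2
      exact h2.mono_left nhdsWithin_le_nhds
    refine tendsto_of_tendsto_of_tendsto_of_le_of_le' c2 c1 ?_ ?_
    · filter_upwards [self_mem_nhdsWithin] with s hs
      rcases eq_or_ne s t with rfl | hne
      · simp
      · rw [div_le_iff₀ (by positivity), mul_comm]
        have := hcomp t ht s hs hne.symm
        rwa [abs_sub_comm] at this
    · filter_upwards [self_mem_nhdsWithin] with s hs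
      rcases eq_or_ne s t with rfl | hne
      · simp
      · exact hcomp s hs t ht hne
  · intro t ht
    obtain ⟨-, -, -, -, -, h⟩ := mT_attained (hbody t ht)
    exact h.ne'

/-- Polygons far from triangles: the maximum principle applied on the region where the deficit is
at least a fixed constant; a motion leaving the region is stopped at its boundary, where the
estimate for nearly full bodies applies. -/
lemma Th_polygon_far (S : Finset (ℝ × ℝ)) (hB : Body (convexHull ℝ (S : Set (ℝ × ℝ))))
    (hη : 1 / 6000 ≤ eta (convexHull ℝ (S : Set (ℝ × ℝ)))) :
    Th (convexHull ℝ (S : Set (ℝ × ℝ))) ≤ 1 / 54 - 1 / 6000 / 108 := by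
  induction hn : S.card using Nat.strong_induction_on generalizing S with
  | _ n ih =>
    rcases polygon_move hB with ⟨S', hcard, he⟩ | ⟨o, u, v, hd, he⟩ |
      ⟨o, u, v, P, t₁, t₂, S₁, S₂, hd, hP, hint, he, ht₁, ht₂, hv, hc1, hc2, h1, h2⟩
    · rw [← he] at hB hη ⊢
      exact ih _ (hn ▸ hcard) S' hB hη rfl
    · rw [he, eta_aff T0_body hd] at hη
      linarith [eta_T0]
    · rw [he, Th_aff hP hd]
      rw [he, eta_aff hP hd] at hη
      have hcont := eta_continuousOn hP hint hv
      have hP0 : sh 0 0 '' P = P := by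
        rw [show sh 0 0 = id from funext fun z => sh_zero 0 z, image_id]
      have hbd : ∀ t, -t₁ ≤ t → t ≤ t₂ → eta (sh 0 t '' P) = 1 / 6000 →
          Th (sh 0 t '' P) ≤ 1 / 54 - 1 / 6000 / 108 := by
        intro t ha hb h
        have := Th_le_of_eta (hP.sh (hv t ha hb)) (by rw [h]; norm_num)
        rwa [h] at this
      rcases hη.eq_or_lt with h0 | h0
      · have := hbd 0 (by linarith) ht₂.le (by rw [hP0]; exact h0.symm)
        rwa [hP0] at this
      have r2 : ∃ s, 0 < s ∧ s ≤ t₂ ∧ Th (sh 0 s '' P) ≤ 1 / 54 - 1 / 6000 / 108 := by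
        by_cases hh : 1 / 6000 ≤ eta (sh 0 t₂ '' P)
        · refine ⟨t₂, ht₂, le_rfl, ?_⟩
          have := hP.sh (hv t₂ (by linarith) le_rfl)
          rw [h2] at this hh ⊢
          exact ih _ (hn ▸ hc2) S₂ this hh rfl
        · push Not at hh
          have hmem : (1 / 6000 : ℝ) ∈ Icc (eta (sh 0 t₂ '' P)) (eta (sh 0 0 '' P)) :=
            ⟨hh.le, by rw [hP0]; exact h0.le⟩
          obtain ⟨s, ⟨hs0, hs1⟩, hs⟩ := intermediate_value_Icc' ht₂.le
            (hcont.mono (Icc_subset_Icc (by linarith) le_rfl)) hmem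
          have hs' : 0 < s := by
            rcases hs0.eq_or_lt with h | h
            · rw [← h] at hs; simp only [hP0] at hs; linarith
            · exact h
          exact ⟨s, hs', hs1, hbd s (by linarith) hs1 hs⟩
      have r1 : ∃ s, 0 < s ∧ s ≤ t₁ ∧ Th (sh 0 (-s) '' P) ≤ 1 / 54 - 1 / 6000 / 108 := by
        by_cases hh : 1 / 6000 ≤ eta (sh 0 (-t₁) '' P)
        · refine ⟨t₁, ht₁, le_rfl, ?_⟩
          have := hP.sh (hv (-t₁) le_rfl (by linarith))
          rw [h1] at this hh ⊢
          exact ih _ (hn ▸ hc1) S₁ this hh rfl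
        · push Not at hh
          have hmem : (1 / 6000 : ℝ) ∈ Icc (eta (sh 0 (-t₁) '' P)) (eta (sh 0 0 '' P)) :=
            ⟨hh.le, by rw [hP0]; exact h0.le⟩
          obtain ⟨s, ⟨hs0, hs1⟩, hs⟩ := intermediate_value_Icc (show -t₁ ≤ 0 by linarith)
            (hcont.mono (Icc_subset_Icc le_rfl ht₂.le)) hmem
          have hs' : s < 0 := by
            rcases hs1.eq_or_lt with h | h
            · rw [h] at hs; simp only [hP0] at hs; linarith
            · exact h
          refine ⟨-s, by linarith, by linarith, ?_⟩
          rw [neg_neg]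
          exact hbd s hs0 (by linarith) hs
      obtain ⟨s₁, p1, q1, g1⟩ := r1
      obtain ⟨s₂, p2, q2, g2⟩ := r2
      have g := shearConvex_moments.1 P 0 s₁ s₂ hP p1 p2 (hv _ (by linarith) (by linarith))
        (hv _ (by linarith) q2)
      unfold gap at g
      have hT : 0 < s₁ + s₂ := by linarith
      nlinarith

/-- Stability of the quadratic functional for polygons. -/
lemma Th_polygon (S : Finset (ℝ × ℝ)) (hB : Body (convexHull ℝ (S : Set (ℝ × ℝ)))) :
    Th (convexHull ℝ (S : Set (ℝ × ℝ))) ≤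
      1 / 54 - min (eta (convexHull ℝ (S : Set (ℝ × ℝ)))) (1 / 6000) / 108 := by
  rcases le_or_gt (1 / 6000) (eta (convexHull ℝ (S : Set (ℝ × ℝ)))) with h | h
  · rw [min_eq_right h]; exact Th_polygon_far S hB h
  · rw [min_eq_left h.le]; exact Th_le_of_eta hB (by linarith)

lemma Th_T0 : Th T0 = 1 / 54 := by
  have h1 : ∫ z in T0, (z.1 - 1 / 3) ^ 2 = 1 / 36 := by
    rw [integral_T0 (by fun_prop)]
    simp only [intervalIntegral.integral_const, smul_eq_mul, sub_zero]
    have hd : ∀ x : ℝ, HasDerivAt (fun x : ℝ => -x ^ 4 / 4 + 5 * x ^ 3 / 9 - 7 * x ^ 2 / 18 + x / 9)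
        ((1 - x) * (x - 1 / 3) ^ 2) x := by
      intro x
      have := (((((hasDerivAt_pow 4 x).neg).div_const 4).add
        (((hasDerivAt_pow 3 x).const_mul 5).div_const 9)).sub
        (((hasDerivAt_pow 2 x).const_mul 7).div_const 18)).add ((hasDerivAt_id' x).div_const 9)
      refine this.congr_deriv ?_
      simp; ring
    rw [intervalIntegral.integral_eq_sub_of_hasDerivAt (fun x _ => hd x)
      (Continuous.intervalIntegrable (by fun_prop) _ _)]
    norm_num
  have h2 : ∫ z in T0, (z.2 - 1 / 3) ^ 2 = 1 / 36 := by
    rw [integral_T0 (by fun_prop)]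
    have hi : ∀ x : ℝ, ∫ y in (0:ℝ)..(1 - x), (y - 1 / 3) ^ 2 = ((2 / 3 - x) ^ 3 + 1 / 27) / 3 := by
      intro x
      have hd : ∀ y : ℝ, HasDerivAt (fun y : ℝ => (y - 1 / 3) ^ 3 / 3) ((y - 1 / 3) ^ 2) y := by
        intro y
        refine ((((hasDerivAt_id' y).sub_const (1 / 3)).pow 3).div_const 3).congr_deriv ?_
        simp
      rw [intervalIntegral.integral_eq_sub_of_hasDerivAt (fun x _ => hd x)
        (Continuous.intervalIntegrable (by fun_prop) _ _)]
      ring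
    simp_rw [hi]
    have hd : ∀ x : ℝ, HasDerivAt (fun x : ℝ => (-(2 / 3 - x) ^ 4 / 4 + x / 27) / 3)
        (((2 / 3 - x) ^ 3 + 1 / 27) / 3) x := by
      intro x
      refine ((((((hasDerivAt_id' x).const_sub (2 / 3)).pow 4).neg.div_const 4).add
        ((hasDerivAt_id' x).div_const 27)).div_const 3).congr_deriv ?_
      simp
    rw [intervalIntegral.integral_eq_sub_of_hasDerivAt (fun x _ => hd x)
      (Continuous.intervalIntegrable (by fun_prop) _ _)]
    norm_num
  have h3 : ∫ z in T0, (z.1 - 1 / 3) * (z.2 - 1 / 3) = -1 / 72 := by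
    rw [integral_T0 (by fun_prop)]
    have hi : ∀ x : ℝ, ∫ y in (0:ℝ)..(1 - x), (x - 1 / 3) * (y - 1 / 3) =
        (x - 1 / 3) * ((2 / 3 - x) ^ 2 / 2 - 1 / 18) := by
      intro x
      have hd : ∀ y : ℝ, HasDerivAt (fun y : ℝ => (y - 1 / 3) ^ 2 / 2) (y - 1 / 3) y := by
        intro y
        refine ((((hasDerivAt_id' y).sub_const (1 / 3)).pow 2).div_const 2).congr_deriv ?_
        simp
      rw [intervalIntegral.integral_const_mul,
        intervalIntegral.integral_eq_sub_of_hasDerivAt (fun x _ => hd x)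
        (Continuous.intervalIntegrable (by fun_prop) _ _)]
      ring
    simp_rw [hi]
    have hd : ∀ x : ℝ, HasDerivAt
        (fun x : ℝ => x ^ 4 / 8 - 5 * x ^ 3 / 18 + 7 * x ^ 2 / 36 - x / 18)
        ((x - 1 / 3) * ((2 / 3 - x) ^ 2 / 2 - 1 / 18)) x := by
      intro x
      have := ((((hasDerivAt_pow 4 x).div_const 8).sub
        (((hasDerivAt_pow 3 x).const_mul 5).div_const 18)).add
        (((hasDerivAt_pow 2 x).const_mul 7).div_const 36)).sub ((hasDerivAt_id' x).div_const 18)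
      refine this.congr_deriv ?_
      simp; ring
    rw [intervalIntegral.integral_eq_sub_of_hasDerivAt (fun x _ => hd x)
      (Continuous.intervalIntegrable (by fun_prop) _ _)]
    norm_num
  unfold Th
  rw [W_sq T0_compact, cen_T0, area_T0]
  simp only [h1, h2, h3]
  norm_num

/-- The stability estimate for polygons. -/
lemma polygon_stability : ∃ c : ℝ, 0 < c ∧ c ≤ 1 ∧ ∀ p : ℝ, 1 ≤ p → ∀ S : Finset (ℝ × ℝ),
    Body (convexHull ℝ (S : Set (ℝ × ℝ))) →
    Es p (convexHull ℝ (S : Set (ℝ × ℝ))) ≤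
      Es p T0 - c ^ p * min (eta (convexHull ℝ (S : Set (ℝ × ℝ)))) (1 / 6000) ∧
    E3 p (convexHull ℝ (S : Set (ℝ × ℝ))) ≤
      E3 p T0 - c ^ p * min (eta (convexHull ℝ (S : Set (ℝ × ℝ)))) (1 / 6000) := by
  obtain ⟨-, c, hc0, hc1, h⟩ := shearConvex_moments
  refine ⟨c * (1 / 108), by positivity, by linarith, fun p hp S hB => ?_⟩
  obtain ⟨h1, h2⟩ := h p hp
  have hT := Th_polygon S hB
  have e1 := polygon_le_T0 (fun K hK o u v hd => by
    simp only [Es_aff p hK hd, Th_aff hK hd]) h1 S hB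
  have e2 := polygon_le_T0 (fun K hK o u v hd => by
    simp only [E3_aff p hK hd, Th_aff hK hd]) h2 S hB
  simp only [Th_T0] at e1 e2
  have hη0 : 0 ≤ eta (convexHull ℝ (S : Set (ℝ × ℝ))) := by
    obtain ⟨o, u, v, K₀, -, -, -, he⟩ := exists_minIn_eta hB
    rw [he]; exact measureReal_nonneg
  set m := min (eta (convexHull ℝ (S : Set (ℝ × ℝ)))) (1 / 6000) with hm
  have hm0 : 0 ≤ m := le_min hη0 (by norm_num)
  have hcp : 0 ≤ c ^ p := Real.rpow_nonneg hc0.le p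
  have hk : (c * (1 / 108)) ^ p ≤ c ^ p * (1 / 108) := by
    rw [Real.mul_rpow hc0.le (by norm_num)]
    refine mul_le_mul_of_nonneg_left ?_ hcp
    calc (1 / 108 : ℝ) ^ p ≤ (1 / 108 : ℝ) ^ (1 : ℝ) :=
          Real.rpow_le_rpow_of_exponent_ge (by norm_num) (by norm_num) hp
      _ = 1 / 108 := Real.rpow_one _
  have h3 : c ^ p * Th (convexHull ℝ (S : Set (ℝ × ℝ))) ≤ c ^ p * (1 / 54 - m / 108) := by gcongr
  have h4 : (c * (1 / 108)) ^ p * m ≤ c ^ p * (1 / 108) * m := by gcongr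
  constructor <;> linarith

/-! ### Passage from polygons to convex bodies -/

/-- Inner approximation of a convex body by polygons, up to homotheties with a fixed centre. -/
lemma exists_polygon {K : Set (ℝ × ℝ)} (hK : Body K) : ∃ z : ℝ × ℝ, ∀ ε : ℝ, 0 < ε →
    ∃ S : Finset (ℝ × ℝ), Body (convexHull ℝ (S : Set (ℝ × ℝ))) ∧
      convexHull ℝ (S : Set (ℝ × ℝ)) ⊆ K ∧
      K ⊆ hom z (1 + ε) '' convexHull ℝ (S : Set (ℝ × ℝ)) := by
  obtain ⟨a, ha, b, hb, c, hc, hne⟩ := hK.nondeg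
  obtain ⟨z, ρ, hρ, hball⟩ := (tri_body hne).exists_ball
  refine ⟨z, fun ε hε => ?_⟩
  obtain ⟨t, htK, htf, hcov⟩ := hK.cpt.finite_cover_balls (e := ε * ρ) (by positivity)
  set S : Finset (ℝ × ℝ) := htf.toFinset ∪ {a, b, c} with hS
  have hSc : (S : Set (ℝ × ℝ)) = t ∪ {a, b, c} := by simp [hS]
  have htri : tri a b c ⊆ convexHull ℝ (S : Set (ℝ × ℝ)) :=
    convexHull_mono (by rw [hSc]; exact subset_union_right)
  have hsub : convexHull ℝ (S : Set (ℝ × ℝ)) ⊆ K := by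
    refine convexHull_min ?_ hK.cvx
    rw [hSc]
    rintro w (hw | rfl | rfl | rfl)
    exacts [htK hw, ha, hb, hc]
  refine ⟨S, ⟨Set.Finite.isCompact_convexHull (𝕜 := ℝ) (Finset.finite_toSet S),
    convex_convexHull ℝ _, (tri_body hne).int.mono (interior_mono htri)⟩, hsub, ?_⟩
  refine subset_hom (convex_convexHull ℝ _) hε (hball.trans htri) fun w hw => ?_
  obtain ⟨p, hp, hd⟩ := mem_iUnion₂.1 (hcov hw)
  exact ⟨p, subset_convexHull _ _ (by rw [hSc]; exact Or.inl hp), (Metric.mem_ball.1 hd).le⟩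

lemma W_nonneg {φ : ℝ → ℝ} (h0 : ∀ s, 0 ≤ φ s) (K : Set (ℝ × ℝ)) (o : ℝ × ℝ) : 0 ≤ W φ K o :=
  integral_nonneg fun _ => integral_nonneg fun _ => h0 _

lemma W_mono {φ : ℝ → ℝ} (hφ : Continuous φ) (h0 : ∀ s, 0 ≤ φ s) {K L : Set (ℝ × ℝ)}
    (hK : IsCompact K) (hL : IsCompact L) (h : K ⊆ L) (o : ℝ × ℝ) : W φ K o ≤ W φ L o := by
  have hc : Continuous (Function.uncurry fun x y => φ (cr o x y)) := by
    simp only [Function.uncurry_def, cr]; fun_prop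
  calc W φ K o ≤ ∫ x in K, ∫ y in L, φ (cr o x y) := by
        refine setIntegral_mono_on (intOn_of_cont hK (cont_inner hK hc))
          (intOn_of_cont hK (cont_inner hL hc)) hK.measurableSet fun x _ => ?_
        exact setIntegral_mono_set (intOn_of_cont hL (cont_left hc x)) (ae_of_all _ fun _ => h0 _)
          (LE.le.eventuallyLE h)
    _ ≤ W φ L o := setIntegral_mono_set (intOn_of_cont hL (cont_inner hL hc))
        (ae_of_all _ fun _ => integral_nonneg fun _ => h0 _) (LE.le.eventuallyLE h)

lemma half_rpow_cont {p : ℝ} (hp : 1 ≤ p) : Continuous fun s : ℝ => (|s| / 2) ^ p :=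
  (continuous_abs.div_const 2).rpow_const fun _ => Or.inr (by linarith)

lemma half_rpow_nonneg (p s : ℝ) : 0 ≤ (|s| / 2) ^ p := Real.rpow_nonneg (by positivity) p

lemma Es_nonneg (p : ℝ) (K : Set (ℝ × ℝ)) : 0 ≤ Es p K :=
  mul_nonneg (Real.rpow_nonneg measureReal_nonneg _) (W_nonneg (half_rpow_nonneg p) _ _)

lemma E3_nonneg (p : ℝ) (K : Set (ℝ × ℝ)) : 0 ≤ E3 p K :=
  mul_nonneg (Real.rpow_nonneg measureReal_nonneg _)
    (integral_nonneg fun _ => W_nonneg (half_rpow_nonneg p) _ _)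

lemma area_hom (z : ℝ × ℝ) (r : ℝ) (K : Set (ℝ × ℝ)) : area (hom z r '' K) = r ^ 2 * area K := by
  rw [hom, area_aff, det_hom, abs_of_nonneg (sq_nonneg r)]

lemma rpow_ratio {A B q r : ℝ} (hA : 0 < A) (hB : 0 < B) (hq : 0 ≤ q) (h : B ≤ r ^ 2 * A) :
    A ^ (-q) ≤ (r ^ 2) ^ q * B ^ (-q) := by
  have hr : 0 < r ^ 2 := pos_of_mul_pos_left (hB.trans_le h) hA.le
  rw [Real.rpow_neg hA.le, Real.rpow_neg hB.le, ← div_eq_mul_inv, le_div_iff₀ (by positivity),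
    inv_mul_le_iff₀ (by positivity), ← Real.mul_rpow hA.le hr.le]
  exact Real.rpow_le_rpow hB.le (by linarith) hq

lemma hom_det_ne {r : ℝ} (hr : 0 < r) : det2 (r, 0) (0, r) ≠ 0 := by
  rw [det_hom]; positivity

lemma E3_le_of_hom {p : ℝ} (hp : 1 ≤ p) {K P : Set (ℝ × ℝ)} (hK : Body K) (hP : Body P)
    {z : ℝ × ℝ} {r : ℝ} (hr : 0 < r) (hPK : P ⊆ K) (h : K ⊆ hom z r '' P) :
    E3 p K ≤ (r ^ 2) ^ (3 + p) * E3 p P := by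
  have hL : Body (hom z r '' P) := hP.aff (hom_det_ne hr)
  have he : E3 p (hom z r '' P) = E3 p P := E3_aff p hP (hom_det_ne hr)
  rw [← he]
  have hA := hK.area_pos
  have hφ := half_rpow_cont hp
  have h0 := half_rpow_nonneg p
  have h1 : ∫ o in K, W (fun s => (|s| / 2) ^ p) K o ≤
      ∫ o in hom z r '' P, W (fun s => (|s| / 2) ^ p) (hom z r '' P) o := by
    refine (setIntegral_mono_on (intOn_of_cont hK.cpt (W_cont hφ hK.cpt))
      (intOn_of_cont hK.cpt (W_cont hφ hL.cpt)) hK.meas fun o _ =>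
      W_mono hφ h0 hK.cpt hL.cpt h o).trans ?_
    exact setIntegral_mono_set (intOn_of_cont hL.cpt (W_cont hφ hL.cpt))
      (ae_of_all _ fun _ => W_nonneg h0 _ _) (LE.le.eventuallyLE h)
  have h2 : area (hom z r '' P) ≤ r ^ 2 * area K := by
    rw [area_hom]; exact mul_le_mul_of_nonneg_left (area_mono hPK hK.cpt) (sq_nonneg r)
  have h3 := rpow_ratio (q := 3 + p) hA hL.area_pos (by linarith) h2
  have h4 : 0 ≤ ∫ o in hom z r '' P, W (fun s => (|s| / 2) ^ p) (hom z r '' P) o :=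
    integral_nonneg fun _ => W_nonneg h0 _ _
  unfold E3
  rw [show (-3 - p) = -(3 + p) by ring, ← mul_assoc]
  have h5 : 0 ≤ area K ^ (-(3 + p)) := Real.rpow_nonneg hA.le _
  calc _ ≤ area K ^ (-(3 + p)) * _ := mul_le_mul_of_nonneg_left h1 h5
    _ ≤ _ := mul_le_mul_of_nonneg_right h3 h4

lemma Es_le_of_hom {p : ℝ} (hp : 1 ≤ p) {K P : Set (ℝ × ℝ)} (hK : Body K) (hP : Body P)
    {z : ℝ × ℝ} {r : ℝ} (hr : 0 < r) (hPK : P ⊆ K) (h : K ⊆ hom z r '' P) :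
    area K ^ (-2 - p) * W (fun s => (|s| / 2) ^ p) K (hom z r (cen P)) ≤
      (r ^ 2) ^ (2 + p) * Es p P := by
  have hL : Body (hom z r '' P) := hP.aff (hom_det_ne hr)
  have he : Es p (hom z r '' P) = Es p P := Es_aff p hP (hom_det_ne hr)
  have hcen : cen (hom z r '' P) = hom z r (cen P) := cen_aff hP (hom_det_ne hr)
  rw [← he]
  have hA := hK.area_pos
  have hφ := half_rpow_cont hp
  have h0 := half_rpow_nonneg p
  have h1 := W_mono hφ h0 hK.cpt hL.cpt h (hom z r (cen P))
  have h2 : area (hom z r '' P) ≤ r ^ 2 * area K := by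
    rw [area_hom]; exact mul_le_mul_of_nonneg_left (area_mono hPK hK.cpt) (sq_nonneg r)
  have h3 := rpow_ratio (q := 2 + p) hA hL.area_pos (by linarith) h2
  have h4 := W_nonneg h0 (hom z r '' P) (hom z r (cen P))
  unfold Es
  rw [show (-2 - p) = -(2 + p) by ring, ← mul_assoc, hcen]
  have h5 : 0 ≤ area K ^ (-(2 + p)) := Real.rpow_nonneg hA.le _
  calc _ ≤ area K ^ (-(2 + p)) * _ := mul_le_mul_of_nonneg_left h1 h5
    _ ≤ _ := mul_le_mul_of_nonneg_right h3 h4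

/-- The centroids of a body and of a convex subset of nearly the same area are close. -/
lemma cen_near {K P : Set (ℝ × ℝ)} (hK : Body K) (hP : Body P) {M r : ℝ}
    (hM : ∀ w ∈ K, |w.1 - (cen K).1| ≤ M ∧ |w.2 - (cen K).2| ≤ M) (hPK : P ⊆ K)
    (hA : area K ≤ r ^ 2 * area P) :
    |(cen P).1 - (cen K).1| ≤ M * (r ^ 2 - 1) ∧ |(cen P).2 - (cen K).2| ≤ M * (r ^ 2 - 1) := by
  have hPp := hP.area_pos
  have hfin : volume (K \ P) < ⊤ :=
    lt_of_le_of_lt (measure_mono sdiff_subset) hK.cpt.measure_lt_top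
  have hM0 : 0 ≤ M := by
    obtain ⟨a, ha, -⟩ := hK.nondeg
    exact (abs_nonneg _).trans (hM a ha).1
  have hdiff : volume.real (K \ P) = area K - area P :=
    measureReal_sdiff hPK hP.meas hK.cpt.measure_lt_top.ne
  have gen : ∀ l₁ l₂ : ℝ, (∀ w ∈ K, |l₁ * (w.1 - (cen K).1) + l₂ * (w.2 - (cen K).2)| ≤ M) →
      |l₁ * ((cen P).1 - (cen K).1) + l₂ * ((cen P).2 - (cen K).2)| ≤ M * (r ^ 2 - 1) := by
    intro l₁ l₂ hb
    have hi : IntegrableOn (fun w : ℝ × ℝ => -(l₁ * (cen K).1 + l₂ * (cen K).2) + l₁ * w.1 +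
      l₂ * w.2) K := hK.intOn (by fun_prop)
    have h1 := integral_inter_add_sdiff hP.meas hi
    rw [inter_eq_right.2 hPK, hK.integral_affine, hP.integral_affine] at h1
    have h2 : ‖∫ w in K \ P, (-(l₁ * (cen K).1 + l₂ * (cen K).2) + l₁ * w.1 + l₂ * w.2)‖ ≤
        M * volume.real (K \ P) := by
      refine norm_setIntegral_le_of_norm_le_const hfin fun w hw => ?_
      rw [Real.norm_eq_abs]
      refine le_trans (le_of_eq ?_) (hb w hw.1)
      congr 1; ring
    rw [Real.norm_eq_abs, hdiff] at h2
    have h3 : |area P * (l₁ * ((cen P).1 - (cen K).1) + l₂ * ((cen P).2 - (cen K).2))| ≤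
        M * (area K - area P) := by
      refine le_trans (le_of_eq ?_) h2
      rw [← abs_neg]
      congr 1; linarith
    rw [abs_mul, abs_of_pos hPp] at h3
    have h4 : M * (area K - area P) ≤ area P * (M * (r ^ 2 - 1)) := by nlinarith
    exact le_of_mul_le_mul_left (h3.trans h4) hPp
  constructor
  · have := gen 1 0 fun w hw => by simpa using (hM w hw).1
    simpa using this
  · have := gen 0 1 fun w hw => by simpa using (hM w hw).2
    simpa using this

/-- The stability estimate in terms of the area deficit in a smallest circumscribed triangle. -/
theorem body_stability : ∃ c : ℝ, 0 < c ∧ c ≤ 1 ∧ ∀ p : ℝ, 1 ≤ p → ∀ K, Body K →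
    Es p K ≤ Es p T0 - c ^ p * min (eta K) (1 / 6000) ∧
    E3 p K ≤ E3 p T0 - c ^ p * min (eta K) (1 / 6000) := by
  obtain ⟨c, hc0, hc1, h⟩ := polygon_stability
  refine ⟨c, hc0, hc1, fun p hp K hK => ?_⟩
  -- The estimate for an inscribed polygon `P ε` with `K ⊆ hom z (1 + ε) '' P ε` gives one for `K` with
  -- factors depending continuously on `ε`.
  obtain ⟨z, hz⟩ := exists_polygon hK
  choose! S hB hsub hhom using hz
  have hcp : 0 ≤ c ^ p := Real.rpow_nonneg hc0.le p
  obtain ⟨-, -, -, -, -, hm0⟩ := mT_attained hK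
  have hA := hK.area_pos
  set P : ℝ → Set (ℝ × ℝ) := fun ε => convexHull ℝ (S ε : Set (ℝ × ℝ)) with hPd
  have hη : ∀ ε, 0 < ε → eta K - ((1 + ε) ^ 2 - 1) * (area K / mT K) ≤ eta (P ε) := by
    intro ε hε
    obtain ⟨-, -, -, -, -, hm1⟩ := mT_attained (hB ε hε)
    have h1 : mT K ≤ (1 + ε) ^ 2 * mT (P ε) := mT_le_hom (hB ε hε) (hhom ε hε)
    have h2 : area (P ε) ≤ area K := area_mono (hsub ε hε) hK.cpt
    unfold eta
    have h3 : area (P ε) / mT (P ε) ≤ (1 + ε) ^ 2 * (area K / mT K) := by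
      rw [← mul_div_assoc, div_le_div_iff₀ hm1 hm0]
      have : 0 ≤ area (P ε) := measureReal_nonneg
      calc area (P ε) * mT K ≤ area K * ((1 + ε) ^ 2 * mT (P ε)) := by gcongr
        _ = _ := by ring
    linarith
  have hmin : ∀ ε, 0 < ε → c ^ p * min (eta K - ((1 + ε) ^ 2 - 1) * (area K / mT K)) (1 / 6000) ≤
      c ^ p * min (eta (P ε)) (1 / 6000) := fun ε hε =>
    mul_le_mul_of_nonneg_left (min_le_min_right _ (hη ε hε)) hcp
  have hlim : ∀ E q : ℝ, Tendsto (fun ε : ℝ => ((1 + ε) ^ 2) ^ q *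
      (E - c ^ p * min (eta K - ((1 + ε) ^ 2 - 1) * (area K / mT K)) (1 / 6000)))
      (𝓝[>] 0) (𝓝 (E - c ^ p * min (eta K) (1 / 6000))) := by
    intro E q
    have h1 : ContinuousAt (fun ε : ℝ => ((1 + ε) ^ 2) ^ q *
      (E - c ^ p * min (eta K - ((1 + ε) ^ 2 - 1) * (area K / mT K)) (1 / 6000))) 0 := by
      refine ContinuousAt.mul (ContinuousAt.rpow_const (by fun_prop) (Or.inl (by norm_num))) ?_
      fun_prop
    have h2 := h1.tendsto
    simp only [add_zero, one_pow, Real.one_rpow, one_mul, sub_self, zero_mul, sub_zero] at h2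
    exact h2.mono_left nhdsWithin_le_nhds
  constructor
  · obtain ⟨M, hM0, hM⟩ : ∃ M : ℝ, 0 ≤ M ∧
        ∀ w ∈ K, |w.1 - (cen K).1| ≤ M ∧ |w.2 - (cen K).2| ≤ M := by
      obtain ⟨R, hR⟩ := hK.cpt.isBounded.exists_norm_le
      refine ⟨max 0 (R + ‖cen K‖), le_max_left _ _, fun w hw => ?_⟩
      have h1 : ‖w - cen K‖ ≤ max 0 (R + ‖cen K‖) :=
        (norm_sub_le _ _).trans ((add_le_add_left (hR w hw) _).trans (le_max_right _ _))
      exact ⟨(norm_fst_le (w - cen K)).trans h1, (norm_snd_le (w - cen K)).trans h1⟩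
    have hnear : ∀ ε, 0 < ε → |(cen (P ε)).1 - (cen K).1| ≤ M * ((1 + ε) ^ 2 - 1) ∧
        |(cen (P ε)).2 - (cen K).2| ≤ M * ((1 + ε) ^ 2 - 1) := by
      intro ε hε
      refine cen_near hK (hB ε hε) hM (hsub ε hε) ?_
      rw [← area_hom z]
      exact area_mono (hhom ε hε) ((hB ε hε).aff (hom_det_ne (by linarith))).cpt
    have hconv : ∀ f : ℝ → ℝ, ∀ g : ℝ, (∀ ε, 0 < ε → |f ε - g| ≤ M * ((1 + ε) ^ 2 - 1)) →
        Tendsto f (𝓝[>] 0) (𝓝 g) := by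
      intro f g hf
      rw [tendsto_iff_dist_tendsto_zero]
      have h1 : Tendsto (fun ε : ℝ => M * ((1 + ε) ^ 2 - 1)) (𝓝[>] 0) (𝓝 0) := by
        have : Continuous fun ε : ℝ => M * ((1 + ε) ^ 2 - 1) := by fun_prop
        have h2 := this.tendsto 0
        simp only [add_zero, one_pow, sub_self, mul_zero] at h2
        exact h2.mono_left nhdsWithin_le_nhds
      refine squeeze_zero' (Eventually.of_forall fun _ => dist_nonneg) ?_ h1
      filter_upwards [self_mem_nhdsWithin] with ε hε
      rw [Real.dist_eq]; exact hf ε hε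
    have t1 := hconv (fun ε => (cen (P ε)).1) _ fun ε hε => (hnear ε hε).1
    have t2 := hconv (fun ε => (cen (P ε)).2) _ fun ε hε => (hnear ε hε).2
    have te : Tendsto (fun ε : ℝ => ε) (𝓝[>] 0) (𝓝 0) := tendsto_id.mono_left nhdsWithin_le_nhds
    have thom : Tendsto (fun ε => hom z (1 + ε) (cen (P ε))) (𝓝[>] 0) (𝓝 (cen K)) := by
      simp_rw [hom_apply]
      have u1 := ((te.const_add 1).mul t1).add ((((te.const_add 1).const_sub 1)).mul_const z.1)
      have u2 := ((te.const_add 1).mul t2).add ((((te.const_add 1).const_sub 1)).mul_const z.2)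
      have := u1.prodMk_nhds u2
      simpa using this
    have hW := (((W_cont (half_rpow_cont hp) hK.cpt).tendsto (cen K)).comp thom).const_mul
      (area K ^ (-2 - p))
    refine le_of_tendsto_of_tendsto hW (hlim (Es p T0) (2 + p)) ?_
    filter_upwards [self_mem_nhdsWithin] with ε hε
    have hε : 0 < ε := hε
    refine (Es_le_of_hom hp hK (hB ε hε) (by linarith) (hsub ε hε) (hhom ε hε)).trans ?_
    refine mul_le_mul_of_nonneg_left ?_ (Real.rpow_nonneg (sq_nonneg _) _)
    linarith [(h p hp (S ε) (hB ε hε)).1, hmin ε hε]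
  · refine ge_of_tendsto (hlim (E3 p T0) (3 + p)) ?_
    filter_upwards [self_mem_nhdsWithin] with ε hε
    have hε : 0 < ε := hε
    refine (E3_le_of_hom hp hK (hB ε hε) (by linarith) (hsub ε hε) (hhom ε hε)).trans ?_
    refine mul_le_mul_of_nonneg_left ?_ (Real.rpow_nonneg (sq_nonneg _) _)
    linarith [(h p hp (S ε) (hB ε hε)).2, hmin ε hε]

/-! ### The distance to a triangle -/

/-- The admissible ratios in the definition of the Banach–Mazur distance between `K` and a
triangle: a triangle lies between `K` and a homothetic image of `K`. -/
def bm (K : Set (ℝ × ℝ)) : Set ℝ := {r | 1 ≤ r ∧ ∃ o u v x : ℝ × ℝ, det2 u v ≠ 0 ∧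
  K ⊆ aff o u v '' T0 ∧ aff o u v '' T0 ⊆ hom x r '' K}

lemma bm_bdd (K : Set (ℝ × ℝ)) : BddBelow (bm K) := ⟨1, fun _ h => h.1⟩

lemma aff_hom (o u v z w : ℝ × ℝ) (r : ℝ) :
    aff o u v (hom z r w) = hom (aff o u v z) r (aff o u v w) := by
  rw [hom_apply, hom_apply]
  ext
  · simp; ring
  · simp; ring

/-- If `K₀` contains the homothetic copy of ratio `s` of the standard triangle, with the same centroid,
then its ratio to the triangle is at most `1 / s`. -/
lemma mem_bm_of_vertices {K₀ : Set (ℝ × ℝ)} (hK : MinIn K₀) {o u v : ℝ × ℝ} (hd : det2 u v ≠ 0)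
    {s : ℝ} (hs0 : 0 < s) (hs1 : s ≤ 1) (h1 : ((1 - s) / 3, (1 - s) / 3) ∈ K₀)
    (h2 : ((1 - s) / 3 + s, (1 - s) / 3) ∈ K₀) (h3 : ((1 - s) / 3, (1 - s) / 3 + s) ∈ K₀) :
    1 / s ∈ bm (aff o u v '' K₀) := by
  refine ⟨by rw [le_div_iff₀ hs0]; linarith, o, u, v, aff o u v (1 / 3, 1 / 3), hd,
    image_mono hK.sub, ?_⟩
  rintro _ ⟨z, ⟨hz1, hz2, hz3⟩, rfl⟩
  have hm : (s * z.1 + (1 - s) / 3, s * z.2 + (1 - s) / 3) ∈ K₀ := by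
    refine comb3 hK.body.cvx h1 h2 h3 hz1 hz2 hz3 ?_ ?_ <;> simp only <;> ring
  refine ⟨_, ⟨_, hm, rfl⟩, ?_⟩
  rw [← aff_hom, hom_apply]
  congr 1
  ext
  · simp only; field_simp; ring
  · simp only; field_simp; ring

/-- A body with small area deficit contains the vertices of a slightly smaller triangle. -/
lemma vertices_mem {K : Set (ℝ × ℝ)} (hK : Body K) (hM : Mid K) {τ : ℝ} (h0 : 0 ≤ τ)
    (h1 : τ ≤ 1 / 2) (h : area (T0 \ K) < τ ^ 2) :
    (τ, τ) ∈ K ∧ (1 - 2 * τ, τ) ∈ K ∧ (τ, 1 - 2 * τ) ∈ K := by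
  have main : ∀ K, Body K → Mid K → area (T0 \ K) < τ ^ 2 → (τ, τ) ∈ K := by
    intro K hK hM h
    by_contra hn
    have := hM.area_ge hK hn h0 h0 h1 h1
    simp only at this
    nlinarith
  refine ⟨main K hK hM h, ?_, ?_⟩
  · have hd : |det2 ((-1 : ℝ), (1 : ℝ)) (-1, 0)| = 1 := by norm_num [det2]
    have hs : ∀ z, aff (1, 0) (-1, 1) (-1, 0) z = (1 - z.1 - z.2, z.1) := by
      intro z; ext <;> simp; ring
    obtain ⟨hK', hM', hA'⟩ := hM.pull (o := (1, 0)) hK hd (fun z => by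
      rw [hs]; simp only [mem_T0]; constructor <;> rintro ⟨h1, h2, h3⟩ <;>
      refine ⟨?_, ?_, ?_⟩ <;> linarith)
      (by rw [hs]; convert hM.m₃ using 2; norm_num) (by rw [hs]; convert hM.m₁ using 2; norm_num)
      (by rw [hs]; convert hM.m₂ using 2; norm_num)
    have := main _ hK' hM' (hA' ▸ h)
    rw [mem_preimage, hs] at this
    convert this using 2; simp only; ring
  · have hd : |det2 ((0 : ℝ), (-1 : ℝ)) (1, -1)| = 1 := by norm_num [det2]
    have hs : ∀ z, aff (0, 1) (0, -1) (1, -1) z = (z.2, 1 - z.1 - z.2) := by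
      intro z; ext <;> simp; ring
    obtain ⟨hK', hM', hA'⟩ := hM.pull (o := (0, 1)) hK hd (fun z => by
      rw [hs]; simp only [mem_T0]; constructor <;> rintro ⟨h1, h2, h3⟩ <;>
      refine ⟨?_, ?_, ?_⟩ <;> linarith)
      (by rw [hs]; convert hM.m₂ using 2; norm_num) (by rw [hs]; convert hM.m₃ using 2; norm_num)
      (by rw [hs]; convert hM.m₁ using 2; norm_num)
    have := main _ hK' hM' (hA' ▸ h)
    rw [mem_preimage, hs] at this
    convert this using 2; simp only; ring

lemma eta_nonneg {K : Set (ℝ × ℝ)} (hK : Body K) : 0 ≤ eta K := by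
  obtain ⟨o, u, v, K₀, -, -, -, he⟩ := exists_minIn_eta hK
  rw [he]; exact measureReal_nonneg

/-- The triangle of the side midpoints, reduced by the factor `1 / 2` and reflected, is a homothetic copy
of ratio `1 / 4` of the circumscribed triangle. -/
lemma four_mem_bm {K : Set (ℝ × ℝ)} (hK : Body K) : (4 : ℝ) ∈ bm K := by
  obtain ⟨o, u, v, K₀, hd, hm, he, -⟩ := exists_minIn_eta hK
  have hM := hm.toMid
  have hc := hm.body.cvx
  rw [he]
  have := mem_bm_of_vertices hm hd (o := o) (s := 1 / 4) (by norm_num) (by norm_num) ?_ ?_ ?_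
  · norm_num at this; exact this
  · refine comb3 hc hM.m₃ hM.m₁ hM.m₂ (x := 1 / 2) (y := 1 / 2) ?_ ?_ ?_ ?_ ?_ <;> norm_num
  · refine comb3 hc hM.m₃ hM.m₁ hM.m₂ (x := 1 / 2) (y := 0) ?_ ?_ ?_ ?_ ?_ <;> norm_num
  · refine comb3 hc hM.m₃ hM.m₁ hM.m₂ (x := 0) (y := 1 / 2) ?_ ?_ ?_ ?_ ?_ <;> norm_num

lemma one_le_sInf_bm {K : Set (ℝ × ℝ)} (hK : Body K) : 1 ≤ sInf (bm K) :=
  le_csInf ⟨4, four_mem_bm hK⟩ fun _ h => h.1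

/-- A small area deficit forces a small distance to a triangle. -/
lemma sInf_bm_le {K : Set (ℝ × ℝ)} (hK : Body K) {τ : ℝ} (hτ0 : 0 < τ) (hτ1 : τ ≤ 1 / 6)
    (h : eta K < τ ^ 2) : sInf (bm K) ≤ 1 + 6 * τ := by
  obtain ⟨o, u, v, K₀, hd, hm, he, he2⟩ := exists_minIn_eta hK
  rw [he2] at h
  obtain ⟨h1, h2, h3⟩ := vertices_mem hm.body hm.toMid hτ0.le (by linarith) h
  have := mem_bm_of_vertices hm hd (o := o) (s := 1 - 3 * τ) (by linarith) (by linarith)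
    (by convert h1 using 2 <;> ring) (by convert h2 using 2 <;> ring)
    (by convert h3 using 2 <;> ring)
  rw [← he] at this
  refine (csInf_le (bm_bdd K) this).trans ?_
  rw [div_le_iff₀ (by linarith)]
  nlinarith

/-- The area deficit controls the square of the distance to a triangle. -/
lemma sq_le_eta {K : Set (ℝ × ℝ)} (hK : Body K) {δ : ℝ} (hδ : 0 ≤ δ) (h : sInf (bm K) = 1 + δ) :
    δ ^ 2 / 54000 ≤ min (eta K) (1 / 6000) := by
  have h3 : δ ≤ 3 := by
    have := csInf_le (bm_bdd K) (four_mem_bm hK)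
    linarith
  refine le_min ?_ (by nlinarith)
  rcases le_or_gt (1 / 6000) (eta K) with h1 | h1
  · nlinarith
  have h0 := eta_nonneg hK
  by_contra hlt
  push Not at hlt
  have hδ0 : 0 < δ := by
    rcases hδ.eq_or_lt with h2 | h2
    · rw [← h2] at hlt; norm_num at hlt; linarith
    · exact h2
  have hτ := sInf_bm_le hK (τ := δ / 200) (by linarith) (by linarith) (by nlinarith)
  linarith

lemma W_T0_le {p : ℝ} (hp : 1 ≤ p) {o : ℝ × ℝ} (ho : o ∈ T0) :
    W (fun s => (|s| / 2) ^ p) T0 o ≤ (1 / 2) ^ p / 4 := by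
  have hb : ∀ x ∈ T0, ∀ y ∈ T0, (|cr o x y| / 2) ^ p ≤ (1 / 2 : ℝ) ^ p := by
    intro x hx y hy
    refine Real.rpow_le_rpow (by positivity) ?_ (by linarith)
    rw [← area_tri, ← area_T0]
    exact area_mono (tri_subset T0_body.cvx ho hx hy) T0_compact
  have hc : Continuous (Function.uncurry fun x y => (|cr o x y| / 2) ^ p) :=
    (half_rpow_cont hp).comp (cr_cont o)
  have := double_mono T0_compact hc
    (by simp only [Function.uncurry_def]; exact continuous_const :
      Continuous (Function.uncurry fun _ _ : ℝ × ℝ => (1 / 2 : ℝ) ^ p)) hb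
  refine this.trans (le_of_eq ?_)
  have ha : volume.real T0 = 1 / 2 := area_T0
  simp only [integral_const, smul_eq_mul, measureReal_restrict_apply_univ, ha]
  ring

/-- The normalised moments of the triangle are at most `1`, so that additive and multiplicative errors
are comparable. -/
lemma Es_T0_le {p : ℝ} (hp : 1 ≤ p) : Es p T0 ≤ 1 ∧ E3 p T0 ≤ 1 := by
  have hA : (0 : ℝ) < 1 / 2 := by norm_num
  have hφ := half_rpow_cont hp
  have hW : ∀ o ∈ T0, W (fun s => (|s| / 2) ^ p) T0 o ≤ (1 / 2) ^ p / 4 := fun o ho =>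
    W_T0_le hp ho
  have hc : cen T0 ∈ T0 := by rw [cen_T0]; refine ⟨?_, ?_, ?_⟩ <;> norm_num
  constructor
  · unfold Es
    rw [area_T0]
    calc (1 / 2 : ℝ) ^ (-2 - p) * _ ≤ (1 / 2 : ℝ) ^ (-2 - p) * ((1 / 2) ^ p / 4) :=
          mul_le_mul_of_nonneg_left (hW _ hc) (by positivity)
      _ = 1 := by
          rw [mul_div_assoc', ← Real.rpow_add hA, show -2 - p + p = ((-2 : ℤ) : ℝ) by push_cast; ring,
            Real.rpow_intCast]
          norm_num
  · unfold E3
    rw [area_T0]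
    have : ∫ o in T0, W (fun s => (|s| / 2) ^ p) T0 o ≤ ∫ _ in T0, (1 / 2 : ℝ) ^ p / 4 :=
      setIntegral_mono_on (T0_body.intOn (W_cont hφ T0_compact)) (T0_body.intOn continuous_const)
        T0_body.meas hW
    have ha : volume.real T0 = 1 / 2 := area_T0
    rw [setIntegral_const, ha, smul_eq_mul] at this
    calc (1 / 2 : ℝ) ^ (-3 - p) * _ ≤ (1 / 2 : ℝ) ^ (-3 - p) * (1 / 2 * ((1 / 2) ^ p / 4)) :=
          mul_le_mul_of_nonneg_left this (by positivity)
      _ = (1 / 2 : ℝ) ^ (-3 - p) * (1 / 2) ^ p / 8 := by ring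
      _ = 1 := by
          rw [← Real.rpow_add hA, show -3 - p + p = ((-3 : ℤ) : ℝ) by push_cast; ring,
            Real.rpow_intCast]
          norm_num

/-- The stability estimate in the plane, with an additive error. -/
lemma distance_stability : ∃ c : ℝ, 0 < c ∧ c ≤ 1 ∧ ∀ K, Body K → ∀ δ : ℝ, 0 ≤ δ →
    sInf (bm K) = 1 + δ → ∀ p : ℝ, 1 ≤ p →
    Es p K ≤ Es p T0 - c ^ p * δ ^ 2 ∧ E3 p K ≤ E3 p T0 - c ^ p * δ ^ 2 := by
  obtain ⟨c, hc0, hc1, h⟩ := body_stability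
  refine ⟨c * (1 / 54000), by positivity, by linarith, fun K hK δ hδ hd p hp => ?_⟩
  obtain ⟨h1, h2⟩ := h p hp K hK
  have h3 := sq_le_eta hK hδ hd
  have hcp : 0 ≤ c ^ p := Real.rpow_nonneg hc0.le p
  have hk : (c * (1 / 54000)) ^ p ≤ c ^ p * (1 / 54000) := by
    rw [Real.mul_rpow hc0.le (by norm_num)]
    refine mul_le_mul_of_nonneg_left ?_ hcp
    calc (1 / 54000 : ℝ) ^ p ≤ (1 / 54000 : ℝ) ^ (1 : ℝ) :=
          Real.rpow_le_rpow_of_exponent_ge (by norm_num) (by norm_num) hp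
      _ = 1 / 54000 := Real.rpow_one _
  have h4 : (c * (1 / 54000)) ^ p * δ ^ 2 ≤ c ^ p * min (eta K) (1 / 6000) := by
    calc _ ≤ c ^ p * (1 / 54000) * δ ^ 2 := by gcongr
      _ = c ^ p * (δ ^ 2 / 54000) := by ring
      _ ≤ _ := by gcongr
  constructor <;> linarith

/-- The stability estimate in coordinates. -/
theorem plane_stability : ∃ c : ℝ, 0 < c ∧ ∀ K, Body K → ∀ δ : ℝ, 0 < δ →
    sInf (bm K) = 1 + δ → ∀ p : ℝ, 1 ≤ p →
    Es p K ≤ (1 - c ^ p * δ ^ 2) * Es p T0 ∧ E3 p K ≤ (1 - c ^ p * δ ^ 2) * E3 p T0 := by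
  obtain ⟨c, hc0, -, h⟩ := distance_stability
  refine ⟨c, hc0, fun K hK δ hδ hd p hp => ?_⟩
  obtain ⟨h1, h2⟩ := h K hK δ hδ.le hd p hp
  obtain ⟨g1, g2⟩ := Es_T0_le hp
  have h0 : 0 ≤ c ^ p * δ ^ 2 := mul_nonneg (Real.rpow_nonneg hc0.le p) (sq_nonneg δ)
  constructor <;> nlinarith

/-! ### Truncated triangles -/

/-- The standard triangle with a corner of size `ε` cut off. -/
def trunc (ε : ℝ) : Set (ℝ × ℝ) := {z | z ∈ T0 ∧ z.2 ≤ 1 - ε}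

lemma trunc_sub (ε : ℝ) : trunc ε ⊆ T0 := fun _ h => h.1

lemma trunc_anti {s t : ℝ} (h : s ≤ t) : trunc t ⊆ trunc s :=
  fun _ hz => ⟨hz.1, hz.2.trans (by linarith)⟩

lemma trunc_zero : trunc 0 = T0 := by
  refine Subset.antisymm (trunc_sub 0) fun z hz => ⟨hz, ?_⟩
  obtain ⟨h1, h2, h3⟩ := hz
  linarith

lemma trunc_body {ε : ℝ} (h : ε ≤ 1 / 2) : Body (trunc ε) := by
  refine ⟨T0_compact.inter_right (isClosed_le continuous_snd continuous_const), ?_, ?_⟩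
  · rintro x ⟨hx, hx'⟩ y ⟨hy, hy'⟩ a b ha hb hab
    refine ⟨T0_body.cvx hx hy ha hb hab, ?_⟩
    simp only [Prod.snd_add, Prod.smul_snd, smul_eq_mul]
    have : b = 1 - a := by linarith
    subst this
    nlinarith
  · refine ⟨(1 / 4, 1 / 4), ?_⟩
    rw [mem_interior]
    refine ⟨{z | 0 < z.1 ∧ 0 < z.2 ∧ z.1 + z.2 < 1 ∧ z.2 < 1 / 2}, ?_, ?_, ?_⟩
    · rintro z ⟨h1, h2, h3, h4⟩; exact ⟨⟨h1.le, h2.le, h3.le⟩, by linarith⟩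
    · exact (isOpen_lt continuous_const continuous_fst).inter
        ((isOpen_lt continuous_const continuous_snd).inter
          ((isOpen_lt (continuous_fst.add continuous_snd) continuous_const).inter
            (isOpen_lt continuous_snd continuous_const)))
    · norm_num

/-- The area of an inscribed triangle is half of its height times the horizontal width at its middle
vertex, which is at most `1 - b.2`. -/
lemma abs_cr_trunc_of_sorted {ε : ℝ} {a b c : ℝ × ℝ} (ha : a ∈ trunc ε) (hb : b ∈ trunc ε)
    (hc : c ∈ trunc ε) (h1 : a.2 ≤ b.2) (h2 : b.2 ≤ c.2) : |cr a b c| ≤ 1 - ε := by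
  obtain ⟨⟨a1, a2, a3⟩, -⟩ := ha
  obtain ⟨⟨b1, b2, b3⟩, -⟩ := hb
  obtain ⟨⟨c1, c2, c3⟩, c4⟩ := hc
  have e : cr a b c = b.1 * (c.2 - a.2) - (a.1 * (c.2 - b.2) + c.1 * (b.2 - a.2)) := by
    unfold cr; ring
  have l1 : 0 ≤ a.1 * (c.2 - b.2) + c.1 * (b.2 - a.2) :=
    add_nonneg (mul_nonneg a1 (by linarith)) (mul_nonneg c1 (by linarith))
  have l2 : a.1 * (c.2 - b.2) + c.1 * (b.2 - a.2) ≤ (c.2 - a.2) * (1 - b.2) := by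
    have := mul_le_mul_of_nonneg_right (show a.1 ≤ 1 - a.2 by linarith) (sub_nonneg.2 h2)
    have := mul_le_mul_of_nonneg_right (show c.1 ≤ 1 - c.2 by linarith) (sub_nonneg.2 h1)
    linarith
  have l3 : 0 ≤ b.1 * (c.2 - a.2) := mul_nonneg b1 (by linarith)
  have l4 : b.1 * (c.2 - a.2) ≤ (1 - b.2) * (c.2 - a.2) :=
    mul_le_mul_of_nonneg_right (by linarith) (by linarith)
  have l5 : (c.2 - a.2) * (1 - b.2) ≤ 1 - ε := by nlinarith
  rw [e, abs_le]
  constructor <;> linarith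

/-- Triangles in the truncated triangle have area at most `(1 - ε) / 2`. -/
lemma abs_cr_trunc {ε : ℝ} {a b c : ℝ × ℝ} (ha : a ∈ trunc ε) (hb : b ∈ trunc ε)
    (hc : c ∈ trunc ε) : |cr a b c| ≤ 1 - ε := by
  rcases le_total a.2 b.2 with h1 | h1 <;> rcases le_total b.2 c.2 with h2 | h2 <;>
    rcases le_total a.2 c.2 with h3 | h3
  · exact abs_cr_trunc_of_sorted ha hb hc h1 h2
  · exact abs_cr_trunc_of_sorted ha hb hc h1 h2
  · rw [← abs_cr_swap_right]; exact abs_cr_trunc_of_sorted ha hc hb h3 h2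
  · rw [← abs_cr_swap_right, ← abs_cr_swap_left]; exact abs_cr_trunc_of_sorted hc ha hb h3 h1
  · rw [← abs_cr_swap_left]; exact abs_cr_trunc_of_sorted hb ha hc h1 h3
  · rw [← abs_cr_swap_left, ← abs_cr_swap_right]; exact abs_cr_trunc_of_sorted hb hc ha h2 h3
  · rw [← abs_cr_swap_left, ← abs_cr_swap_right, ← abs_cr_swap_left]
    exact abs_cr_trunc_of_sorted hc hb ha h2 h1
  · rw [← abs_cr_swap_left, ← abs_cr_swap_right, ← abs_cr_swap_left]
    exact abs_cr_trunc_of_sorted hc hb ha h2 h1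

lemma area_T0_diff_trunc (ε : ℝ) :
    area (T0 \ trunc ε) ≤ ε ^ 2 / 2 := by
  have hsub : T0 \ trunc ε ⊆ tri (0, 1 - ε) (ε, 1 - ε) (0, 1) := by
    rintro z ⟨⟨h1, h2, h3⟩, hz⟩
    have h4 : 1 - ε < z.2 := by
      by_contra hn
      exact hz ⟨⟨h1, h2, h3⟩, not_lt.1 hn⟩
    have hε : 0 < ε := by linarith
    rw [tri_eq_aff]
    refine ⟨(z.1 / ε, (z.2 - (1 - ε)) / ε), ⟨by positivity, ?_, ?_⟩, ?_⟩
    · exact div_nonneg (by linarith) hε.le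
    · rw [← add_div, div_le_one hε]; linarith
    · ext
      · simp; field_simp
      · simp; field_simp; ring
  have h2 : area (tri (0, 1 - ε) (ε, 1 - ε) (0, 1)) = ε ^ 2 / 2 := by
    rw [area_tri]
    have : cr (0, 1 - ε) (ε, 1 - ε) (0, 1) = ε ^ 2 := by unfold cr; ring
    rw [this, abs_of_nonneg (sq_nonneg ε)]
  rw [← h2]
  exact area_mono hsub (Set.Finite.isCompact_convexHull ℝ (Set.toFinite _))

lemma area_trunc_le {ε : ℝ} : area (trunc ε) ≤ 1 / 2 := by
  rw [← area_T0]; exact area_mono (trunc_sub ε) T0_compact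

lemma area_trunc_ge {ε : ℝ} (h : ε ≤ 1 / 2) : (1 - ε ^ 2) / 2 ≤ area (trunc ε) := by
  have h1 := area_T0_diff_trunc ε
  rw [area_diff (trunc_body h) (trunc_sub ε)] at h1
  linarith

/-- Comparing the largest triangle inside the truncated triangle with the smallest one around it
bounds its distance to a triangle from below. -/
lemma sq_ge_of_mem_bm_trunc {ε : ℝ} (h : ε ≤ 1 / 2) {r : ℝ} (hr : r ∈ bm (trunc ε)) :
    1 + ε ≤ r ^ 2 := by
  obtain ⟨hr1, o, u, v, x, hd, h1, h2⟩ := hr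
  have hA : 1 - ε ^ 2 ≤ |det2 u v| := by
    have := (area_trunc_ge h).trans (area_mono h1 (T0_compact.image (aff_cont o u v)))
    rw [area_aff, area_T0] at this
    linarith
  have hv : ∀ w ∈ T0, ∃ k ∈ trunc ε, hom x r k = aff o u v w := fun w hw => h2 ⟨w, hw, rfl⟩
  obtain ⟨a, ha, ea⟩ := hv (0, 0) (by refine ⟨?_, ?_, ?_⟩ <;> norm_num)
  obtain ⟨b, hb, eb⟩ := hv (1, 0) (by refine ⟨?_, ?_, ?_⟩ <;> norm_num)
  obtain ⟨c, hc, ec⟩ := hv (0, 1) (by refine ⟨?_, ?_, ?_⟩ <;> norm_num)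
  have e : r ^ 2 * cr a b c = det2 u v := by
    have h3 := cr_aff ((1 - r) • x) (r, 0) (0, r) a b c
    rw [det_hom] at h3
    change cr (hom x r a) (hom x r b) (hom x r c) = _ at h3
    rw [ea, eb, ec, cr_aff] at h3
    rw [← h3]
    simp [cr]
  have h3 : |det2 u v| ≤ r ^ 2 * (1 - ε) := by
    rw [← e, abs_mul, abs_of_nonneg (sq_nonneg r)]
    exact mul_le_mul_of_nonneg_left (abs_cr_trunc ha hb hc) (sq_nonneg r)
  have h4 : (1 + ε) * (1 - ε) ≤ r ^ 2 * (1 - ε) := by linarith [h3, hA, show (1 + ε) * (1 - ε) = 1 - ε ^ 2 by ring]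
  exact le_of_mul_le_mul_right h4 (by linarith)

/-- The composition of two homotheties of ratio at least `1` is again one, with a suitable centre. -/
lemma hom_hom {a b : ℝ} (ha : 1 ≤ a) (hb : 1 ≤ b) (x y : ℝ × ℝ) :
    ∃ z, ∀ w, hom x a (hom y b w) = hom z (a * b) w := by
  rcases (one_le_mul_of_one_le_of_one_le ha hb).eq_or_lt with h | h
  · have e1 : a = 1 := by nlinarith
    have e2 : b = 1 := by nlinarith
    refine ⟨0, fun w => ?_⟩
    subst e1 e2
    simp [hom_apply]
  · have h' : 1 - a * b ≠ 0 := by linarith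
    refine ⟨(1 - a * b)⁻¹ • ((1 - a) • x + (a * (1 - b)) • y), fun w => ?_⟩
    simp only [hom_apply]
    ext
    · simp only [Prod.smul_fst, Prod.fst_add, smul_eq_mul]; field_simp; ring
    · simp only [Prod.smul_snd, Prod.snd_add, smul_eq_mul]; field_simp; ring

lemma image_aff_aff (o u v o' u' v' : ℝ × ℝ) : ∃ o'' u'' v'' : ℝ × ℝ,
    det2 u'' v'' = det2 u v * det2 u' v' ∧ ∀ z, aff o'' u'' v'' z = aff o u v (aff o' u' v' z) := by
  refine ⟨aff o u v o', aff 0 u v u', aff 0 u v v', ?_, fun z => ?_⟩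
  · simp [det2]; ring
  · ext <;> simp <;> ring

/-- Bodies sandwiching each other up to a homothety have comparable distances to a triangle. -/
lemma sInf_bm_sandwich {K L : Set (ℝ × ℝ)} (hK : Body K) (hL : Body L) {y : ℝ × ℝ} {r : ℝ}
    (hr : 1 ≤ r) (h1 : K ⊆ L) (h2 : L ⊆ hom y r '' K) :
    sInf (bm L) ≤ r * sInf (bm K) ∧ sInf (bm K) ≤ r * sInf (bm L) := by
  have hr0 : 0 < r := by linarith
  constructor
  · rw [← div_le_iff₀' hr0]
    refine le_csInf ⟨4, four_mem_bm hK⟩ fun s hs => ?_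
    rw [div_le_iff₀' hr0]
    refine csInf_le (bm_bdd L) ?_
    obtain ⟨hs1, o, u, v, x, hd, g1, g2⟩ := hs
    obtain ⟨o', u', v', e1, e2⟩ := image_aff_aff ((1 - r) • y) (r, 0) (0, r) o u v
    obtain ⟨z, hz⟩ := hom_hom hr hs1 y x
    have e3 : aff o' u' v' '' T0 = hom y r '' (aff o u v '' T0) := by
      rw [← image_comp]; exact image_congr fun w _ => e2 w
    refine ⟨one_le_mul_of_one_le_of_one_le hr hs1, o', u', v', z, ?_, ?_, ?_⟩
    · rw [e1, det_hom]; exact mul_ne_zero (by positivity) hd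
    · rw [e3]; exact h2.trans (image_mono g1)
    · rw [e3]
      refine (image_mono (g2.trans (image_mono h1))).trans ?_
      rw [← image_comp]; exact (image_congr fun w _ => hz w).subset
  · rw [← div_le_iff₀' hr0]
    refine le_csInf ⟨4, four_mem_bm hL⟩ fun s hs => ?_
    rw [div_le_iff₀' hr0]
    refine csInf_le (bm_bdd K) ?_
    obtain ⟨hs1, o, u, v, x, hd, g1, g2⟩ := hs
    obtain ⟨z, hz⟩ := hom_hom hs1 hr x y
    refine ⟨one_le_mul_of_one_le_of_one_le hr hs1, o, u, v, z, hd, h1.trans g1, ?_⟩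
    refine (g2.trans (image_mono h2)).trans ?_
    rw [← image_comp, mul_comm]; exact (image_congr fun w _ => hz w).subset

lemma trunc_sub_hom {s t : ℝ} (hs : s ≤ t) (ht : t ≤ 1 / 2) :
    trunc s ⊆ hom 0 (1 + 2 * (t - s)) '' trunc t := by
  rintro z ⟨⟨h1, h2, h3⟩, h4⟩
  have hr : 0 < 1 + 2 * (t - s) := by linarith
  refine ⟨(z.1 / (1 + 2 * (t - s)), z.2 / (1 + 2 * (t - s))), ⟨⟨by positivity, by positivity, ?_⟩,
    ?_⟩, ?_⟩
  · rw [← add_div, div_le_one hr]; linarith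
  · rw [div_le_iff₀ hr]; nlinarith
  · rw [hom_apply]
    ext
    · simp; field_simp
    · simp; field_simp

lemma sInf_bm_trunc_continuousOn : ContinuousOn (fun ε => sInf (bm (trunc ε))) (Icc 0 (1 / 2)) := by
  have hb : ∀ ε ∈ Icc (0 : ℝ) (1 / 2), sInf (bm (trunc ε)) ≤ 4 := fun ε hε =>
    csInf_le (bm_bdd _) (four_mem_bm (trunc_body hε.2))
  have main : ∀ s ∈ Icc (0 : ℝ) (1 / 2), ∀ t ∈ Icc (0 : ℝ) (1 / 2), s ≤ t →
      |sInf (bm (trunc s)) - sInf (bm (trunc t))| ≤ 8 * |s - t| := by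
    intro s hs t ht hst
    obtain ⟨h1, h2⟩ := sInf_bm_sandwich (trunc_body ht.2) (trunc_body hs.2)
      (by linarith : 1 ≤ 1 + 2 * (t - s)) (trunc_anti hst) (trunc_sub_hom hst ht.2)
    have b1 := hb s hs
    have b2 := hb t ht
    rw [abs_sub_comm s t, abs_of_nonneg (sub_nonneg.2 hst), abs_le]
    constructor <;> nlinarith
  have : LipschitzOnWith 8 (fun ε => sInf (bm (trunc ε))) (Icc 0 (1 / 2)) := by
    refine LipschitzOnWith.of_dist_le_mul fun s hs t ht => ?_
    rw [Real.dist_eq, Real.dist_eq]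
    rcases le_total s t with h | h
    · exact main s hs t ht h
    · rw [abs_sub_comm, abs_sub_comm s]; exact main t ht s hs h
  exact this.continuousOn

lemma sInf_bm_trunc_zero : sInf (bm (trunc 0)) = 1 := by
  refine le_antisymm (csInf_le (bm_bdd _) ⟨le_rfl, 0, (1, 0), (0, 1), 0, ?_, ?_, ?_⟩)
    (one_le_sInf_bm (trunc_body (by norm_num)))
  · norm_num [det2]
  · rw [trunc_zero]
    exact fun z hz => ⟨z, hz, by ext <;> simp⟩
  · rw [trunc_zero]
    rintro _ ⟨z, hz, rfl⟩
    exact ⟨z, hz, by rw [hom_apply]; ext <;> simp⟩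

lemma sInf_bm_trunc_sq {ε : ℝ} (h : ε ≤ 1 / 2) :
    1 + ε ≤ sInf (bm (trunc ε)) ^ 2 := by
  have h1 : √(1 + ε) ≤ sInf (bm (trunc ε)) := by
    refine le_csInf ⟨4, four_mem_bm (trunc_body h)⟩ fun r hr => ?_
    rw [Real.sqrt_le_left (by linarith [hr.1])]
    exact sq_ge_of_mem_bm_trunc h hr
  exact (Real.sqrt_le_left (by linarith [one_le_sInf_bm (trunc_body h)])).1 h1

/-- Every small distance to a triangle is attained by a truncated triangle. -/
lemma exists_trunc {δ : ℝ} (h0 : 0 ≤ δ) (h1 : δ ≤ 1 / 5) :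
    ∃ ε, 0 ≤ ε ∧ ε ≤ 1 / 2 ∧ ε ≤ 3 * δ ∧ sInf (bm (trunc ε)) = 1 + δ := by
  have hh := sInf_bm_trunc_sq (ε := 1 / 2) le_rfl
  have hh1 := one_le_sInf_bm (trunc_body (ε := 1 / 2) le_rfl)
  obtain ⟨ε, hε, he⟩ := intermediate_value_Icc (by norm_num) sInf_bm_trunc_continuousOn
    (show 1 + δ ∈ Icc _ _ from ⟨by rw [sInf_bm_trunc_zero]; linarith, by nlinarith⟩)
  simp only at he
  have := sInf_bm_trunc_sq hε.2
  rw [he] at this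
  exact ⟨ε, hε.1, hε.2, by nlinarith, he⟩

/-! ### Moments of truncated triangles -/

/-- Integrals of bounded functions over the truncated triangle and over the triangle differ by at
most the bound times the area cut off. -/
lemma integral_trunc_ge {ε : ℝ} (h : ε ≤ 1 / 2) {f : ℝ × ℝ → ℝ} (hf : Continuous f)
    {M : ℝ} (hM0 : 0 ≤ M) (hM : ∀ z ∈ T0, f z ≤ M) :
    (∫ z in T0, f z) - M * (ε ^ 2 / 2) ≤ ∫ z in trunc ε, f z := by
  have hK := trunc_body h
  have hs : ∫ z in T0, f z = (∫ z in trunc ε, f z) + ∫ z in T0 \ trunc ε, f z := by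
    rw [← setIntegral_union disjoint_sdiff_right (T0_body.meas.diff hK.meas) (hK.intOn hf)
      ((T0_body.intOn hf).mono_set sdiff_subset), union_sdiff_cancel (trunc_sub ε)]
  have hd : ∫ z in T0 \ trunc ε, f z ≤ ∫ _ in T0 \ trunc ε, M :=
    setIntegral_mono_on ((T0_body.intOn hf).mono_set sdiff_subset)
      ((T0_body.intOn continuous_const).mono_set sdiff_subset) (T0_body.meas.diff hK.meas)
      fun z hz => hM z hz.1
  rw [setIntegral_const, smul_eq_mul] at hd
  have hA : volume.real (T0 \ trunc ε) ≤ ε ^ 2 / 2 := area_T0_diff_trunc ε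
  nlinarith

lemma abs_cr_T0 {a b c : ℝ × ℝ} (ha : a ∈ T0) (hb : b ∈ T0) (hc : c ∈ T0) : |cr a b c| ≤ 1 := by
  have := abs_cr_trunc (ε := 0) (a := a) (b := b) (c := c) (trunc_zero ▸ ha) (trunc_zero ▸ hb)
    (trunc_zero ▸ hc)
  linarith

lemma phi_T0_le {p : ℝ} (hp : 1 ≤ p) {a b c : ℝ × ℝ} (ha : a ∈ T0) (hb : b ∈ T0) (hc : c ∈ T0) :
    (|cr a b c| / 2) ^ p ≤ (1 / 2) ^ p :=
  Real.rpow_le_rpow (by positivity) (by linarith [abs_cr_T0 ha hb hc]) (by linarith)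

lemma W_trunc_ge {p : ℝ} (hp : 1 ≤ p) {ε : ℝ} (h : ε ≤ 1 / 2) {o : ℝ × ℝ}
    (ho : o ∈ T0) : W (fun s => (|s| / 2) ^ p) T0 o - (1 / 2) ^ p * (ε ^ 2 / 2) ≤
      W (fun s => (|s| / 2) ^ p) (trunc ε) o := by
  have hK := trunc_body h
  have hA : (0 : ℝ) ≤ (1 / 2) ^ p := by positivity
  have hc : Continuous (Function.uncurry fun x y => (|cr o x y| / 2) ^ p) :=
    (half_rpow_cont hp).comp (cr_cont o)
  have hc0 := cont_inner T0_compact hc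
  have hc1 := cont_inner hK.cpt hc
  have ha : volume.real T0 = 1 / 2 := area_T0
  have hb : ∀ x ∈ T0, ∫ y in T0, (|cr o x y| / 2) ^ p ≤ (1 / 2) ^ p / 2 := by
    intro x hx
    have := setIntegral_mono_on (T0_body.intOn (cont_left hc x))
      (T0_body.intOn (continuous_const (y := (1 / 2 : ℝ) ^ p))) T0_body.meas
      fun y hy => phi_T0_le hp ho hx hy
    rw [setIntegral_const, ha, smul_eq_mul] at this
    linarith
  have h1 := integral_trunc_ge h hc0 (by positivity) hb
  have h2 : ∫ x in trunc ε, ((∫ y in T0, (|cr o x y| / 2) ^ p) - (1 / 2) ^ p * (ε ^ 2 / 2)) ≤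
      ∫ x in trunc ε, ∫ y in trunc ε, (|cr o x y| / 2) ^ p :=
    setIntegral_mono_on (hK.intOn (hc0.sub continuous_const)) (hK.intOn hc1) hK.meas
      fun x hx => integral_trunc_ge h (cont_left hc x) hA
        fun y hy => phi_T0_le hp ho (trunc_sub ε hx) hy
  rw [integral_sub (hK.intOn hc0) (hK.intOn continuous_const), setIntegral_const, smul_eq_mul] at h2
  have h3 : volume.real (trunc ε) ≤ 1 / 2 := area_trunc_le
  have h4 : volume.real (trunc ε) * ((1 / 2) ^ p * (ε ^ 2 / 2)) ≤
      1 / 2 * ((1 / 2) ^ p * (ε ^ 2 / 2)) := by gcongr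
  unfold W
  linarith

lemma half_rpow_neg_mul (p k : ℝ) : (1 / 2 : ℝ) ^ (-k - p) * (1 / 2) ^ p = 2 ^ k := by
  rw [← Real.rpow_add (by norm_num), show -k - p + p = -k by ring, one_div,
    Real.inv_rpow (by norm_num), Real.rpow_neg (by norm_num), inv_inv]

lemma area_trunc_rpow {p k : ℝ} (hp : 1 ≤ p) (hk : 0 ≤ k) {ε : ℝ} (h : ε ≤ 1 / 2) :
    (1 / 2 : ℝ) ^ (-k - p) ≤ area (trunc ε) ^ (-k - p) :=
  Real.rpow_le_rpow_of_nonpos (trunc_body h).area_pos area_trunc_le (by linarith)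

lemma E3_trunc_ge {p : ℝ} (hp : 1 ≤ p) {ε : ℝ} (h : ε ≤ 1 / 2) :
    E3 p T0 - 3 * ε ^ 2 ≤ E3 p (trunc ε) := by
  have hK := trunc_body h
  have hφ := half_rpow_cont hp
  have hc0 := W_cont hφ T0_compact
  have hc1 := W_cont hφ hK.cpt
  have hA : (0 : ℝ) ≤ (1 / 2) ^ p := by positivity
  have hb : ∀ o ∈ T0, W (fun s => (|s| / 2) ^ p) T0 o ≤ (1 / 2) ^ p / 4 := fun o ho =>
    W_T0_le hp ho
  have h1 := integral_trunc_ge h hc0 (by positivity) hb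
  have h2 : ∫ o in trunc ε, (W (fun s => (|s| / 2) ^ p) T0 o - (1 / 2) ^ p * (ε ^ 2 / 2)) ≤
      ∫ o in trunc ε, W (fun s => (|s| / 2) ^ p) (trunc ε) o :=
    setIntegral_mono_on (hK.intOn (hc0.sub continuous_const)) (hK.intOn hc1) hK.meas
      fun o ho => W_trunc_ge hp h (trunc_sub ε ho)
  rw [integral_sub (hK.intOn hc0) (hK.intOn continuous_const), setIntegral_const, smul_eq_mul] at h2
  have h3 : volume.real (trunc ε) ≤ 1 / 2 := area_trunc_le
  have h4 : volume.real (trunc ε) * ((1 / 2) ^ p * (ε ^ 2 / 2)) ≤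
      1 / 2 * ((1 / 2) ^ p * (ε ^ 2 / 2)) := by gcongr
  have h5 : (∫ o in T0, W (fun s => (|s| / 2) ^ p) T0 o) - (1 / 2) ^ p * (3 / 8 * ε ^ 2) ≤
      ∫ o in trunc ε, W (fun s => (|s| / 2) ^ p) (trunc ε) o := by linarith
  have h6 := mul_le_mul_of_nonneg_left h5 (show (0 : ℝ) ≤ (1 / 2) ^ (-3 - p) by positivity)
  have h7 : 0 ≤ ∫ o in trunc ε, W (fun s => (|s| / 2) ^ p) (trunc ε) o :=
    integral_nonneg fun o => W_nonneg (half_rpow_nonneg p) _ o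
  have h8 := mul_le_mul_of_nonneg_right (area_trunc_rpow hp (by norm_num : (0 : ℝ) ≤ 3) h) h7
  have h9 := half_rpow_neg_mul p 3
  have h10 : (2 : ℝ) ^ (3 : ℝ) = 8 := by norm_num
  rw [mul_sub, ← mul_assoc, h9, h10] at h6
  unfold E3
  rw [area_T0]
  linarith

/-- A one-sided Lipschitz estimate for `s ↦ (|s| / 2) ^ p` from convexity. -/
lemma phi_ge {p : ℝ} (hp : 1 ≤ p) {s t : ℝ} (hs : |s| ≤ 1) :
    (|s| / 2) ^ p - p * (1 / 2) ^ p * |t - s| ≤ (|t| / 2) ^ p := by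
  have hA : (0 : ℝ) ≤ (1 / 2) ^ p := by positivity
  have hp0 : 0 < p := by linarith
  rcases le_or_gt |s| |t| with h | h
  · have := Real.rpow_le_rpow (by positivity) (show |s| / 2 ≤ |t| / 2 by linarith) hp0.le
    have : 0 ≤ p * (1 / 2) ^ p * |t - s| := by positivity
    linarith
  · have ha : 0 < |s| := lt_of_le_of_lt (abs_nonneg t) h
    have hb := one_add_mul_self_le_rpow_one_add (s := |t| / |s| - 1)
      (by have : 0 ≤ |t| / |s| := by positivity
          linarith) hp
    have e : (|t| / 2) ^ p = (1 + (|t| / |s| - 1)) ^ p * (|s| / 2) ^ p := by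
      rw [← Real.mul_rpow (by rw [add_sub_cancel]; positivity) (by positivity)]
      congr 1; field_simp; ring
    have hq : (|s| / 2) ^ p ≤ |s| * (1 / 2) ^ p := by
      rw [div_eq_mul_one_div, Real.mul_rpow ha.le (by norm_num)]
      refine mul_le_mul_of_nonneg_right ?_ hA
      calc |s| ^ p ≤ |s| ^ (1 : ℝ) := Real.rpow_le_rpow_of_exponent_ge ha hs hp
        _ = |s| := Real.rpow_one _
    have h1 : (1 + p * (|t| / |s| - 1)) * (|s| / 2) ^ p ≤ (|t| / 2) ^ p := by
      rw [e]; exact mul_le_mul_of_nonneg_right hb (by positivity)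
    have h2 : p * (1 - |t| / |s|) * (|s| / 2) ^ p ≤ p * (1 / 2) ^ p * |t - s| := by
      have h3 : 0 ≤ 1 - |t| / |s| := by
        rw [sub_nonneg, div_le_one ha]; exact h.le
      calc p * (1 - |t| / |s|) * (|s| / 2) ^ p ≤ p * (1 - |t| / |s|) * (|s| * (1 / 2) ^ p) := by
            gcongr
        _ = p * (1 / 2) ^ p * (|s| - |t|) := by field_simp
        _ ≤ _ := by
            gcongr
            rw [abs_sub_comm]; exact abs_sub_abs_le_abs_sub s t
    linarith

lemma cen_trunc_near {ε : ℝ} (h0 : 0 ≤ ε) (h : ε ≤ 1 / 2) :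
    |(cen (trunc ε)).1 - (cen T0).1| ≤ 2 * ε ^ 2 ∧ |(cen (trunc ε)).2 - (cen T0).2| ≤ 2 * ε ^ 2 := by
  have hq : 0 < 1 - ε ^ 2 := by nlinarith
  have hr : √(1 / (1 - ε ^ 2)) ^ 2 = 1 / (1 - ε ^ 2) := Real.sq_sqrt (by positivity)
  have hle : 1 * (√(1 / (1 - ε ^ 2)) ^ 2 - 1) ≤ 2 * ε ^ 2 := by
    rw [hr, one_mul, sub_le_iff_le_add, div_le_iff₀ hq]; nlinarith [mul_nonneg (sq_nonneg ε) (show 0 ≤ 1 - 2 * ε ^ 2 by nlinarith)]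
  have := cen_near T0_body (trunc_body h) (M := 1) (r := √(1 / (1 - ε ^ 2)))
    (by
      rintro w ⟨h1, h2, h3⟩
      rw [cen_T0]
      refine ⟨abs_le.2 ⟨?_, ?_⟩, abs_le.2 ⟨?_, ?_⟩⟩ <;> simp only <;> linarith)
    (trunc_sub ε)
    (by
      rw [hr, area_T0, one_div_mul_eq_div, le_div_iff₀ hq]
      linarith [area_trunc_ge h])
  exact ⟨this.1.trans hle, this.2.trans hle⟩

lemma Body.cen_eq_average {K : Set (ℝ × ℝ)} (hK : Body K) : cen K = ⨍ z in K, z := by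
  have hi : IntegrableOn (fun z : ℝ × ℝ => z) K :=
    continuous_id.continuousOn.integrableOn_compact hK.cpt
  rw [setAverage_eq]
  ext
  · rw [Prod.smul_fst, fst_integral hi, smul_eq_mul]; rfl
  · rw [Prod.smul_snd, snd_integral hi, smul_eq_mul]; rfl

lemma Body.cen_mem {K : Set (ℝ × ℝ)} (hK : Body K) : cen K ∈ K := by
  rw [hK.cen_eq_average]
  refine hK.cvx.set_average_mem hK.cpt.isClosed ?_ hK.cpt.measure_lt_top.ne
    (ae_restrict_mem hK.meas) (continuous_id.continuousOn.integrableOn_compact hK.cpt)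
  exact fun h => hK.area_pos.ne' (by simp [area, measureReal_def, h])

lemma Es_trunc_ge {p : ℝ} (hp : 1 ≤ p) {ε : ℝ} (h0 : 0 ≤ ε) (h : ε ≤ 1 / 2) :
    Es p T0 - (2 + 4 * p) * ε ^ 2 ≤ Es p (trunc ε) := by
  have hK := trunc_body h
  have hφ := half_rpow_cont hp
  have hA : (0 : ℝ) ≤ (1 / 2) ^ p := by positivity
  have hg : cen T0 ∈ T0 := by rw [cen_T0]; refine ⟨?_, ?_, ?_⟩ <;> norm_num
  have h1 := W_trunc_ge hp h (trunc_sub ε hK.cen_mem)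
  obtain ⟨n1, n2⟩ := cen_trunc_near h0 h
  set g := cen T0 with hgd
  set g' := cen (trunc ε) with hgd'
  have hc : ∀ o, Continuous (Function.uncurry fun x y => (|cr o x y| / 2) ^ p) := fun o =>
    hφ.comp (cr_cont o)
  have h2 : W (fun s => (|s| / 2) ^ p) T0 g - p * (1 / 2) ^ p * ε ^ 2 ≤
      W (fun s => (|s| / 2) ^ p) T0 g' := by
    have h3 := double_mono T0_compact (F := fun x y => (|cr g x y| / 2) ^ p -
      p * (1 / 2) ^ p * (4 * ε ^ 2)) (by
        simp only [Function.uncurry_def]; exact Continuous.sub (hc g) continuous_const) (hc g')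
      (fun x hx y hy => by
        refine le_trans ?_ (phi_ge hp (t := cr g' x y) (abs_cr_T0 hg hx hy))
        refine sub_le_sub_left ?_ _
        refine mul_le_mul_of_nonneg_left ?_ (by positivity)
        have e : cr g' x y - cr g x y = (g'.1 - g.1) * (x.2 - y.2) + (g'.2 - g.2) * (y.1 - x.1) := by
          unfold cr; ring
        rw [e]
        obtain ⟨x1, x2, x3⟩ := hx
        obtain ⟨y1, y2, y3⟩ := hy
        have k1 : |x.2 - y.2| ≤ 1 := abs_le.2 ⟨by linarith, by linarith⟩
        have k2 : |y.1 - x.1| ≤ 1 := abs_le.2 ⟨by linarith, by linarith⟩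
        refine (abs_add_le _ _).trans ?_
        rw [abs_mul, abs_mul]
        have := mul_le_mul n1 k1 (abs_nonneg _) (by positivity)
        have := mul_le_mul n2 k2 (abs_nonneg _) (by positivity)
        linarith)
    have ha : volume.real T0 = 1 / 2 := area_T0
    have h4 : ∀ x, ∫ y in T0, ((|cr g x y| / 2) ^ p - p * (1 / 2) ^ p * (4 * ε ^ 2)) =
        (∫ y in T0, (|cr g x y| / 2) ^ p) - p * (1 / 2) ^ p * (2 * ε ^ 2) := by
      intro x
      rw [integral_sub (T0_body.intOn (cont_left (hc g) x)) (T0_body.intOn continuous_const),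
        setIntegral_const, ha, smul_eq_mul]
      ring
    simp_rw [h4] at h3
    rw [integral_sub (T0_body.intOn (cont_inner T0_compact (hc g)))
      (T0_body.intOn continuous_const), setIntegral_const, ha, smul_eq_mul] at h3
    unfold W
    linarith
  have h5 : W (fun s => (|s| / 2) ^ p) T0 g - (1 / 2) ^ p * ((1 / 2 + p) * ε ^ 2) ≤
      W (fun s => (|s| / 2) ^ p) (trunc ε) g' := by linarith
  have h6 := mul_le_mul_of_nonneg_left h5 (show (0 : ℝ) ≤ (1 / 2) ^ (-2 - p) by positivity)
  have h7 := W_nonneg (half_rpow_nonneg p) (trunc ε) g'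
  have h8 := mul_le_mul_of_nonneg_right (area_trunc_rpow hp (by norm_num : (0 : ℝ) ≤ 2) h) h7
  have h9 := half_rpow_neg_mul p 2
  have h10 : (2 : ℝ) ^ (2 : ℝ) = 4 := by norm_num
  rw [mul_sub, ← mul_assoc, h9, h10] at h6
  unfold Es
  rw [area_T0]
  linarith

/-- The moments of the triangle decay at most exponentially in `p`: by stability they exceed those of
a truncated triangle by an exponentially small amount, and the latter are nonnegative. -/
lemma T0_moments_ge : ∃ k : ℝ, 0 < k ∧ ∀ p : ℝ, 1 ≤ p → k ^ p ≤ Es p T0 ∧ k ^ p ≤ E3 p T0 := by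
  obtain ⟨c, hc0, -, h⟩ := distance_stability
  obtain ⟨ε, e0, e1, -, e2⟩ := exists_trunc (δ := 1 / 5) (by norm_num) le_rfl
  refine ⟨c * (1 / 25), by positivity, fun p hp => ?_⟩
  obtain ⟨h1, h2⟩ := h _ (trunc_body e1) (1 / 5) (by norm_num) e2 p hp
  have h3 : (c * (1 / 25)) ^ p ≤ c ^ p * (1 / 5) ^ 2 := by
    rw [Real.mul_rpow hc0.le (by norm_num)]
    refine mul_le_mul_of_nonneg_left ?_ (by positivity)
    calc (1 / 25 : ℝ) ^ p ≤ (1 / 25 : ℝ) ^ (1 : ℝ) :=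
          Real.rpow_le_rpow_of_exponent_ge (by norm_num) (by norm_num) hp
      _ = _ := by norm_num
  have h4 := Es_nonneg p (trunc ε)
  have h5 := E3_nonneg p (trunc ε)
  constructor <;> linarith

/-- The stability estimate in coordinates has the optimal order. -/
theorem plane_sharp : ∃ C : ℝ, 0 < C ∧ ∃ δ₀ : ℝ, 0 < δ₀ ∧ ∀ δ : ℝ, 0 < δ → δ < δ₀ →
    ∃ K, Body K ∧ sInf (bm K) = 1 + δ ∧ ∀ p : ℝ, 1 ≤ p →
    (1 - C ^ p * δ ^ 2) * Es p T0 ≤ Es p K ∧ (1 - C ^ p * δ ^ 2) * E3 p T0 ≤ E3 p K := by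
  obtain ⟨k, hk0, hk⟩ := T0_moments_ge
  refine ⟨108 / k, by positivity, 1 / 5, by norm_num, fun δ hδ hδ1 => ?_⟩
  obtain ⟨ε, e0, e1, e2, e3⟩ := exists_trunc hδ.le hδ1.le
  refine ⟨trunc ε, trunc_body e1, e3, fun p hp => ?_⟩
  obtain ⟨k1, k2⟩ := hk p hp
  have hε2 : ε ^ 2 ≤ 9 * δ ^ 2 := by nlinarith
  have hp2 : p ≤ 2 ^ p := by
    have := one_add_mul_self_le_rpow_one_add (s := 1) (by norm_num) hp
    norm_num at this
    linarith
  have h2 : (2 : ℝ) ≤ 2 ^ p := by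
    calc (2 : ℝ) = 2 ^ (1 : ℝ) := (Real.rpow_one _).symm
      _ ≤ _ := Real.rpow_le_rpow_of_exponent_le (by norm_num) hp
  have h54 : (54 : ℝ) ≤ 54 ^ p := by
    calc (54 : ℝ) = 54 ^ (1 : ℝ) := (Real.rpow_one _).symm
      _ ≤ _ := Real.rpow_le_rpow_of_exponent_le (by norm_num) hp
  have h108 : 6 * 2 ^ p * ε ^ 2 ≤ 108 ^ p * δ ^ 2 := by
    rw [show (108 : ℝ) = 54 * 2 by norm_num, Real.mul_rpow (by norm_num) (by norm_num)]
    calc 6 * 2 ^ p * ε ^ 2 ≤ 6 * 2 ^ p * (9 * δ ^ 2) := by gcongr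
      _ = 54 * (2 ^ p * δ ^ 2) := by ring
      _ ≤ 54 ^ p * (2 ^ p * δ ^ 2) := by gcongr
      _ = _ := by ring
  have hfin : ∀ E : ℝ, k ^ p ≤ E → 108 ^ p * δ ^ 2 ≤ (108 / k) ^ p * δ ^ 2 * E := by
    intro E hE
    rw [Real.div_rpow (by norm_num) hk0.le]
    have hkp : 0 < k ^ p := by positivity
    calc (108 : ℝ) ^ p * δ ^ 2 = 108 ^ p / k ^ p * δ ^ 2 * k ^ p := by field_simp
      _ ≤ _ := by gcongr
  have f1 := hfin _ k1
  have f2 := hfin _ k2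
  have g1 := Es_trunc_ge hp e0 e1
  have g2 := E3_trunc_ge hp e1
  have hs : (2 + 4 * p) * ε ^ 2 ≤ 6 * 2 ^ p * ε ^ 2 := by gcongr; linarith
  have hs' : 3 * ε ^ 2 ≤ 6 * 2 ^ p * ε ^ 2 := by gcongr; linarith
  constructor <;> linarith

/-! ### Coordinates in the Euclidean plane -/

/-- The coordinate map from the Euclidean plane to `ℝ × ℝ`. -/
def coord : EuclideanSpace ℝ (Fin 2) ≃L[ℝ] ℝ × ℝ :=
  (EuclideanSpace.equiv (Fin 2) ℝ).trans (ContinuousLinearEquiv.finTwoArrow ℝ ℝ)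

lemma coord_measurePreserving : MeasurePreserving coord :=
  (volume_preserving_finTwoArrow ℝ).comp (PiLp.volume_preserving_ofLp (Fin 2))

lemma coord_emb : MeasurableEmbedding coord := coord.toHomeomorph.measurableEmbedding

lemma volume_real_eq (K : Set (EuclideanSpace ℝ (Fin 2))) : volume.real K = area (coord '' K) := by
  have := coord_measurePreserving.measure_preimage_emb coord_emb (coord '' K)
  rw [preimage_image_eq K coord.injective] at this
  rw [area, measureReal_def, measureReal_def, this]

lemma setIntegral_coord {F : Type*} [NormedAddCommGroup F] [NormedSpace ℝ F]
    (K : Set (EuclideanSpace ℝ (Fin 2))) (f : ℝ × ℝ → F) :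
    ∫ x in K, f (coord x) = ∫ z in coord '' K, f z :=
  (coord_measurePreserving.setIntegral_image_emb coord_emb f K).symm

lemma coord_hull (x : Fin 3 → EuclideanSpace ℝ (Fin 2)) :
    coord '' convexHull ℝ (range x) = tri (coord (x 0)) (coord (x 1)) (coord (x 2)) := by
  have h := coord.toLinearEquiv.toLinearMap.image_convexHull (range x)
  have h2 : coord.toLinearEquiv.toLinearMap '' range x =
      {coord (x 0), coord (x 1), coord (x 2)} := by
    ext z
    simp only [mem_image, mem_range, mem_insert_iff, mem_singleton_iff]
    constructor
    · rintro ⟨_, ⟨i, rfl⟩, rfl⟩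
      fin_cases i
      · exact Or.inl rfl
      · exact Or.inr (Or.inl rfl)
      · exact Or.inr (Or.inr rfl)
    · rintro (rfl | rfl | rfl)
      exacts [⟨_, ⟨0, rfl⟩, rfl⟩, ⟨_, ⟨1, rfl⟩, rfl⟩, ⟨_, ⟨2, rfl⟩, rfl⟩]
  rw [h2] at h
  rw [tri, ← h]; rfl

lemma hullVolume_eq (x : Fin 3 → EuclideanSpace ℝ (Fin 2)) :
    RandomSimplex.hullVolume x = |cr (coord (x 0)) (coord (x 1)) (coord (x 2))| / 2 := by
  rw [RandomSimplex.hullVolume, volume_real_eq, ← area_tri, coord_hull]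

lemma centroid_eq {K : Set (EuclideanSpace ℝ (Fin 2))} (hK : Body (coord '' K)) :
    coord (RandomSimplex.centroid K) = cen (coord '' K) := by
  rw [hK.cen_eq_average, RandomSimplex.centroid, setAverage_eq, setAverage_eq, map_smul,
    ← coord.integral_comp_comm, setIntegral_coord K fun z => z, volume_real_eq]
  rfl

/-- An integral over `K ^ (n + 1)` as an iterated integral. -/
lemma integral_pi_succ {n : ℕ} {K : Set (EuclideanSpace ℝ (Fin 2))} (hK : IsCompact K)
    {f : (Fin (n + 1) → EuclideanSpace ℝ (Fin 2)) → ℝ} (hf : Continuous f) :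
    ∫ x in univ.pi (fun _ : Fin (n + 1) => K), f x =
      ∫ a in K, ∫ y in univ.pi (fun _ : Fin n => K), f (Fin.cons a y) := by
  have hi : IntegrableOn f (univ.pi fun _ : Fin (n + 1) => K) :=
    hf.continuousOn.integrableOn_compact (isCompact_univ_pi fun _ => hK)
  have : IsFiniteMeasure ((volume : Measure (EuclideanSpace ℝ (Fin 2))).restrict K) :=
    ⟨by rw [Measure.restrict_apply_univ]; exact hK.measure_lt_top⟩
  unfold IntegrableOn at hi
  rw [volume_pi, Measure.restrict_pi_pi] at hi ⊢
  rw [volume_pi, Measure.restrict_pi_pi]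
  have hmp := measurePreserving_piFinSuccAbove
    (fun _ : Fin (n + 1) => (volume : Measure (EuclideanSpace ℝ (Fin 2))).restrict K) 0
  rw [← hmp.symm.integral_comp' f, integral_prod]
  · refine integral_congr_ae (Eventually.of_forall fun a => integral_congr_ae
      (Eventually.of_forall fun y => congrArg f ?_))
    exact Fin.insertNth_zero' a y
  · exact (hmp.symm.integrable_comp_emb (MeasurableEquiv.measurableEmbedding _)).2 hi

lemma integral_pi_zero {K : Set (EuclideanSpace ℝ (Fin 2))}
    (f : (Fin 0 → EuclideanSpace ℝ (Fin 2)) → ℝ) (x : Fin 0 → EuclideanSpace ℝ (Fin 2)) :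
    ∫ x in univ.pi (fun _ : Fin 0 => K), f x = f x := by
  rw [volume_pi, Measure.restrict_pi_pi, Measure.pi_of_empty _ x, integral_dirac]

lemma hullVolume_rpow_continuous {p : ℝ} (hp : 1 ≤ p) :
    Continuous fun x : Fin 3 → EuclideanSpace ℝ (Fin 2) => RandomSimplex.hullVolume x ^ p := by
  simp_rw [hullVolume_eq]
  refine (half_rpow_cont hp).comp ?_
  have h : ∀ i, Continuous fun x : Fin 3 → EuclideanSpace ℝ (Fin 2) => coord (x i) := fun i =>
    coord.continuous.comp (continuous_apply i)
  have h0 := h 0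
  have h1 := h 1
  have h2 := h 2
  unfold cr
  fun_prop

lemma cons_continuous (n : ℕ) (a : EuclideanSpace ℝ (Fin 2)) :
    Continuous fun y : Fin n → EuclideanSpace ℝ (Fin 2) =>
      (Fin.cons a y : Fin (n + 1) → EuclideanSpace ℝ (Fin 2)) := by
  refine continuous_pi fun i => ?_
  refine Fin.cases ?_ (fun j => ?_) i
  · simpa using continuous_const
  · simpa using continuous_apply j

/-- The unnormalised moment with one fixed vertex in coordinates. -/
lemma integral_fixed {p : ℝ} (hp : 1 ≤ p) {K : Set (EuclideanSpace ℝ (Fin 2))} (hK : IsCompact K)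
    (a : EuclideanSpace ℝ (Fin 2)) :
    ∫ x in univ.pi (fun _ : Fin 2 => K),
      RandomSimplex.hullVolume (Fin.cons a x : Fin 3 → EuclideanSpace ℝ (Fin 2)) ^ p =
      W (fun s => (|s| / 2) ^ p) (coord '' K) (coord a) := by
  have hc := (hullVolume_rpow_continuous hp).comp (cons_continuous 2 a)
  have h1 := integral_pi_succ hK hc
  simp only [Function.comp_def] at h1
  rw [h1, W, ← setIntegral_coord K fun z => ∫ y in coord '' K, (|cr (coord a) z y| / 2) ^ p]
  congr 1; ext b
  have h2 := integral_pi_succ hK (hc.comp (cons_continuous 1 b))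
  simp only [Function.comp_def] at h2
  rw [h2, ← setIntegral_coord K fun z => (|cr (coord a) (coord b) z| / 2) ^ p]
  congr 1; ext c
  rw [integral_pi_zero _ Fin.elim0, hullVolume_eq]
  rfl

lemma momentCentroid_eq {p : ℝ} (hp : 1 ≤ p) {K : Set (EuclideanSpace ℝ (Fin 2))}
    (hK : Body (coord '' K)) : RandomSimplex.momentCentroid p K = Es p (coord '' K) := by
  have hc : IsCompact K := coord.toHomeomorph.isCompact_image.1 hK.cpt
  rw [RandomSimplex.momentCentroid, RandomSimplex.momentFixed, integral_fixed hp hc,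
    centroid_eq hK, volume_real_eq, Es]
  norm_num

lemma momentRandom_eq {p : ℝ} (hp : 1 ≤ p) {K : Set (EuclideanSpace ℝ (Fin 2))}
    (hK : Body (coord '' K)) : RandomSimplex.momentRandom 3 p K = E3 p (coord '' K) := by
  have hc : IsCompact K := coord.toHomeomorph.isCompact_image.1 hK.cpt
  rw [RandomSimplex.momentRandom, integral_pi_succ hc (hullVolume_rpow_continuous hp),
    volume_real_eq, E3]
  simp_rw [integral_fixed hp hc]
  rw [setIntegral_coord K fun z => W (fun s => (|s| / 2) ^ p) (coord '' K) z]
  norm_num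

/-- A triangle is an affine image of the standard triangle. -/
lemma triangle_frame {T : Set (EuclideanSpace ℝ (Fin 2))} (hT : RandomSimplex.IsTriangle T) :
    ∃ o u v : ℝ × ℝ, det2 u v ≠ 0 ∧ coord '' T = aff o u v '' T0 := by
  obtain ⟨x, hx, rfl⟩ := hT
  refine ⟨coord (x 0), coord (x 1) - coord (x 0), coord (x 2) - coord (x 0), ?_, ?_⟩
  · intro h0
    set u := coord (x 1) - coord (x 0) with hu
    set v := coord (x 2) - coord (x 0) with hv
    have key : ∀ s t : ℝ, s • u + t • v = 0 → s = 0 ∧ t = 0 := by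
      intro s t hst
      have := (affineIndependent_iff.1 hx) Finset.univ ![-s - t, s, t]
        (by simp [Fin.sum_univ_three]; ring) (by
          apply coord.injective
          simp only [Fin.sum_univ_three, Matrix.cons_val_zero, Matrix.cons_val_one,
            Matrix.cons_val, map_add, map_smul, map_zero]
          rw [← hst, hu, hv]; module)
      exact ⟨by simpa using this 1 (Finset.mem_univ _), by simpa using this 2 (Finset.mem_univ _)⟩
    have h0' : u.1 * v.2 - u.2 * v.1 = 0 := h0
    obtain ⟨a1, a2⟩ := key v.2 (-u.2) (by ext <;> simp <;> linarith)
    obtain ⟨b1, b2⟩ := key v.1 (-u.1) (by ext <;> simp <;> linarith)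
    have := (key 1 0 (by ext <;> simp <;> linarith)).1
    exact one_ne_zero this
  · rw [← tri_eq_aff, coord_hull]

/-- Invertible linear maps of the plane have nonzero determinant in coordinates. -/
lemma linear_eq_aff (Ψ : (ℝ × ℝ) ≃ₗ[ℝ] (ℝ × ℝ)) :
    det2 (Ψ (1, 0)) (Ψ (0, 1)) ≠ 0 ∧ ∀ z, Ψ z = aff 0 (Ψ (1, 0)) (Ψ (0, 1)) z := by
  have h : ∀ z, Ψ z = aff 0 (Ψ (1, 0)) (Ψ (0, 1)) z := by
    intro z
    have : z = z.1 • ((1 : ℝ), (0 : ℝ)) + z.2 • ((0 : ℝ), (1 : ℝ)) := by ext <;> simp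
    conv_lhs => rw [this]
    rw [map_add, map_smul, map_smul]
    ext <;> simp
  refine ⟨fun h0 => ?_, h⟩
  set u := Ψ (1, 0)
  set v := Ψ (0, 1)
  have h0' : u.1 * v.2 - u.2 * v.1 = 0 := h0
  have k : ∀ z, aff 0 u v z = 0 → z = 0 := fun z hz => by
    rw [← h] at hz; exact Ψ.map_eq_zero_iff.1 hz
  have e1 := k (v.2, -u.2) (by ext <;> simp <;> linarith)
  have e2 := k (v.1, -u.1) (by ext <;> simp <;> linarith)
  simp only [Prod.mk_eq_zero, neg_eq_zero] at e1 e2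
  have := k (1, 0) (by ext <;> simp [e1, e2])
  simp at this

/-- The linear automorphism of the plane with given values on the standard basis. -/
def linOfFrame (u v : ℝ × ℝ) (h : det2 u v ≠ 0) : (ℝ × ℝ) ≃ₗ[ℝ] (ℝ × ℝ) :=
  LinearEquiv.ofInjectiveEndo
    ((LinearMap.fst ℝ ℝ ℝ).smulRight u + (LinearMap.snd ℝ ℝ ℝ).smulRight v) (by
      intro x y hxy
      apply aff_inj 0 u v h
      simpa [aff] using hxy)

lemma linOfFrame_apply (u v : ℝ × ℝ) (h : det2 u v ≠ 0) (z : ℝ × ℝ) :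
    linOfFrame u v h z = aff 0 u v z := by
  change (LinearMap.fst ℝ ℝ ℝ).smulRight u z + (LinearMap.snd ℝ ℝ ℝ).smulRight v z = _
  ext <;> simp

/-- The Banach–Mazur ratios between `K` and any triangle, in coordinates. An affine image of the
triangle is written as `x + Φ (T - y)` with `x` the centre of the homothety. -/
lemma banachMazurSet_eq {T : Set (EuclideanSpace ℝ (Fin 2))} (hT : RandomSimplex.IsTriangle T)
    (K : Set (EuclideanSpace ℝ (Fin 2))) :
    RandomSimplex.banachMazurSet K T = bm (coord '' K) := by
  obtain ⟨o, u, v, hd, hT0⟩ := triangle_frame hT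
  have hhom : ∀ x r w, coord x + r • (coord w - coord x) = hom (coord x) r (coord w) := by
    intro x r w; rw [hom_apply]; ext <;> simp <;> ring
  ext r
  constructor
  · rintro ⟨hr, Φ, x, y, h1, h2⟩
    obtain ⟨hΨ, hΨ'⟩ := linear_eq_aff
      ((coord.symm.toLinearEquiv.trans Φ).trans coord.toLinearEquiv)
    set Ψ := (coord.symm.toLinearEquiv.trans Φ).trans coord.toLinearEquiv with hΨd
    have hΦ : ∀ z, coord (Φ z) = Ψ (coord z) := by intro z; simp [hΨd]
    obtain ⟨o', u', v', e1, e2⟩ := image_aff_aff (coord x - Ψ (coord y)) (Ψ (1, 0)) (Ψ (0, 1)) o u v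
    have e3 : aff o' u' v' '' T0 = (fun t => coord x + coord (Φ (t - y))) '' T := by
      have : (fun t => coord x + coord (Φ (t - y))) =
          (fun z => coord x + (Ψ z - Ψ (coord y))) ∘ coord := by
        ext1 t; simp only [Function.comp, hΦ, map_sub]
      rw [this, image_comp, hT0, ← image_comp]
      refine image_congr fun z _ => ?_
      rw [e2, Function.comp, hΨ' (aff o u v z)]
      ext <;> simp <;> ring
    refine ⟨hr, o', u', v', coord x, by rw [e1]; exact mul_ne_zero hΨ hd, ?_, ?_⟩
    · rw [e3]
      rintro _ ⟨k, hk, rfl⟩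
      obtain ⟨t, ht, e⟩ := h1 ⟨k, hk, rfl⟩
      refine ⟨t, ht, ?_⟩
      simp only at e ⊢
      rw [e, map_sub]; abel
    · rw [e3]
      rintro _ ⟨t, ht, rfl⟩
      obtain ⟨k, hk, e⟩ := h2 ⟨t, ht, rfl⟩
      refine ⟨_, ⟨k, hk, rfl⟩, ?_⟩
      simp only at e ⊢
      rw [← e, ← hhom, map_smul, map_sub]
  · rintro ⟨hr, o₁, u₁, v₁, x', hd₁, h1, h2⟩
    obtain ⟨oi, ui, vi, hdi, -, i1, i2⟩ := aff_inv o u v hd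
    obtain ⟨o', u', v', e1, e2⟩ := image_aff_aff o₁ u₁ v₁ oi ui vi
    have hd' : det2 u' v' ≠ 0 := by rw [e1]; exact mul_ne_zero hd₁ hdi
    set Ψ := linOfFrame u' v' hd' with hΨd
    have hΨ : ∀ z, Ψ z + o' = aff o' u' v' z := by
      intro z; rw [hΨd, linOfFrame_apply]; ext <;> simp
    set Φ := (coord.toLinearEquiv.trans Ψ).trans coord.symm.toLinearEquiv with hΦd
    set x := coord.symm x' with hx
    set y := coord.symm (Ψ.symm (x' - o')) with hy
    have hΦ : ∀ t, coord x + coord (Φ (t - y)) = aff o' u' v' (coord t) := by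
      intro t
      rw [← hΨ]
      simp [hΦd, hx, hy]
      abel
    have e3 : aff o₁ u₁ v₁ '' T0 = (fun t => coord x + coord (Φ (t - y))) '' T := by
      have : (fun t => coord x + coord (Φ (t - y))) = aff o' u' v' ∘ coord := funext hΦ
      rw [this, image_comp, hT0, ← image_comp]
      refine image_congr fun z _ => ?_
      rw [Function.comp, e2, i1]
    rw [e3] at h1 h2
    have hx' : coord x = x' := by simp [hx]
    refine ⟨hr, Φ, x, y, ?_, ?_⟩
    · rintro _ ⟨k, hk, rfl⟩
      obtain ⟨t, ht, e⟩ := h1 ⟨k, hk, rfl⟩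
      refine ⟨t, ht, coord.injective ?_⟩
      simp only at e ⊢
      rw [map_sub coord, ← e, add_sub_cancel_left]
    · rintro _ ⟨t, ht, rfl⟩
      obtain ⟨_, ⟨k, hk, rfl⟩, e⟩ := h2 ⟨t, ht, rfl⟩
      refine ⟨k, hk, coord.injective ?_⟩
      simp only at e ⊢
      rw [← hx', ← hhom] at e
      rw [map_smul, map_sub]
      exact add_left_cancel e

lemma body_coord {K : Set (EuclideanSpace ℝ (Fin 2))} (h1 : IsCompact K) (h2 : Convex ℝ K)
    (h3 : (interior K).Nonempty) : Body (coord '' K) := by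
  refine ⟨h1.image coord.continuous, h2.linear_image coord.toLinearEquiv.toLinearMap, ?_⟩
  have := coord.toHomeomorph.image_interior K
  have e : interior (coord '' K) = coord '' interior K := this.symm
  rw [e]; exact h3.image _

lemma triangle_body {T : Set (EuclideanSpace ℝ (Fin 2))} (hT : RandomSimplex.IsTriangle T) :
    Body (coord '' T) := by
  obtain ⟨o, u, v, hd, h⟩ := triangle_frame hT
  rw [h]; exact T0_body.aff hd

lemma triangle_moments {T : Set (EuclideanSpace ℝ (Fin 2))} (hT : RandomSimplex.IsTriangle T)
    {p : ℝ} (hp : 1 ≤ p) : RandomSimplex.momentCentroid p T = Es p T0 ∧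
      RandomSimplex.momentRandom 3 p T = E3 p T0 := by
  rw [momentCentroid_eq hp (triangle_body hT), momentRandom_eq hp (triangle_body hT)]
  obtain ⟨o, u, v, hd, h⟩ := triangle_frame hT
  rw [h, Es_aff p T0_body hd, E3_aff p T0_body hd]
  exact ⟨rfl, rfl⟩

lemma exists_convexBody {K : Set (ℝ × ℝ)} (hK : Body K) :
    ∃ B : ConvexBody (EuclideanSpace ℝ (Fin 2)),
      (interior (B : Set (EuclideanSpace ℝ (Fin 2)))).Nonempty ∧
      coord '' (B : Set (EuclideanSpace ℝ (Fin 2))) = K := by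
  have hne : K.Nonempty := hK.int.mono interior_subset
  refine ⟨⟨coord.symm '' K, hK.cvx.linear_image coord.symm.toLinearEquiv.toLinearMap,
    hK.cpt.image coord.symm.continuous, hne.image _⟩, ?_, ?_⟩
  · have := coord.symm.toHomeomorph.image_interior K
    have e : interior (coord.symm '' K) = coord.symm '' interior K := this.symm
    change (interior (coord.symm '' K)).Nonempty
    rw [e]; exact hK.int.image _
  · change coord '' (coord.symm '' K) = K
    rw [← image_comp]; simp

end PlaneBody
end

theorem theorem2p2 :
    -- the stability estimate, with an absolute constant `c`
    (∃ c : ℝ, 0 < c ∧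
      ∀ T : Set (EuclideanSpace ℝ (Fin 2)), RandomSimplex.IsTriangle T →
      ∀ K : ConvexBody (EuclideanSpace ℝ (Fin 2)),
        (interior (K : Set (EuclideanSpace ℝ (Fin 2)))).Nonempty →
      ∀ δ : ℝ, 0 < δ → RandomSimplex.banachMazurDist (K : Set (EuclideanSpace ℝ (Fin 2))) T = 1 + δ →
      ∀ p : ℝ, 1 ≤ p →
        RandomSimplex.momentCentroid p (K : Set (EuclideanSpace ℝ (Fin 2))) ≤
            (1 - c ^ p * δ ^ 2) * RandomSimplex.momentCentroid p T ∧
        RandomSimplex.momentRandom 3 p (K : Set (EuclideanSpace ℝ (Fin 2))) ≤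
            (1 - c ^ p * δ ^ 2) * RandomSimplex.momentRandom 3 p T) ∧
    -- its sharpness as `δ` tends to zero: the order `δ ^ 2` is attained for every small `δ`
    (∃ C : ℝ, 0 < C ∧ ∃ δ₀ : ℝ, 0 < δ₀ ∧
      ∀ T : Set (EuclideanSpace ℝ (Fin 2)), RandomSimplex.IsTriangle T →
      ∀ δ : ℝ, 0 < δ → δ < δ₀ →
      ∃ K : ConvexBody (EuclideanSpace ℝ (Fin 2)),
        (interior (K : Set (EuclideanSpace ℝ (Fin 2)))).Nonempty ∧
        RandomSimplex.banachMazurDist (K : Set (EuclideanSpace ℝ (Fin 2))) T = 1 + δ ∧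
        ∀ p : ℝ, 1 ≤ p →
          (1 - C ^ p * δ ^ 2) * RandomSimplex.momentCentroid p T ≤
              RandomSimplex.momentCentroid p (K : Set (EuclideanSpace ℝ (Fin 2))) ∧
          (1 - C ^ p * δ ^ 2) * RandomSimplex.momentRandom 3 p T ≤
              RandomSimplex.momentRandom 3 p (K : Set (EuclideanSpace ℝ (Fin 2)))) := by
  constructor
  · obtain ⟨c, hc0, h⟩ := PlaneBody.plane_stability
    refine ⟨c, hc0, fun T hT K hK δ hδ hd p hp => ?_⟩
    have hB := PlaneBody.body_coord K.isCompact K.convex hK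
    rw [RandomSimplex.banachMazurDist, PlaneBody.banachMazurSet_eq hT] at hd
    rw [PlaneBody.momentCentroid_eq hp hB, PlaneBody.momentRandom_eq hp hB,
      (PlaneBody.triangle_moments hT hp).1,
      (PlaneBody.triangle_moments hT hp).2]
    exact h _ hB δ hδ hd p hp
  · obtain ⟨C, hC0, δ₀, hδ₀, h⟩ := PlaneBody.plane_sharp
    refine ⟨C, hC0, δ₀, hδ₀, fun T hT δ hδ hδ1 => ?_⟩
    obtain ⟨K, hK, hd, hm⟩ := h δ hδ hδ1
    obtain ⟨B, hB, rfl⟩ := PlaneBody.exists_convexBody hK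
    refine ⟨B, hB, ?_, fun p hp => ?_⟩
    · rw [RandomSimplex.banachMazurDist, PlaneBody.banachMazurSet_eq hT, hd]
    · rw [PlaneBody.momentCentroid_eq hp hK, PlaneBody.momentRandom_eq hp hK,
        (PlaneBody.triangle_moments hT hp).1,
        (PlaneBody.triangle_moments hT hp).2]
      exact hm p hp
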